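/- Let $u_0:\mathbb R\to\mathbb R$ be strictly decreasing with $\lim_{x\to-\infty}u_0(x)=1$, $\lim_{x\to+\infty}u_0(x)=0$, and let $f:(0,1)\to\mathbb R$ be its inverse function. Assume that $f\in C^3(0,1)$, that $f(u)\to+\infty$ as $u\to0$ and $f(u)\to-\infty$ as $u\to1$, that $f'''<0$ near $u=0$ and near $u=1$, and that $\int_0^{\infty}\sqrt{u_0(y)}\,dy<\infty$. For real $x$ and $t$, and $\eta\in(0,1)$, put $$a(\eta,x,t)=\eta x-16\eta^5t-\theta(\eta),\qquad \theta(\eta)=\eta f(\eta^2)+\int_{f(\eta^2)}^{\infty}\Big[\eta-\sqrt{\eta^2-u_0(y)}\Big]dy,$$ and consider the problem of minimizing $$-\frac1{2\pi}\int_0^1\!\!\int_0^1\log\Big|\frac{\eta-\mu}{\eta+\mu}\Big|\,\psi(\eta)\psi(\mu)\,d\eta\,d\mu+\int_0^1a(\eta,x,t)\psi(\eta)\,d\eta\qquad(\ast)$$ (with values in the extended reals) over all $\psi\ge0$, $\psi\in L^1(0,1)$. For $\xi,u\in(0,1)$ let $H(u)=x-30tu^2-f(u)$ and $$\Phi_0(\xi,u)=\frac1{2\sqrt2}\int_{-1}^1\frac{H'\big(\frac{1+\mu}2\xi+\frac{1-\mu}2u\big)}{\sqrt{1-\mu}}\,d\mu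 .$$ There are constants $T^-,T^+>0$ with the following properties. (i) For every $t>T^-$ the trailing edge equations $\Phi_0(u_3,u_1)=0$, $\partial_\xi\Phi_0(\xi,u_1)|_{\xi=u_3}=0$, $x-30tu_1^2-f(u_1)=0$ have exactly one solution $(u_1,u_3,x)=(u_1^-(t),u_3^-(t),x^-(t))$ with $0<u_3<u_1<1$. (ii) For every $t>T^+$ the leading edge equations $\Phi_0(u_1,u_3)=0$, $\int_{u_3}^{u_1}\Phi_0(\xi,u_3)\sqrt{\xi-u_3}\,d\xi=0$, $x-30tu_3^2-f(u_3)=0$ have exactly one solution $(u_1,u_3,x)=(u_1^+(t),u_3^+(t),x^+(t))$ with $0<u_3<u_1<1$. (iii) For every $t>\max\{T^-,T^+\}$ and every $x$ with $x\le x^-(t)$ or $x\ge x^+(t)$ there is $u\in(0,1)$, with $u\ge u_1^-(t)$ if $x\le x^-(t)$ and $u\le u_3^+(t)$ if $x\ge x^+(t)$, such that $$x-30tu^2-f(u)=0,$$ $$-\sqrt{u-\xi}\;\Phi_0(\xi,u)<0\quad(0<\xi<u),\qquad \int_u^{\xi}\sqrt{v-u}\;\Phi_0(v,u)\,dv>0\quad(u<\xi<1),$$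 where the first inequality is not asserted at the single point $\xi=u_3^-(t)$ when $x=x^-(t)$, and the second is not asserted at the single point $\xi=u_1^+(t)$ when $x=x^+(t)$. Moreover the function $\psi(\eta)=2\eta\sqrt{u-\eta^2}\,\Phi_0(\eta^2,u)$ for $0<\eta<\sqrt u$, $\psi(\eta)=0$ otherwise, is a minimizer of $(\ast)$; it is the only one up to null sets; and its support is the single interval $[0,\sqrt u]$. -/

import Mathlib

open MeasureTheory Set Filter Topology

noncomputable section

namespace FifthKdV

/-- Decreasing initial data `u₀` running from `1` to `0`, together with its inverse function `f`
on `(0,1)`. -/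
structure InitialData (u₀ f : ℝ → ℝ) : Prop where
  strictAnti : StrictAnti u₀
  tendsto_atBot : Tendsto u₀ atBot (𝓝 1)
  tendsto_atTop : Tendsto u₀ atTop (𝓝 0)
  /-- `f` is the inverse function of `u₀`. -/
  inverse : ∀ u ∈ Ioo (0 : ℝ) 1, u₀ (f u) = u
  smooth : ContDiffOn ℝ 3 f (Ioo 0 1)
  f_zero : Tendsto f (𝓝[>] 0) atTop
  f_one : Tendsto f (𝓝[<] 1) atBot
  third_zero : ∀ᶠ u in 𝓝[>] (0 : ℝ), iteratedDeriv 3 f u < 0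
  third_one : ∀ᶠ u in 𝓝[<] (1 : ℝ), iteratedDeriv 3 f u < 0
  /-- The decay at `+∞` needed for `θ` to be finite and for the minimizer, whose mass is
  of the size of `∫ √u₀`, to lie in `L¹`. -/
  decay : IntegrableOn (fun y => √(u₀ y)) (Ioi 0)

/-- `θ(η) = η f(η²) + ∫_{f(η²)}^∞ (η - √(η² - u₀(y))) dy`. -/
def theta (u₀ f : ℝ → ℝ) (η : ℝ) : ℝ :=
  η * f (η ^ 2) + ∫ y in Ioi (f (η ^ 2)), (η - √(η ^ 2 - u₀ y))

/-- `a(η,x,t) = η x - 16 η⁵ t - θ(η)`. -/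
def aFun (u₀ f : ℝ → ℝ) (x t η : ℝ) : ℝ :=
  η * x - 16 * η ^ 5 * t - theta u₀ f η

/-- The functional
`-(1/2π) ∫₀¹∫₀¹ log|(η-μ)/(η+μ)| φ(η) φ(μ) dη dμ + ∫₀¹ a(η,x,t) φ(η) dη`, with values in the
extended reals. For `φ ≥ 0` the double integral has a nonnegative integrand, so it is taken as a
lower Lebesgue integral; the second integral is the difference of the integrals of the positive
and negative parts. -/
def functional (u₀ f : ℝ → ℝ) (x t : ℝ) (φ : ℝ → ℝ) : EReal :=
  ((ENNReal.ofReal (1 / (2 * Real.pi)) *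
      ∫⁻ η in Ioo (0 : ℝ) 1, ∫⁻ μ in Ioo (0 : ℝ) 1,
        ENNReal.ofReal (-Real.log |(η - μ) / (η + μ)| * φ η * φ μ) : ENNReal) : EReal)
  + ((∫⁻ η in Ioo (0 : ℝ) 1, ENNReal.ofReal (aFun u₀ f x t η * φ η) : ENNReal) : EReal)
  - ((∫⁻ η in Ioo (0 : ℝ) 1, ENNReal.ofReal (-(aFun u₀ f x t η * φ η)) : ENNReal) : EReal)

/-- The competitors: `φ ≥ 0` (almost everywhere) and `φ ∈ L¹(0,1)`. -/
def Admissible (φ : ℝ → ℝ) : Prop :=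
  (∀ᵐ η ∂(volume.restrict (Ioo (0 : ℝ) 1)), 0 ≤ φ η) ∧ IntegrableOn φ (Ioo 0 1)

/-- `φ` solves the minimization problem at `(x,t)`. -/
def IsMinimizer (u₀ f : ℝ → ℝ) (x t : ℝ) (φ : ℝ → ℝ) : Prop :=
  Admissible φ ∧ ∀ χ, Admissible χ → functional u₀ f x t φ ≤ functional u₀ f x t χ

/-- `H(u) = x - 30 t u² - f(u)`. -/
def hodograph (f : ℝ → ℝ) (x t u : ℝ) : ℝ :=
  x - 30 * t * u ^ 2 - f u

/-- `Φ₀(ξ,u)`, the solution of `2(ξ-u) Φ_{ξu} = Φ_ξ - 2Φ_u`, `Φ(u,u) = H'(u)`, by its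
explicit formula
`(1/(2√2)) ∫_{-1}^1 H'((1+μ)/2 ξ + (1-μ)/2 u) / √(1-μ) dμ`. -/
def phi0 (f : ℝ → ℝ) (x t ξ u : ℝ) : ℝ :=
  1 / (2 * √2) * ∫ μ in (-1 : ℝ)..1,
    deriv (hodograph f x t) ((1 + μ) / 2 * ξ + (1 - μ) / 2 * u) / √(1 - μ)

/-- The trailing edge equations. -/
def IsTrailingEdge (f : ℝ → ℝ) (t u₁ u₃ x : ℝ) : Prop :=
  0 < u₃ ∧ u₃ < u₁ ∧ u₁ < 1 ∧
  phi0 f x t u₃ u₁ = 0 ∧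
  HasDerivAt (fun ξ => phi0 f x t ξ u₁) 0 u₃ ∧
  hodograph f x t u₁ = 0

/-- The leading edge equations. -/
def IsLeadingEdge (f : ℝ → ℝ) (t u₁ u₃ x : ℝ) : Prop :=
  0 < u₃ ∧ u₃ < u₁ ∧ u₁ < 1 ∧
  phi0 f x t u₁ u₃ = 0 ∧
  (∫ ξ in u₃..u₁, phi0 f x t ξ u₃ * √(ξ - u₃)) = 0 ∧
  hodograph f x t u₃ = 0

/-- `Re(√(-1) R(ξ,u))` for `R(ξ,u) = √(ξ - u)`: it equals `-√(u - ξ)` for `ξ < u`, and `0` for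
`ξ ≥ u` (the real square root of a negative number is `0` here). -/
def reIR (ξ u : ℝ) : ℝ := -√(u - ξ)

/-- `ψ(η) = -2 η Re(√(-1) R(η²,u)) Φ₀(η²,u)` on `(0,1)`, extended by `0`. -/
def psi (f : ℝ → ℝ) (x t u : ℝ) : ℝ → ℝ :=
  indicator (Ioo 0 1) (fun η => -2 * η * reIR (η ^ 2) u * phi0 f x t (η ^ 2) u)

end FifthKdV

end

/-!
The kernel `-log |(η-μ)/(η+μ)|` is the square of the Abel kernel `1/√(η²-s)`
(`lintegral_abelKernel_mul`), so the quadratic part of the functional is `(2π)⁻¹ ∫₀¹ (Tφ)² ds`,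
where `Tφ(s)` is the integral of `φ(η)/√(η²-s)` over `√s < η < 1` (`lintegral_log_energy`). The
linear coefficient is itself an Abel transform, `a(η) = ½ ∫ H(s)/√(η²-s) ds` over `0 < s < η²`
(`InitialData.aFun_eq`). If `H(u) = 0`, then `Tψ` equals `-(π/2) H` on `(0,u)` and vanishes beyond
`u` (`OneInterval.abelT_psi`). Nonnegativity of `Φ₀(·,u)` on `(0,u)` makes `ψ` admissible;
nonnegativity of the weighted primitive of `Φ₀(·,u)` on `(u,1)` says exactly that `a(η)` is at least
the part of its integral over `(0,u)`. Completing the square, the functional exceeds its value at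
`ψ` by at least `(2π)⁻¹ ∫₀¹ (Tφ-Tψ)² ds` (`OneInterval.functional_excess`), and Abel inversion
(`ae_eq_of_abelT_ae_eq`) turns equality into `φ = ψ` almost everywhere.

It remains to find the edges and to check the two inequalities. For `t` large, `h = H'`, which does
not depend on `x`, is positive, negative, positive on `(0,a)`, `(a,b)`, `(b,1)`, with `a` close to
`0` and `b` close to `1`. The function `Φ₀(·,u)` is strictly convex on `(u,1)` for `u` near `0` and
on `(0,u)` for `u` near `1`: in its second derivative the contribution of `-f'''` near the end point
is of the size of `|f(u)|`, which tends to infinity (`Profile.second_deriv_pos_left`). For the other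
`u > a` it is decreasing on `(0,u)`. These facts are collected in `Shape`, for one threshold `T`
that serves for both edges (`InitialData.exists_shape`).

At the trailing edge, `Φ₀(·,u₁)` touches zero from above at `u₃`. Such a `u₁` appears as `u` is
lowered from near `1`, where `Φ₀(·,u) > 0`, to `b`, where it is not (`exists_touching`). Convexity
makes the touching point the only zero, and `u₁ > b`, so that enlarging `u` adds a positive
contribution: this gives uniqueness and the inequality on `(0,u)` for every `u > u₁`. On `(u,1)` the
inequality is clear, because `h > 0` there. The leading edge is the mirror image, with `u` raised
from near `0` to `a` and with the weighted primitive of `Φ₀(·,u)` in the place of `Φ₀(·,u)`.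
-/

noncomputable section

namespace FifthKdV

/-! ### Elementary Abel-type integrals -/

theorem setLIntegral_eq_of_subset_of_eq_zero {α : Type*} [MeasurableSpace α] {ν : Measure α}
    {A B : Set α} (hAB : A ⊆ B) (hA : MeasurableSet A) {F : α → ENNReal}
    (h : ∀ x ∈ B, x ∉ A → F x = 0) (hB : MeasurableSet B) :
    ∫⁻ x in B, F x ∂ν = ∫⁻ x in A, F x ∂ν := by
  rw [← lintegral_inter_add_sdiff F B hA, inter_eq_self_of_subset_right hAB]
  have : ∫⁻ x in B \ A, F x ∂ν = 0 := by
    rw [setLIntegral_congr_fun (g := fun _ => 0) (hB.diff hA) (fun x hx => h x hx.1 hx.2)]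
    simp
  rw [this, add_zero]

/-- The fundamental theorem of calculus for a nonnegative, possibly unbounded derivative, as a
lower Lebesgue integral. -/
theorem lintegral_deriv_of_nonneg {G g : ℝ → ℝ} {p q : ℝ} (hpq : p ≤ q)
    (hG : ContinuousOn G (Icc p q)) (hd : ∀ x ∈ Ioo p q, HasDerivAt G (g x) x)
    (hg : ∀ x ∈ Ioo p q, 0 ≤ g x) :
    ∫⁻ x in Ioo p q, ENNReal.ofReal (g x) = ENNReal.ofReal (G q - G p) := by
  have hint := intervalIntegral.integrableOn_deriv_of_nonneg hG hd hg
  have h1 := intervalIntegral.integral_eq_sub_of_hasDerivAt_of_le hpq hG hd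
    ((intervalIntegrable_iff_integrableOn_Ioc_of_le hpq).2 hint)
  rw [← h1, intervalIntegral.integral_of_le hpq, integral_Ioc_eq_integral_Ioo,
    ofReal_integral_eq_lintegral_ofReal (hint.mono_set Ioo_subset_Ioc_self)]
  exact (ae_restrict_iff' measurableSet_Ioo).2 (ae_of_all _ hg)

theorem lintegral_inv_sqrt_sub_right {p q : ℝ} (hpq : p ≤ q) :
    ∫⁻ s in Ioo p q, ENNReal.ofReal ((√(q - s))⁻¹) = ENNReal.ofReal (2 * √(q - p)) := by
  rw [lintegral_deriv_of_nonneg (G := fun s => -(2 * √(q - s))) hpq (by fun_prop)]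
  · simp
  · intro s hs
    have h0 : q - s ≠ 0 := (sub_pos.2 hs.2).ne'
    have := (((hasDerivAt_id s).const_sub q).sqrt h0).const_mul 2 |>.neg
    refine this.congr_deriv ?_
    have : √(q - s) ≠ 0 := (Real.sqrt_pos.2 (sub_pos.2 hs.2)).ne'
    simp only [id]
    field_simp
  · intros; positivity

theorem lintegral_inv_sqrt_sub_left {p q : ℝ} (hpq : p ≤ q) :
    ∫⁻ s in Ioo p q, ENNReal.ofReal ((√(s - p))⁻¹) = ENNReal.ofReal (2 * √(q - p)) := by
  rw [lintegral_deriv_of_nonneg (G := fun s => 2 * √(s - p)) hpq (by fun_prop)]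
  · simp
  · intro s hs
    have h0 : s - p ≠ 0 := (sub_pos.2 hs.1).ne'
    have := (((hasDerivAt_id s).sub_const p).sqrt h0).const_mul 2
    refine this.congr_deriv ?_
    have : √(s - p) ≠ 0 := (Real.sqrt_pos.2 (sub_pos.2 hs.1)).ne'
    simp only [id]
    field_simp
  · intros; positivity

theorem hasDerivAt_arcsin_affine {p q x : ℝ} (hx : x ∈ Ioo p q) :
    HasDerivAt (fun x => Real.arcsin ((2 * x - p - q) / (q - p)))
      ((√(x - p))⁻¹ * (√(q - x))⁻¹) x := by
  obtain ⟨h1, h2⟩ := hx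
  have hqp : 0 < q - p := by linarith
  have hz1 : (2 * x - p - q) / (q - p) ≠ -1 := by
    intro h; rw [div_eq_iff hqp.ne'] at h; linarith
  have hz2 : (2 * x - p - q) / (q - p) ≠ 1 := by
    intro h; rw [div_eq_iff hqp.ne'] at h; linarith
  have hl : HasDerivAt (fun x : ℝ => (2 * x - p - q) / (q - p)) (2 / (q - p)) x := by
    have := ((((hasDerivAt_id x).const_mul 2).sub_const p).sub_const q).div_const (q - p)
    simpa using this
  refine ((Real.hasDerivAt_arcsin hz1 hz2).comp x hl).congr_deriv ?_
  have e : 1 - ((2 * x - p - q) / (q - p)) ^ 2 = (2 / (q - p)) ^ 2 * ((x - p) * (q - x)) := by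
    field_simp; ring
  rw [e, Real.sqrt_mul (by positivity), Real.sqrt_sq (by positivity),
    Real.sqrt_mul (by linarith)]
  have a1 : √(x - p) ≠ 0 := (Real.sqrt_pos.2 (by linarith)).ne'
  have a2 : √(q - x) ≠ 0 := (Real.sqrt_pos.2 (by linarith)).ne'
  field_simp

/-- The Beta integral `∫ ds / √((s-p)(q-s)) = π`. -/
theorem lintegral_beta {p q : ℝ} (hpq : p < q) :
    ∫⁻ s in Ioo p q, ENNReal.ofReal ((√(s - p))⁻¹ * (√(q - s))⁻¹) = ENNReal.ofReal Real.pi := by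
  have hqp : q - p ≠ 0 := (sub_pos.2 hpq).ne'
  rw [lintegral_deriv_of_nonneg (G := fun x => Real.arcsin ((2 * x - p - q) / (q - p))) hpq.le
    (Real.continuous_arcsin.comp (by fun_prop)).continuousOn
    (fun x hx => hasDerivAt_arcsin_affine hx) (fun x _ => by positivity)]
  congr 1
  have e1 : (2 * q - p - q) / (q - p) = 1 := by field_simp; ring
  have e2 : (2 * p - p - q) / (q - p) = -1 := by field_simp; ring
  rw [e1, e2, Real.arcsin_one, Real.arcsin_neg_one]; ring

/-- The Abel kernel `1 / √(η² - s)` for `s < η²`. Since the real square root of a negative number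
is `0`, and `0⁻¹ = 0`, it vanishes for `s ≥ η²`. -/
def abelKernel (s η : ℝ) : ℝ := (√(η ^ 2 - s))⁻¹

theorem abelKernel_nonneg (s η : ℝ) : 0 ≤ abelKernel s η := by
  unfold abelKernel; positivity

theorem abelKernel_eq_zero {s η : ℝ} (h : η ^ 2 ≤ s) : abelKernel s η = 0 := by
  unfold abelKernel; rw [Real.sqrt_eq_zero_of_nonpos (by linarith)]; simp

theorem measurable_abelKernel : Measurable (Function.uncurry abelKernel) := by
  unfold abelKernel Function.uncurry; fun_prop

/-- The Beta integral in the variable `η² = s`. -/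
theorem lintegral_beta_sq {s r : ℝ} (hs : 0 ≤ s) (hsr : s < r) (hr : r ≤ 1) :
    ∫⁻ η in Ioo (0 : ℝ) 1, ENNReal.ofReal (η * abelKernel s η * (√(r - η ^ 2))⁻¹) =
      ENNReal.ofReal (Real.pi / 2) := by
  have hs' := Real.sqrt_nonneg s
  have hr1 : √r ≤ 1 := Real.sqrt_le_one.2 hr
  have hsr' : √s < √r := Real.sqrt_lt_sqrt hs hsr
  have hrs : r - s ≠ 0 := (sub_pos.2 hsr).ne'
  rw [setLIntegral_eq_of_subset_of_eq_zero (A := Ioo (√s) (√r)) (Ioo_subset_Ioo hs' hr1)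
    measurableSet_Ioo _ measurableSet_Ioo]
  · rw [lintegral_deriv_of_nonneg
      (G := fun x => 1 / 2 * Real.arcsin ((2 * x ^ 2 - s - r) / (r - s))) hsr'.le
      (Continuous.continuousOn (by
        have : Continuous fun x : ℝ => (2 * x ^ 2 - s - r) / (r - s) := by fun_prop
        exact continuous_const.mul (Real.continuous_arcsin.comp this)))]
    · congr 1
      rw [Real.sq_sqrt hs, Real.sq_sqrt (hs.trans hsr.le)]
      have e1 : (2 * r - s - r) / (r - s) = 1 := by field_simp; ring
      have e2 : (2 * s - s - r) / (r - s) = -1 := by field_simp; ring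
      rw [e1, e2, Real.arcsin_one, Real.arcsin_neg_one]; ring
    · intro x hx
      have hx0 : 0 < x := hs'.trans_lt hx.1
      have hx2 : x ^ 2 ∈ Ioo s r := ⟨(Real.sqrt_lt' hx0).1 hx.1, (Real.lt_sqrt hx0.le).1 hx.2⟩
      have := (HasDerivAt.comp (h := fun y : ℝ => y ^ 2) x (hasDerivAt_arcsin_affine hx2)
        (hasDerivAt_pow 2 x)).const_mul (1 / 2)
      refine this.congr_deriv ?_
      simp [abelKernel]; ring
    · intro x hx
      have hx0 : 0 < x := hs'.trans_lt hx.1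
      have := abelKernel_nonneg s x
      positivity
  · intro x hx hx'
    rcases le_or_gt (x ^ 2) s with h | h
    · simp [abelKernel_eq_zero h]
    · have : r ≤ x ^ 2 := by
        by_contra hc
        exact hx' ⟨(Real.sqrt_lt' hx.1).2 h, (Real.lt_sqrt hx.1.le).2 (not_le.1 hc)⟩
      rw [Real.sqrt_eq_zero_of_nonpos (by linarith : r - x ^ 2 ≤ 0)]; simp

theorem lintegral_abelKernel_mul_of_lt {η μ : ℝ} (hμ : 0 < μ) (hμη : μ < η) (hη : η < 1) :
    ∫⁻ s in Ioo (0 : ℝ) 1, ENNReal.ofReal (abelKernel s η * abelKernel s μ) =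
      ENNReal.ofReal (-Real.log |(η - μ) / (η + μ)|) := by
  have hμ2 : 0 < μ ^ 2 := by positivity
  have hlt : μ ^ 2 < η ^ 2 := by nlinarith
  have hμ1 : μ ^ 2 ≤ 1 := by nlinarith
  rw [setLIntegral_eq_of_subset_of_eq_zero (A := Ioo 0 (μ ^ 2)) (Ioo_subset_Ioo le_rfl hμ1)
    measurableSet_Ioo _ measurableSet_Ioo]
  · have hpos : ∀ s ≤ μ ^ 2, 0 < √(η ^ 2 - s) + √(μ ^ 2 - s) := fun s hs => by
      have := Real.sqrt_pos.2 (by linarith : 0 < η ^ 2 - s)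
      positivity
    rw [lintegral_deriv_of_nonneg
      (G := fun s => -(2 * Real.log (√(η ^ 2 - s) + √(μ ^ 2 - s)))) hμ2.le]
    · congr 1
      have h1 : √(η ^ 2 - 0) = η := by rw [sub_zero, Real.sqrt_sq (by linarith)]
      have h2 : √(μ ^ 2 - 0) = μ := by rw [sub_zero, Real.sqrt_sq hμ.le]
      have h3 : η ^ 2 - μ ^ 2 = (η - μ) * (η + μ) := by ring
      have p1 : 0 < η - μ := by linarith
      have p2 : 0 < η + μ := by linarith
      rw [h1, h2, sub_self, Real.sqrt_zero, add_zero, Real.log_sqrt (by linarith), h3,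
        Real.log_mul p1.ne' p2.ne', abs_of_pos (div_pos p1 p2), Real.log_div p1.ne' p2.ne']
      ring
    · refine (continuousOn_const.mul (ContinuousOn.log (by fun_prop) ?_)).neg
      exact fun s hs => (hpos s hs.2).ne'
    · intro s hs
      have q1 : 0 < η ^ 2 - s := by linarith [hs.2]
      have q2 : 0 < μ ^ 2 - s := by linarith [hs.2]
      have r1 := Real.sqrt_pos.2 q1
      have r2 := Real.sqrt_pos.2 q2
      have d1 := ((hasDerivAt_id s).const_sub (η ^ 2)).sqrt q1.ne'
      have d2 := ((hasDerivAt_id s).const_sub (μ ^ 2)).sqrt q2.ne'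
      have := (((d1.add d2).log (hpos s hs.2.le).ne').const_mul 2).neg
      refine this.congr_deriv ?_
      simp only [abelKernel, id, Pi.add_apply]
      have := (hpos s hs.2.le).ne'
      field_simp
      ring
    · intro s _
      exact mul_nonneg (abelKernel_nonneg _ _) (abelKernel_nonneg _ _)
  · intro s hs hs'
    have : μ ^ 2 ≤ s := by
      by_contra hc
      exact hs' ⟨hs.1, not_le.1 hc⟩
    simp [abelKernel_eq_zero this]

/-- The logarithmic kernel is the square of the Abel kernel. -/
theorem lintegral_abelKernel_mul {η μ : ℝ} (hη : η ∈ Ioo (0 : ℝ) 1) (hμ : μ ∈ Ioo (0 : ℝ) 1)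
    (hne : μ ≠ η) :
    ∫⁻ s in Ioo (0 : ℝ) 1, ENNReal.ofReal (abelKernel s η * abelKernel s μ) =
      ENNReal.ofReal (-Real.log |(η - μ) / (η + μ)|) := by
  rcases lt_or_gt_of_ne hne with h | h
  · exact lintegral_abelKernel_mul_of_lt hμ.1 h hη.2
  · have := lintegral_abelKernel_mul_of_lt hη.1 h hμ.2
    rw [abs_div, abs_sub_comm, add_comm, ← abs_div, ← this]
    simp only [mul_comm]

/-! ### The Abel transform -/

/-- The Abel transform `Tχ(s) = ∫_{√s}^1 χ(η) / √(η² - s) dη` of a nonnegative density, with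
values in `[0, ∞]`. -/
def abelT (χ : ℝ → ℝ) (s : ℝ) : ENNReal :=
  ∫⁻ η in Ioo (0 : ℝ) 1, ENNReal.ofReal (χ η * abelKernel s η)

theorem measurable_abelT_integrand {χ : ℝ → ℝ} (hχ : Measurable χ) :
    Measurable (Function.uncurry fun s η => ENNReal.ofReal (χ η * abelKernel s η)) := by
  have := measurable_abelKernel
  exact ((hχ.comp measurable_snd).mul this).ennreal_ofReal

theorem measurable_abelT {χ : ℝ → ℝ} (hχ : Measurable χ) : Measurable (abelT χ) :=
  (measurable_abelT_integrand hχ).lintegral_prod_right'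

theorem abelT_toReal {χ : ℝ → ℝ} (hχ : Measurable χ) (h0 : ∀ η, 0 ≤ χ η) (s : ℝ) :
    (abelT χ s).toReal = ∫ η in Ioo (0 : ℝ) 1, χ η * abelKernel s η := by
  have hm : Measurable fun η => abelKernel s η :=
    measurable_abelKernel.comp (measurable_const.prodMk measurable_id)
  rw [integral_eq_lintegral_of_nonneg_ae (ae_of_all _ fun η => mul_nonneg (h0 η)
    (abelKernel_nonneg s η)) (hχ.mul hm).aestronglyMeasurable]
  rfl

/-- The logarithmic energy is the squared `L²` norm of the Abel transform. -/
theorem lintegral_log_energy {χ : ℝ → ℝ} (hχ : Measurable χ) (h0 : ∀ η, 0 ≤ χ η) :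
    ∫⁻ η in Ioo (0 : ℝ) 1, ∫⁻ μ in Ioo (0 : ℝ) 1,
        ENNReal.ofReal (-Real.log |(η - μ) / (η + μ)| * χ η * χ μ) =
      ∫⁻ s in Ioo (0 : ℝ) 1, abelT χ s ^ 2 := by
  set G : ℝ → ℝ → ENNReal := fun s η => ENNReal.ofReal (χ η * abelKernel s η) with hG
  have hGm := measurable_abelT_integrand hχ
  have hG1 : Measurable fun p : ℝ × ℝ => G p.1 p.2 := hGm
  have hG2 : Measurable fun p : ℝ × ℝ => G p.2 p.1 := hGm.comp measurable_swap
  have hTm := measurable_abelT hχ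
  have key : ∀ η ∈ Ioo (0 : ℝ) 1, ∫⁻ μ in Ioo (0 : ℝ) 1,
      ENNReal.ofReal (-Real.log |(η - μ) / (η + μ)| * χ η * χ μ) =
      ∫⁻ s in Ioo (0 : ℝ) 1, G s η * abelT χ s := by
    intro η hη
    have hGη : Measurable fun s => G s η := hG1.comp (measurable_id.prodMk measurable_const)
    have e1 : ∫⁻ μ in Ioo (0 : ℝ) 1,
        ENNReal.ofReal (-Real.log |(η - μ) / (η + μ)| * χ η * χ μ) =
        ∫⁻ μ in Ioo (0 : ℝ) 1, ∫⁻ s in Ioo (0 : ℝ) 1, G s η * G s μ := by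
      refine lintegral_congr_ae ?_
      have hne : ∀ᵐ μ ∂(volume.restrict (Ioo (0 : ℝ) 1)), μ ≠ η :=
        ae_restrict_of_ae (by simp [ae_iff, measure_singleton])
      filter_upwards [hne, ae_restrict_mem measurableSet_Ioo] with μ hμ hμ'
      have e3 : ∀ s, G s η * G s μ =
          ENNReal.ofReal (χ η * χ μ) * ENNReal.ofReal (abelKernel s η * abelKernel s μ) := by
        intro s
        simp only [hG]
        rw [← ENNReal.ofReal_mul (mul_nonneg (h0 η) (abelKernel_nonneg _ _)),
          ← ENNReal.ofReal_mul (mul_nonneg (h0 η) (h0 μ))]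
        congr 1; ring
      simp_rw [e3]
      rw [lintegral_const_mul' _ _ ENNReal.ofReal_ne_top, lintegral_abelKernel_mul hη hμ' hμ,
        ← ENNReal.ofReal_mul (mul_nonneg (h0 η) (h0 μ))]
      congr 1; ring
    rw [e1, lintegral_lintegral_swap]
    · refine lintegral_congr fun s => ?_
      rw [lintegral_const_mul' _ _ ENNReal.ofReal_ne_top]
      rfl
    · exact ((hGη.comp measurable_snd).mul hG2).aemeasurable
  rw [setLIntegral_congr_fun measurableSet_Ioo key, lintegral_lintegral_swap]
  · refine lintegral_congr fun s => ?_
    have : Measurable fun η => G s η := hG1.comp (measurable_const.prodMk measurable_id)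
    rw [lintegral_mul_const _ this, sq]
    rfl
  · exact (hG2.mul (hTm.comp measurable_snd)).aemeasurable

/-- Abel inversion: the Abel transform determines the tails of the density. -/
theorem lintegral_abelT_mul_inv_sqrt {χ : ℝ → ℝ} (hχ : Measurable χ) (h0 : ∀ η, 0 ≤ χ η)
    {w : ℝ} (hw : 0 ≤ w) :
    ∫⁻ s in Ioo w 1, abelT χ s * ENNReal.ofReal ((√(s - w))⁻¹) =
      ENNReal.ofReal Real.pi * ∫⁻ η in Ioo (√w) 1, ENNReal.ofReal (χ η) := by
  have hGm := measurable_abelT_integrand hχ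
  have hsw : Measurable fun s : ℝ => ENNReal.ofReal ((√(s - w))⁻¹) := by fun_prop
  have e1 : ∀ s, abelT χ s * ENNReal.ofReal ((√(s - w))⁻¹) = ∫⁻ η in Ioo (0 : ℝ) 1,
      ENNReal.ofReal (χ η) * ENNReal.ofReal ((√(s - w))⁻¹ * (√(η ^ 2 - s))⁻¹) := by
    intro s
    rw [abelT, ← lintegral_mul_const' _ _ ENNReal.ofReal_ne_top]
    refine lintegral_congr fun η => ?_
    rw [← ENNReal.ofReal_mul (mul_nonneg (h0 η) (abelKernel_nonneg _ _)),
      ← ENNReal.ofReal_mul (h0 η)]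
    congr 1; unfold abelKernel; ring
  simp_rw [e1]
  rw [lintegral_lintegral_swap]
  · have e2 : ∀ η ∈ Ioo (0 : ℝ) 1, ∫⁻ s in Ioo w 1,
        ENNReal.ofReal (χ η) * ENNReal.ofReal ((√(s - w))⁻¹ * (√(η ^ 2 - s))⁻¹) =
        (Ioo (√w) 1).indicator (fun η => ENNReal.ofReal Real.pi * ENNReal.ofReal (χ η)) η := by
      intro η hη
      rw [lintegral_const_mul' _ _ ENNReal.ofReal_ne_top]
      by_cases h : √w < η
      · have hwη : w < η ^ 2 := (Real.sqrt_lt' hη.1).1 h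
        have hη1 : η ^ 2 ≤ 1 := by nlinarith [hη.1, hη.2]
        rw [indicator_of_mem (show η ∈ Ioo (√w) 1 from ⟨h, hη.2⟩),
          setLIntegral_eq_of_subset_of_eq_zero (A := Ioo w (η ^ 2)) (Ioo_subset_Ioo le_rfl hη1)
          measurableSet_Ioo _ measurableSet_Ioo, lintegral_beta hwη, mul_comm]
        intro s hs hs'
        have : η ^ 2 ≤ s := by
          by_contra hc
          exact hs' ⟨hs.1, not_le.1 hc⟩
        rw [Real.sqrt_eq_zero_of_nonpos (by linarith : η ^ 2 - s ≤ 0)]; simp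
      · rw [indicator_of_notMem (fun h' => h h'.1)]
        have hwη : η ^ 2 ≤ w := (Real.le_sqrt hη.1.le hw).1 (not_lt.1 h)
        have : ∫⁻ s in Ioo w 1, ENNReal.ofReal ((√(s - w))⁻¹ * (√(η ^ 2 - s))⁻¹) = 0 := by
          rw [setLIntegral_congr_fun (g := fun _ => 0) measurableSet_Ioo]
          · simp
          · intro s hs
            simp only
            rw [Real.sqrt_eq_zero_of_nonpos (by linarith [hs.1] : η ^ 2 - s ≤ 0)]; simp
        rw [this, mul_zero]
    rw [setLIntegral_congr_fun measurableSet_Ioo e2, setLIntegral_indicator measurableSet_Ioo,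
      inter_eq_self_of_subset_left (Ioo_subset_Ioo (Real.sqrt_nonneg w) le_rfl),
      lintegral_const_mul' _ _ ENNReal.ofReal_ne_top]
  · have : Measurable fun p : ℝ × ℝ =>
        ENNReal.ofReal (χ p.2) * ENNReal.ofReal ((√(p.1 - w))⁻¹ * (√(p.2 ^ 2 - p.1))⁻¹) := by
      fun_prop
    exact this.aemeasurable

/-- Two densities of finite mass with almost everywhere equal Abel transforms agree almost
everywhere. -/
theorem ae_eq_of_abelT_ae_eq {χ φ : ℝ → ℝ} (hχ : Measurable χ) (hχ0 : ∀ η, 0 ≤ χ η)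
    (hφ : Measurable φ) (hφ0 : ∀ η, 0 ≤ φ η) (hχi : IntegrableOn χ (Ioo 0 1))
    (hφi : IntegrableOn φ (Ioo 0 1))
    (h : ∀ᵐ s ∂(volume.restrict (Ioo (0 : ℝ) 1)), abelT χ s = abelT φ s) :
    ∀ᵐ η ∂(volume.restrict (Ioo (0 : ℝ) 1)), χ η = φ η := by
  have tail : ∀ c, 0 ≤ c → ∫⁻ η in Ioo c 1, ENNReal.ofReal (χ η) =
      ∫⁻ η in Ioo c 1, ENNReal.ofReal (φ η) := by
    intro c hc
    have h1 := lintegral_abelT_mul_inv_sqrt hχ hχ0 (sq_nonneg c)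
    have h2 := lintegral_abelT_mul_inv_sqrt hφ hφ0 (sq_nonneg c)
    rw [Real.sqrt_sq hc] at h1 h2
    have h3 : ∫⁻ s in Ioo (c ^ 2) 1, abelT χ s * ENNReal.ofReal ((√(s - c ^ 2))⁻¹) =
        ∫⁻ s in Ioo (c ^ 2) 1, abelT φ s * ENNReal.ofReal ((√(s - c ^ 2))⁻¹) := by
      refine lintegral_congr_ae ?_
      have := ae_restrict_of_ae_restrict_of_subset (Ioo_subset_Ioo (sq_nonneg c) le_rfl) h
      filter_upwards [this] with s hs
      rw [hs]
    rw [h1, h2] at h3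
    exact (ENNReal.mul_right_inj (by simpa using Real.pi_pos) ENNReal.ofReal_ne_top).1 h3
  have mass : ∀ {ρ : ℝ → ℝ}, IntegrableOn ρ (Ioo 0 1) →
      ∫⁻ η in Ioo (0 : ℝ) 1, ENNReal.ofReal (ρ η) ≠ ⊤ := fun hρ => hρ.lintegral_lt_top.ne
  have hfin : IsFiniteMeasure
      ((volume.restrict (Ioo (0 : ℝ) 1)).withDensity fun η => ENNReal.ofReal (χ η)) :=
    isFiniteMeasure_withDensity (mass hχi)
  have meas : (volume.restrict (Ioo (0 : ℝ) 1)).withDensity (fun η => ENNReal.ofReal (χ η)) =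
      (volume.restrict (Ioo (0 : ℝ) 1)).withDensity (fun η => ENNReal.ofReal (φ η)) := by
    have hfin' : IsFiniteMeasure
        ((volume.restrict (Ioo (0 : ℝ) 1)).withDensity fun η => ENNReal.ofReal (φ η)) :=
      isFiniteMeasure_withDensity (mass hφi)
    refine Measure.ext_of_Ici _ _ fun c => ?_
    rw [withDensity_apply _ measurableSet_Ici, withDensity_apply _ measurableSet_Ici,
      Measure.restrict_restrict measurableSet_Ici]
    have hset : (Ici c ∩ Ioo (0 : ℝ) 1 : Set ℝ) =ᵐ[volume] Ioo (max c 0) 1 := by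
      have : (Ioo (max c 0) 1 : Set ℝ) = Ioi c ∩ Ioo 0 1 := by
        ext x; simp only [mem_Ioo, mem_inter_iff, mem_Ioi, max_lt_iff]; tauto
      rw [this]
      exact Ioi_ae_eq_Ici.symm.inter (ae_eq_refl _)
    rw [setLIntegral_congr hset, setLIntegral_congr hset, tail _ (le_max_right c 0)]
  have := (withDensity_eq_iff hχ.ennreal_ofReal.aemeasurable hφ.ennreal_ofReal.aemeasurable
    (mass hχi)).1 meas
  filter_upwards [this] with η hη
  exact (ENNReal.ofReal_eq_ofReal_iff (hχ0 η) (hφ0 η)).1 hη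

/-- Fubini for a nonnegative kernel whose marginals are known. -/
theorem integral_kernel_swap {I J : Set ℝ} (hJ : MeasurableSet J) {h : ℝ → ℝ}
    (hh : AEStronglyMeasurable h (volume.restrict J)) {k : ℝ → ℝ → ℝ}
    (hk : Measurable (Function.uncurry k)) (hk0 : ∀ v s, 0 ≤ k v s) {κ : ℝ → ℝ}
    (hκ : ∀ s ∈ J, 0 ≤ κ s)
    (hkκ : ∀ s ∈ J, ∫⁻ v in I, ENNReal.ofReal (k v s) = ENNReal.ofReal (κ s))
    (hi : IntegrableOn (fun s => h s * κ s) J) :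
    Integrable (Function.uncurry fun v s => h s * k v s)
      ((volume.restrict I).prod (volume.restrict J)) ∧
    ∫ v in I, ∫ s in J, h s * k v s = ∫ s in J, h s * κ s := by
  have hks : ∀ s, Measurable fun v => k v s := fun s =>
    hk.comp (measurable_id.prodMk measurable_const)
  have hint : ∀ s ∈ J, IntegrableOn (fun v => k v s) I := by
    intro s hs
    refine ⟨(hks s).aestronglyMeasurable, ?_⟩
    rw [hasFiniteIntegral_iff_ofReal (ae_of_all _ fun v => hk0 v s), hkκ s hs]
    exact ENNReal.ofReal_lt_top
  have hval : ∀ s ∈ J, ∫ v in I, k v s = κ s := by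
    intro s hs
    rw [integral_eq_lintegral_of_nonneg_ae (ae_of_all _ fun v => hk0 v s)
      (hks s).aestronglyMeasurable, hkκ s hs, ENNReal.toReal_ofReal (hκ s hs)]
  have hint2 : Integrable (Function.uncurry fun v s => h s * k v s)
      ((volume.restrict I).prod (volume.restrict J)) := by
    have hm : AEStronglyMeasurable (Function.uncurry fun v s => h s * k v s)
        ((volume.restrict I).prod (volume.restrict J)) :=
      (hh.comp_snd).mul hk.aestronglyMeasurable
    rw [integrable_prod_iff' hm]
    constructor
    · filter_upwards [ae_restrict_mem hJ] with s hs
      exact (hint s hs).const_mul (h s)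
    · have : (fun s => |h s * κ s|) =ᵐ[volume.restrict J]
          fun s => ∫ v in I, ‖Function.uncurry (fun v s => h s * k v s) (v, s)‖ := by
        filter_upwards [ae_restrict_mem hJ] with s hs
        simp only [Function.uncurry, norm_mul, Real.norm_eq_abs, abs_of_nonneg (hk0 _ _)]
        rw [integral_const_mul, hval s hs, abs_mul, abs_of_nonneg (hκ s hs)]
      exact (Integrable.abs hi).congr this
  refine ⟨hint2, ?_⟩
  rw [integral_integral_swap hint2]
  refine setIntegral_congr_fun hJ fun s hs => ?_
  rw [integral_const_mul, hval s hs]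

/-! ### The initial data and the linear term -/

theorem integrableOn_inv_sqrt {w : ℝ} (hw : 0 ≤ w) :
    IntegrableOn (fun v : ℝ => (√v)⁻¹) (Ioo 0 w) := by
  refine ⟨by fun_prop, ?_⟩
  rw [hasFiniteIntegral_iff_ofReal (ae_of_all _ fun v => by positivity)]
  have := lintegral_inv_sqrt_sub_left hw
  simp only [sub_zero] at this
  rw [this]
  exact ENNReal.ofReal_lt_top

theorem integrableOn_inv_sqrt_sub {p w : ℝ} (hw : p ≤ w) :
    IntegrableOn (fun v : ℝ => (√(w - v))⁻¹) (Ioo p w) := by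
  refine ⟨by fun_prop, ?_⟩
  rw [hasFiniteIntegral_iff_ofReal (ae_of_all _ fun v => by positivity),
    lintegral_inv_sqrt_sub_right hw]
  exact ENNReal.ofReal_lt_top

theorem integral_inv_sqrt_sub {p w : ℝ} (hw : p ≤ w) :
    ∫ v in Ioo p w, (√(w - v))⁻¹ = 2 * √(w - p) := by
  rw [integral_eq_lintegral_of_nonneg_ae (ae_of_all _ fun v => by positivity) (by fun_prop),
    lintegral_inv_sqrt_sub_right hw, ENNReal.toReal_ofReal (by positivity)]

namespace InitialData

variable {u₀ f : ℝ → ℝ}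

theorem u₀_pos (h : InitialData u₀ f) (y : ℝ) : 0 < u₀ y :=
  (h.strictAnti.antitone.le_of_tendsto h.tendsto_atTop (y + 1)).trans_lt
    (h.strictAnti (lt_add_one y))

theorem u₀_lt_one (h : InitialData u₀ f) (y : ℝ) : u₀ y < 1 :=
  (h.strictAnti (sub_one_lt y)).trans_le
    (h.strictAnti.antitone.ge_of_tendsto h.tendsto_atBot (y - 1))

theorem lt_u₀_iff (h : InitialData u₀ f) {v y : ℝ} (hv : v ∈ Ioo (0 : ℝ) 1) :
    v < u₀ y ↔ y < f v := by
  conv_lhs => rw [← h.inverse v hv]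
  exact h.strictAnti.lt_iff_gt

theorem f_strictAntiOn (h : InitialData u₀ f) : StrictAntiOn f (Ioo 0 1) := by
  intro v hv w hw hvw
  rw [← h.lt_u₀_iff hv, h.inverse w hw]
  exact hvw

theorem continuousOn_f (h : InitialData u₀ f) : ContinuousOn f (Ioo 0 1) :=
  h.smooth.continuousOn

theorem aestronglyMeasurable_f (h : InitialData u₀ f) {w : ℝ} (hw : w ≤ 1) :
    AEStronglyMeasurable f (volume.restrict (Ioo 0 w)) :=
  (h.continuousOn_f.mono (Ioo_subset_Ioo le_rfl hw)).aestronglyMeasurable measurableSet_Ioo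

/-- Integration over the region `{f w < y, 0 < v < u₀ y} = {0 < v < w, f w < y < f v}` in the two
possible orders. -/
theorem lintegral_layer (h : InitialData u₀ f) {w : ℝ} (hw : w ∈ Ioo (0 : ℝ) 1)
    {G : ℝ → ENNReal} (hG : Measurable G) :
    ∫⁻ y in Ioi (f w), ∫⁻ v in Ioo 0 (u₀ y), G v =
      ∫⁻ v in Ioo 0 w, G v * ENNReal.ofReal (f v - f w) := by
  have hu : Measurable u₀ := h.strictAnti.antitone.measurable
  have e1 : ∀ y ∈ Ioi (f w), ∫⁻ v in Ioo 0 (u₀ y), G v =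
      ∫⁻ v in Ioo 0 w, {p : ℝ × ℝ | p.2 < u₀ p.1}.indicator (fun p => G p.2) (y, v) := by
    intro y hy
    have hyw : u₀ y ≤ w := not_lt.1 fun hc => lt_asymm hy ((h.lt_u₀_iff hw).1 hc)
    have : ∀ v, {p : ℝ × ℝ | p.2 < u₀ p.1}.indicator (fun p => G p.2) (y, v) =
        (Iio (u₀ y)).indicator G v := fun v => rfl
    simp_rw [this]
    rw [setLIntegral_indicator measurableSet_Iio]
    congr 2
    ext v; simp only [mem_Ioo, mem_inter_iff, mem_Iio]
    constructor
    · exact fun hv => ⟨hv.2, hv.1, hv.2.trans_le hyw⟩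
    · exact fun hv => ⟨hv.2.1, hv.1⟩
  have hms : MeasurableSet {p : ℝ × ℝ | p.2 < u₀ p.1} :=
    measurableSet_lt measurable_snd (hu.comp measurable_fst)
  have hm : Measurable ({p : ℝ × ℝ | p.2 < u₀ p.1}.indicator fun p => G p.2) :=
    (hG.comp measurable_snd).indicator hms
  rw [setLIntegral_congr_fun measurableSet_Ioi e1, lintegral_lintegral_swap
    (f := fun y v => {p : ℝ × ℝ | p.2 < u₀ p.1}.indicator (fun p => G p.2) (y, v))
    hm.aemeasurable]
  refine setLIntegral_congr_fun measurableSet_Ioo fun v hv => ?_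
  have hv1 : v ∈ Ioo (0 : ℝ) 1 := ⟨hv.1, hv.2.trans hw.2⟩
  have : ∀ y, {p : ℝ × ℝ | p.2 < u₀ p.1}.indicator (fun p => G p.2) (y, v) =
      (Iio (f v)).indicator (fun _ => G v) y := by
    intro y
    by_cases hy : y < f v
    · rw [indicator_of_mem (show (y, v) ∈ _ from (h.lt_u₀_iff hv1).2 hy),
        indicator_of_mem (show y ∈ Iio (f v) from hy)]
    · rw [indicator_of_notMem (show (y, v) ∉ _ from fun hc => hy ((h.lt_u₀_iff hv1).1 hc)),
        indicator_of_notMem (show y ∉ Iio (f v) from hy)]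
  simp_rw [this]
  rw [setLIntegral_indicator measurableSet_Iio, setLIntegral_const, inter_comm, Ioi_inter_Iio,
    Real.volume_Ioo]

theorem integrableOn_sqrt_u₀ (h : InitialData u₀ f) (c : ℝ) :
    IntegrableOn (fun y => √(u₀ y)) (Ioi c) := by
  have hu : Measurable u₀ := h.strictAnti.antitone.measurable
  have h1 : IntegrableOn (fun y => √(u₀ y)) (Icc c 0) := by
    refine Measure.integrableOn_of_bounded (M := 1) (by simp) (by fun_prop)
      (ae_of_all _ fun y => ?_)
    rw [Real.norm_eq_abs, abs_of_nonneg (Real.sqrt_nonneg _)]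
    exact Real.sqrt_le_one.2 (h.u₀_lt_one y).le
  refine (h1.union h.decay).mono_set fun y hy => ?_
  rcases le_or_gt y 0 with h0 | h0
  · exact Or.inl ⟨le_of_lt hy, h0⟩
  · exact Or.inr h0

/-- The decay of `√u₀` at `+∞` as an integrability property of `f` at `0`. -/
theorem integrableOn_sub_mul_inv_sqrt (h : InitialData u₀ f) {w : ℝ} (hw : w ∈ Ioo (0 : ℝ) 1) :
    IntegrableOn (fun v => (f v - f w) * (√v)⁻¹) (Ioo 0 w) := by
  have hpos : ∀ v ∈ Ioo 0 w, 0 ≤ f v - f w := fun v hv => by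
    have := h.f_strictAntiOn ⟨hv.1, hv.2.trans hw.2⟩ hw hv.2
    linarith
  refine ⟨((h.aestronglyMeasurable_f hw.2.le).sub aestronglyMeasurable_const).mul (by fun_prop), ?_⟩
  rw [hasFiniteIntegral_iff_ofReal ((ae_restrict_iff' measurableSet_Ioo).2 (ae_of_all _
    fun v hv => mul_nonneg (hpos v hv) (by positivity)))]
  have hG : Measurable fun v : ℝ => ENNReal.ofReal ((√v)⁻¹) := by fun_prop
  have e := h.lintegral_layer hw hG
  have e1 : ∫⁻ v in Ioo 0 w, ENNReal.ofReal ((f v - f w) * (√v)⁻¹) =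
      ∫⁻ v in Ioo 0 w, ENNReal.ofReal ((√v)⁻¹) * ENNReal.ofReal (f v - f w) := by
    refine setLIntegral_congr_fun measurableSet_Ioo fun v hv => ?_
    rw [ENNReal.ofReal_mul (hpos v hv), mul_comm]
  rw [e1, ← e]
  have e2 : ∀ y, ∫⁻ v in Ioo 0 (u₀ y), ENNReal.ofReal ((√v)⁻¹) =
      ENNReal.ofReal (2 * √(u₀ y)) := by
    intro y
    have := lintegral_inv_sqrt_sub_left (h.u₀_pos y).le
    simpa only [sub_zero] using this
  simp_rw [e2]
  exact ((h.integrableOn_sqrt_u₀ (f w)).const_mul 2).lintegral_lt_top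

theorem integrableOn_mul_inv_sqrt (h : InitialData u₀ f) {w : ℝ} (hw : w ∈ Ioo (0 : ℝ) 1) :
    IntegrableOn (fun v => f v * (√v)⁻¹) (Ioo 0 w) := by
  have := (h.integrableOn_sub_mul_inv_sqrt hw).add ((integrableOn_inv_sqrt hw.1.le).const_mul (f w))
  refine this.congr (ae_of_all _ fun v => ?_)
  simp only [Pi.add_apply]; ring

/-- Since `f` is decreasing and `f / √v` is integrable at `0`, `f √v` is bounded there. -/
theorem exists_bound_mul_sqrt (h : InitialData u₀ f) {w : ℝ} (hw : w ∈ Ioo (0 : ℝ) 1) :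
    ∃ C, ∀ v ∈ Ioc 0 w, |f v| * √v ≤ C := by
  refine ⟨(∫ v in Ioo 0 w, (f v - f w) * (√v)⁻¹) + |f w|, fun v hv => ?_⟩
  have hi := h.integrableOn_sub_mul_inv_sqrt hw
  have hmem : ∀ r ∈ Ioo 0 w, r ∈ Ioo (0 : ℝ) 1 := fun r hr => ⟨hr.1, hr.2.trans hw.2⟩
  have hv1 : v ∈ Ioo (0 : ℝ) 1 := ⟨hv.1, hv.2.trans_lt hw.2⟩
  have hfv : f w ≤ f v := h.f_strictAntiOn.antitoneOn hv1 hw hv.2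
  have h1 : ∫ r in Ioo 0 v, (f v - f w) * (√r)⁻¹ ≤ ∫ r in Ioo 0 v, (f r - f w) * (√r)⁻¹ := by
    refine setIntegral_mono_on ((integrableOn_inv_sqrt hv.1.le).const_mul _)
      (hi.mono_set (Ioo_subset_Ioo le_rfl hv.2)) measurableSet_Ioo fun r hr => ?_
    have := h.f_strictAntiOn (hmem r ⟨hr.1, hr.2.trans_le hv.2⟩) hv1 hr.2
    gcongr
  have h2 : ∫ r in Ioo 0 v, (f r - f w) * (√r)⁻¹ ≤ ∫ r in Ioo 0 w, (f r - f w) * (√r)⁻¹ := by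
    refine setIntegral_mono_set hi ?_ (Ioo_subset_Ioo le_rfl hv.2).eventuallyLE
    refine (ae_restrict_iff' measurableSet_Ioo).2 (ae_of_all _ fun r hr => ?_)
    have := h.f_strictAntiOn (hmem r hr) hw hr.2
    exact mul_nonneg (by linarith) (by positivity)
  have h3 : ∫ r in Ioo 0 v, (√r)⁻¹ = 2 * √v := by
    rw [integral_eq_lintegral_of_nonneg_ae (ae_of_all _ fun v => by positivity) (by fun_prop)]
    have := lintegral_inv_sqrt_sub_left hv.1.le
    simp only [sub_zero] at this
    rw [this, ENNReal.toReal_ofReal (by positivity)]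
  rw [integral_const_mul, h3] at h1
  have hs1 : √v ≤ 1 := Real.sqrt_le_one.2 hv1.2.le
  have hs0 := Real.sqrt_nonneg v
  have h4 : |f v| ≤ (f v - f w) + |f w| := by
    have := abs_add_le (f v - f w) (f w)
    rwa [sub_add_cancel, abs_of_nonneg (sub_nonneg.2 hfv)] at this
  nlinarith [abs_nonneg (f w), mul_nonneg (sub_nonneg.2 hfv) hs0]

/-- `θ` is the Abel transform of `f`. -/
theorem theta_eq (h : InitialData u₀ f) {η : ℝ} (hη : η ∈ Ioo (0 : ℝ) 1) :
    IntegrableOn (fun v => f v * abelKernel v η) (Ioo 0 (η ^ 2)) ∧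
    theta u₀ f η = 1 / 2 * ∫ v in Ioo 0 (η ^ 2), f v * abelKernel v η := by
  have hw : η ^ 2 ∈ Ioo (0 : ℝ) 1 := ⟨by nlinarith [hη.1], by nlinarith [hη.1, hη.2]⟩
  set w := η ^ 2 with hwdef
  have hu : Measurable u₀ := h.strictAnti.antitone.measurable
  have hpos : ∀ v ∈ Ioo 0 w, 0 ≤ f v - f w := fun v hv => by
    have := h.f_strictAntiOn ⟨hv.1, hv.2.trans hw.2⟩ hw hv.2
    linarith
  have hG : Measurable fun v : ℝ => ENNReal.ofReal (1 / 2 * (√(w - v))⁻¹) := by fun_prop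
  have e := h.lintegral_layer hw hG
  have e1 : ∫⁻ v in Ioo 0 w, ENNReal.ofReal (1 / 2 * ((f v - f w) * (√(w - v))⁻¹)) =
      ∫⁻ v in Ioo 0 w, ENNReal.ofReal (1 / 2 * (√(w - v))⁻¹) * ENNReal.ofReal (f v - f w) := by
    refine setLIntegral_congr_fun measurableSet_Ioo fun v hv => ?_
    rw [← ENNReal.ofReal_mul (by positivity)]
    congr 1; ring
  have hyw : ∀ y ∈ Ioi (f w), u₀ y < w := fun y hy => by
    rcases lt_trichotomy (u₀ y) w with hc | hc | hc
    · exact hc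
    · have := h.strictAnti.injective (hc.trans (h.inverse w hw).symm)
      exact absurd this (ne_of_gt hy)
    · exact absurd ((h.lt_u₀_iff hw).1 hc) (not_lt.2 (le_of_lt hy))
  have e2 : ∀ y ∈ Ioi (f w), ∫⁻ v in Ioo 0 (u₀ y), ENNReal.ofReal (1 / 2 * (√(w - v))⁻¹) =
      ENNReal.ofReal (η - √(w - u₀ y)) := by
    intro y hy
    have hy' := hyw y hy
    rw [lintegral_deriv_of_nonneg (G := fun v => -√(w - v)) (h.u₀_pos y).le (by fun_prop)]
    · rw [sub_zero, hwdef, Real.sqrt_sq hη.1.le]; congr 1; ring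
    · intro v hv
      have h0 : 0 < w - v := by linarith [hv.2]
      refine (((hasDerivAt_id v).const_sub w).sqrt h0.ne').neg.congr_deriv ?_
      have := (Real.sqrt_pos.2 h0).ne'
      simp only [id]
      field_simp
    · intros; positivity
  rw [setLIntegral_congr_fun measurableSet_Ioi e2, ← e1] at e
  -- finiteness: the integrand of `θ` is at most `√u₀`
  have hle : ∀ y ∈ Ioi (f w), 0 ≤ η - √(w - u₀ y) ∧ η - √(w - u₀ y) ≤ √(u₀ y) := by
    intro y hy
    have hy' := hyw y hy
    have hp := h.u₀_pos y
    constructor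
    · have : √(w - u₀ y) ≤ √w := Real.sqrt_le_sqrt (by linarith)
      rw [hwdef, Real.sqrt_sq hη.1.le] at this
      linarith
    · have : √w ≤ √(w - u₀ y) + √(u₀ y) := by
        refine Real.sqrt_le_iff.2 ⟨by positivity, ?_⟩
        nlinarith [Real.sq_sqrt (by linarith : 0 ≤ w - u₀ y), Real.sq_sqrt hp.le,
          mul_nonneg (Real.sqrt_nonneg (w - u₀ y)) (Real.sqrt_nonneg (u₀ y))]
      rw [hwdef, Real.sqrt_sq hη.1.le] at this
      linarith
  have hfin : ∫⁻ y in Ioi (f w), ENNReal.ofReal (η - √(w - u₀ y)) < ⊤ := by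
    refine lt_of_le_of_lt (setLIntegral_mono' measurableSet_Ioi fun y hy =>
      ENNReal.ofReal_le_ofReal (hle y hy).2) (h.integrableOn_sqrt_u₀ (f w)).lintegral_lt_top
  have hmeas : AEStronglyMeasurable (fun v => 1 / 2 * ((f v - f w) * (√(w - v))⁻¹))
      (volume.restrict (Ioo 0 w)) :=
    (((h.aestronglyMeasurable_f hw.2.le).sub aestronglyMeasurable_const).mul
      (by fun_prop)).const_mul _
  have hnn : 0 ≤ᵐ[volume.restrict (Ioo 0 w)] fun v => 1 / 2 * ((f v - f w) * (√(w - v))⁻¹) :=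
    (ae_restrict_iff' measurableSet_Ioo).2 (ae_of_all _ fun v hv =>
      mul_nonneg (by norm_num) (mul_nonneg (hpos v hv) (by positivity)))
  have hint : IntegrableOn (fun v => 1 / 2 * ((f v - f w) * (√(w - v))⁻¹)) (Ioo 0 w) := by
    refine ⟨hmeas, ?_⟩
    rw [hasFiniteIntegral_iff_ofReal hnn, ← e]
    exact hfin
  have hval : ∫ y in Ioi (f w), (η - √(w - u₀ y)) =
      ∫ v in Ioo 0 w, 1 / 2 * ((f v - f w) * (√(w - v))⁻¹) := by
    rw [integral_eq_lintegral_of_nonneg_ae ((ae_restrict_iff' measurableSet_Ioi).2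
      (ae_of_all _ fun y hy => (hle y hy).1)) (by fun_prop),
      integral_eq_lintegral_of_nonneg_ae hnn hmeas, e]
  have hc := (integrableOn_inv_sqrt_sub hw.1.le).const_mul (f w)
  have hint2 : IntegrableOn (fun v => f v * abelKernel v η) (Ioo 0 w) := by
    refine ((Integrable.const_mul hint 2).add hc).congr (ae_of_all _ fun v => ?_)
    simp only [Pi.add_apply, abelKernel, ← hwdef]; ring
  refine ⟨hint2, ?_⟩
  rw [theta, ← hwdef, hval]
  have e3 : ∫ v in Ioo 0 w, f v * abelKernel v η =
      2 * (∫ v in Ioo 0 w, 1 / 2 * ((f v - f w) * (√(w - v))⁻¹)) +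
        f w * ∫ v in Ioo 0 w, (√(w - v))⁻¹ := by
    rw [← integral_const_mul, ← integral_const_mul, ← integral_add (Integrable.const_mul hint 2) hc]
    refine integral_congr_ae (ae_of_all _ fun v => ?_)
    simp only [abelKernel, ← hwdef]; ring
  rw [e3, integral_inv_sqrt_sub hw.1.le, sub_zero, hwdef, Real.sqrt_sq hη.1.le]
  ring

theorem continuousOn_hodograph (h : InitialData u₀ f) (x t : ℝ) :
    ContinuousOn (hodograph f x t) (Ioo 0 1) := by
  unfold hodograph
  exact ContinuousOn.sub (by fun_prop) h.continuousOn_f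

theorem exists_bound_hodograph (h : InitialData u₀ f) (x t : ℝ) {w : ℝ} (hw : w ∈ Ioo (0 : ℝ) 1) :
    ∃ C, ∀ v ∈ Ioc 0 w, |hodograph f x t v| * √v ≤ C := by
  obtain ⟨C, hC⟩ := h.exists_bound_mul_sqrt hw
  refine ⟨|x| + 30 * |t| + C, fun v hv => ?_⟩
  have h1 : |hodograph f x t v| ≤ |x| + 30 * |t| * v ^ 2 + |f v| := by
    unfold hodograph
    calc |x - 30 * t * v ^ 2 - f v| ≤ |x - 30 * t * v ^ 2| + |f v| := abs_sub _ _
      _ ≤ |x| + |30 * t * v ^ 2| + |f v| := by gcongr; exact abs_sub _ _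
      _ = _ := by rw [abs_mul, abs_mul, abs_of_nonneg (sq_nonneg v)]; norm_num
  have hv1 : v < 1 := hv.2.trans_lt hw.2
  have hs1 : √v ≤ 1 := Real.sqrt_le_one.2 hv1.le
  have h2 : |x| + 30 * |t| * v ^ 2 ≤ |x| + 30 * |t| := by
    nlinarith [abs_nonneg t, hv.1, mul_nonneg (abs_nonneg t) (by nlinarith [hv.1] : 0 ≤ 1 - v ^ 2)]
  nlinarith [hC v hv, Real.sqrt_nonneg v, abs_nonneg x, abs_nonneg t]

theorem integrableOn_hodograph_mul_inv_sqrt (h : InitialData u₀ f) (x t : ℝ) {w : ℝ}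
    (hw : w ∈ Ioo (0 : ℝ) 1) :
    IntegrableOn (fun v => hodograph f x t v * (√v)⁻¹) (Ioo 0 w) := by
  have h1 : IntegrableOn (fun v : ℝ => (x - 30 * t * v ^ 2) * (√v)⁻¹) (Ioo 0 w) := by
    refine Integrable.bdd_mul (c := |x| + 30 * |t|) (integrableOn_inv_sqrt hw.1.le) (by fun_prop) ?_
    refine (ae_restrict_iff' measurableSet_Ioo).2 (ae_of_all _ fun v hv => ?_)
    have hv1 : v < 1 := hv.2.trans hw.2
    have : |30 * t * v ^ 2| ≤ 30 * |t| := by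
      rw [abs_mul, abs_mul, abs_of_nonneg (sq_nonneg v), abs_of_nonneg (by norm_num : (0 : ℝ) ≤ 30)]
      nlinarith [abs_nonneg t, mul_nonneg (abs_nonneg t) (by nlinarith [hv.1] : 0 ≤ 1 - v ^ 2)]
    exact (abs_sub _ _).trans (by linarith)
  refine (h1.sub (h.integrableOn_mul_inv_sqrt hw)).congr (ae_of_all _ fun v => ?_)
  simp only [Pi.sub_apply, hodograph]; ring

/-- The Abel transform of `v²`. -/
theorem _root_.FifthKdV.integral_sq_mul_abelKernel {η : ℝ} (hη : 0 ≤ η) :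
    IntegrableOn (fun v => v ^ 2 * abelKernel v η) (Ioo 0 (η ^ 2)) ∧
    ∫ v in Ioo 0 (η ^ 2), v ^ 2 * abelKernel v η = 16 / 15 * η ^ 5 := by
  have h0 : (0 : ℝ) ≤ η ^ 2 := sq_nonneg η
  set G : ℝ → ℝ := fun v =>
    -(2 / 15 * √(η ^ 2 - v) * (3 * v ^ 2 + 4 * η ^ 2 * v + 8 * η ^ 4)) with hG
  have hGc : ContinuousOn G (Icc 0 (η ^ 2)) := by fun_prop
  have hd : ∀ v ∈ Ioo 0 (η ^ 2), HasDerivAt G (v ^ 2 * abelKernel v η) v := by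
    intro v hv
    have hp : 0 < η ^ 2 - v := by linarith [hv.2]
    have d1 := ((hasDerivAt_id v).const_sub (η ^ 2)).sqrt hp.ne'
    have d2 : HasDerivAt (fun v : ℝ => 3 * v ^ 2 + 4 * η ^ 2 * v + 8 * η ^ 4)
        (6 * v + 4 * η ^ 2) v := by
      have := (((hasDerivAt_pow 2 v).const_mul 3).add
        ((hasDerivAt_id v).const_mul (4 * η ^ 2))).add_const (8 * η ^ 4)
      refine this.congr_deriv ?_
      norm_num; ring
    refine (((d1.const_mul (2 / 15)).mul d2).neg).congr_deriv ?_
    have hs := (Real.sqrt_pos.2 hp).ne'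
    have hs2 := Real.sq_sqrt hp.le
    simp only [id, abelKernel]
    field_simp
    rw [hs2]; ring
  have hnn : ∀ v ∈ Ioo 0 (η ^ 2), 0 ≤ v ^ 2 * abelKernel v η := fun v _ =>
    mul_nonneg (sq_nonneg v) (abelKernel_nonneg _ _)
  have hi := intervalIntegral.integrableOn_deriv_of_nonneg hGc hd hnn
  refine ⟨hi.mono_set Ioo_subset_Ioc_self, ?_⟩
  rw [← integral_Ioc_eq_integral_Ioo, ← intervalIntegral.integral_of_le h0,
    intervalIntegral.integral_eq_sub_of_hasDerivAt_of_le h0 hGc hd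
    ((intervalIntegrable_iff_integrableOn_Ioc_of_le h0).2 hi)]
  simp only [hG, sub_self, Real.sqrt_zero, sub_zero, Real.sqrt_sq hη]
  ring

/-- The linear term is the Abel transform of the hodograph function. -/
theorem aFun_eq (h : InitialData u₀ f) (x t : ℝ) {η : ℝ} (hη : η ∈ Ioo (0 : ℝ) 1) :
    IntegrableOn (fun v => hodograph f x t v * abelKernel v η) (Ioo 0 (η ^ 2)) ∧
    aFun u₀ f x t η = 1 / 2 * ∫ v in Ioo 0 (η ^ 2), hodograph f x t v * abelKernel v η := by
  obtain ⟨i1, e1⟩ := h.theta_eq hη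
  obtain ⟨i2, e2⟩ := integral_sq_mul_abelKernel hη.1.le
  have i3 := integrableOn_inv_sqrt_sub (sq_nonneg η)
  have e3 := integral_inv_sqrt_sub (sq_nonneg η)
  rw [sub_zero, Real.sqrt_sq hη.1.le] at e3
  have i4 : IntegrableOn (fun v => x * (√(η ^ 2 - v))⁻¹ - 30 * t * (v ^ 2 * abelKernel v η))
      (Ioo 0 (η ^ 2)) := (Integrable.const_mul i3 x).sub (Integrable.const_mul i2 (30 * t))
  have hi := Integrable.sub i4 i1
  have hfun : ∀ v, hodograph f x t v * abelKernel v η =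
      (x * (√(η ^ 2 - v))⁻¹ - 30 * t * (v ^ 2 * abelKernel v η)) - f v * abelKernel v η := by
    intro v; simp only [hodograph, abelKernel]; ring
  refine ⟨hi.congr (ae_of_all _ fun v => (hfun v).symm), ?_⟩
  simp_rw [hfun]
  rw [integral_sub i4 i1,
    integral_sub (Integrable.const_mul i3 x) (Integrable.const_mul i2 (30 * t)),
    integral_const_mul, integral_const_mul, e2, e3, aFun, e1]
  ring

end InitialData

/-! ### Three forms of the kernel average -/

/-- The average `∫₀¹ h((1-r²)ξ + r²u) dr`. With `h = H'` it is `Φ₀(ξ,u)`, after the substitution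
`μ = 1 - 2r²` that removes the singular weight. -/
def sqMean (h : ℝ → ℝ) (ξ u : ℝ) : ℝ := ∫ r in (0 : ℝ)..1, h ((1 - r ^ 2) * ξ + r ^ 2 * u)

/-- The defining integral of `Φ₀(ξ,u)` for `ξ < u`, in the variable
`s = ((1+μ)ξ + (1-μ)u)/2`. -/
theorem mu_form_of_lt (h : ℝ → ℝ) {ξ u : ℝ} (hlt : ξ < u) :
    1 / (2 * √2) * ∫ μ in (-1 : ℝ)..1, h ((1 + μ) / 2 * ξ + (1 - μ) / 2 * u) / √(1 - μ) =
      (2 * √(u - ξ))⁻¹ * ∫ s in ξ..u, h s * (√(s - ξ))⁻¹ := by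
  have hd : 0 < u - ξ := sub_pos.2 hlt
  have hc : (ξ - u) / 2 ≠ 0 := by linarith
  have e : ∀ μ : ℝ, h ((1 + μ) / 2 * ξ + (1 - μ) / 2 * u) / √(1 - μ) =
      (fun s => h s / √(2 * (s - ξ) / (u - ξ))) ((ξ - u) / 2 * μ + (ξ + u) / 2) := by
    intro μ
    simp only
    congr 2
    · ring
    · field_simp; ring
  rw [intervalIntegral.integral_congr (fun μ _ => e μ),
    intervalIntegral.integral_comp_mul_add (fun s => h s / √(2 * (s - ξ) / (u - ξ))) hc]
  have e1 : (ξ - u) / 2 * -1 + (ξ + u) / 2 = u := by ring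
  have e2 : (ξ - u) / 2 * 1 + (ξ + u) / 2 = ξ := by ring
  rw [e1, e2, intervalIntegral.integral_symm]
  have e3 : ∀ s ∈ uIcc ξ u, h s / √(2 * (s - ξ) / (u - ξ)) =
      (√(u - ξ) / √2) * (h s * (√(s - ξ))⁻¹) := by
    intro s hs
    rw [uIcc_of_le hlt.le] at hs
    rw [Real.sqrt_div (by nlinarith [hs.1]), Real.sqrt_mul (by norm_num), div_div_eq_mul_div]
    rw [div_eq_mul_inv, mul_inv]; ring
  rw [intervalIntegral.integral_congr e3, intervalIntegral.integral_const_mul, smul_eq_mul]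
  have hs := Real.sq_sqrt hd.le
  have hs0 := (Real.sqrt_pos.2 hd).ne'
  have h2 := Real.sq_sqrt (by norm_num : (0 : ℝ) ≤ 2)
  have h20 : √(2 : ℝ) ≠ 0 := (Real.sqrt_pos.2 (by norm_num)).ne'
  have : ξ - u = -(√(u - ξ) ^ 2) := by rw [hs]; ring
  rw [this]
  field_simp
  rw [h2]

theorem mu_form_of_gt (h : ℝ → ℝ) {ξ u : ℝ} (hlt : u < ξ) :
    1 / (2 * √2) * ∫ μ in (-1 : ℝ)..1, h ((1 + μ) / 2 * ξ + (1 - μ) / 2 * u) / √(1 - μ) =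
      (2 * √(ξ - u))⁻¹ * ∫ s in u..ξ, h s * (√(ξ - s))⁻¹ := by
  have hneg := mu_form_of_lt (fun s => h (-s)) (neg_lt_neg hlt)
  have e1 : ∀ μ : ℝ, -((1 + μ) / 2 * -ξ + (1 - μ) / 2 * -u) =
      (1 + μ) / 2 * ξ + (1 - μ) / 2 * u := fun μ => by ring
  have e2 : ∀ s : ℝ, s - -ξ = ξ - -s := fun s => by ring
  simp only [e1, e2] at hneg
  rw [hneg, intervalIntegral.integral_comp_neg (fun s => h s * (√(ξ - s))⁻¹), neg_neg, neg_neg]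

theorem convex_arg_mem {ξ u r : ℝ} (hξ : ξ ∈ Ioo (0 : ℝ) 1) (hu : u ∈ Ioo (0 : ℝ) 1)
    (hr : r ∈ Icc (0 : ℝ) 1) : (1 - r ^ 2) * ξ + r ^ 2 * u ∈ Ioo (0 : ℝ) 1 := by
  have h1 : 0 ≤ 1 - r ^ 2 := by nlinarith [hr.1, hr.2]
  exact (convex_Ioo (0 : ℝ) 1) hξ hu h1 (sq_nonneg r) (by ring)

theorem mu_form_eq_sqMean {h : ℝ → ℝ} (hh : ContinuousOn h (Ioo 0 1)) {ξ u : ℝ}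
    (hξ : ξ ∈ Ioo (0 : ℝ) 1) (hu : u ∈ Ioo (0 : ℝ) 1) :
    1 / (2 * √2) * ∫ μ in (-1 : ℝ)..1, h ((1 + μ) / 2 * ξ + (1 - μ) / 2 * u) / √(1 - μ) =
      sqMean h ξ u := by
  have h20 : √(2 : ℝ) ≠ 0 := (Real.sqrt_pos.2 (by norm_num)).ne'
  have h2 := Real.sq_sqrt (by norm_num : (0 : ℝ) ≤ 2)
  have hmem : ∀ μ ∈ Icc (-1 : ℝ) 1, (1 + μ) / 2 * ξ + (1 - μ) / 2 * u ∈ Ioo (0 : ℝ) 1 :=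
    fun μ hμ => by
      have h1 : 0 ≤ (1 + μ) / 2 := by linarith [hμ.1]
      have h3 : 0 ≤ (1 - μ) / 2 := by linarith [hμ.2]
      exact (convex_Ioo (0 : ℝ) 1) hξ hu h1 h3 (by ring)
  have hcont : ContinuousOn (fun μ : ℝ => h ((1 + μ) / 2 * ξ + (1 - μ) / 2 * u)) (Icc (-1) 1) :=
    hh.comp (by fun_prop) hmem
  have hmeanc : ContinuousOn (fun r : ℝ => h ((1 - r ^ 2) * ξ + r ^ 2 * u)) (Icc 0 1) :=
    hh.comp (by fun_prop) fun r hr => convex_arg_mem hξ hu hr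
  set g : ℝ → ℝ := fun μ => h ((1 + μ) / 2 * ξ + (1 - μ) / 2 * u) / √(1 - μ) with hg
  have himg : (fun r : ℝ => 1 - 2 * r ^ 2) '' Icc 0 1 ⊆ Icc (-1) 1 := by
    rintro _ ⟨r, hr, rfl⟩
    constructor <;> nlinarith [hr.1, hr.2]
  have hgi : IntegrableOn g (Icc (-1) 1) := by
    have hi : IntegrableOn (fun μ : ℝ => (√(1 - μ))⁻¹) (Icc (-1) 1) := by
      rw [integrableOn_Icc_iff_integrableOn_Ioo]
      exact integrableOn_inv_sqrt_sub (by norm_num)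
    exact hi.continuousOn_mul hcont isCompact_Icc
  have key := intervalIntegral.integral_comp_mul_deriv''' (a := 0) (b := 1)
    (f := fun r : ℝ => 1 - 2 * r ^ 2) (f' := fun r => -4 * r) (g := g) (by fun_prop)
    (fun r _ => by
      have := ((hasDerivAt_pow 2 r).const_mul 2).const_sub 1
      refine (this.congr_deriv ?_).hasDerivWithinAt
      norm_num; ring)
    (by
      rw [min_eq_left zero_le_one, max_eq_right zero_le_one]
      refine ContinuousOn.div (hcont.mono ?_) (by fun_prop) ?_
      · exact (image_mono Ioo_subset_Icc_self).trans himg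
      · rintro _ ⟨r, hr, rfl⟩
        refine (Real.sqrt_pos.2 ?_).ne'
        nlinarith [hr.1])
    (by rw [uIcc_of_le zero_le_one]; exact hgi.mono_set himg)
    (by
      rw [uIcc_of_le zero_le_one, integrableOn_Icc_iff_integrableOn_Ioc]
      refine IntegrableOn.congr_fun (f := fun r : ℝ => (-4 / √2) *
        h ((1 - r ^ 2) * ξ + r ^ 2 * u)) ?_ ?_ measurableSet_Ioc
      · exact ((hmeanc.const_smul (-4 / √2)).integrableOn_Icc).mono_set Ioc_subset_Icc_self
      · intro r hr
        simp only [Function.comp, hg]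
        have e1 : 1 - (1 - 2 * r ^ 2) = 2 * r ^ 2 := by ring
        have e2 : (1 + (1 - 2 * r ^ 2)) / 2 * ξ + 2 * r ^ 2 / 2 * u =
          (1 - r ^ 2) * ξ + r ^ 2 * u := by ring
        rw [e1, e2, Real.sqrt_mul (by norm_num), Real.sqrt_sq hr.1.le]
        have := hr.1.ne'
        field_simp)
  have e0 : ∫ r in (0 : ℝ)..1, (g ∘ fun r : ℝ => 1 - 2 * r ^ 2) r * (-4 * r) =
      ∫ r in (0 : ℝ)..1, (-4 / √2) * h ((1 - r ^ 2) * ξ + r ^ 2 * u) := by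
    refine intervalIntegral.integral_congr_ae (ae_of_all _ fun r hr => ?_)
    rw [uIoc_of_le zero_le_one] at hr
    simp only [Function.comp, hg]
    have e1 : 1 - (1 - 2 * r ^ 2) = 2 * r ^ 2 := by ring
    have e2 : (1 + (1 - 2 * r ^ 2)) / 2 * ξ + 2 * r ^ 2 / 2 * u =
      (1 - r ^ 2) * ξ + r ^ 2 * u := by ring
    rw [e1, e2, Real.sqrt_mul (by norm_num), Real.sqrt_sq hr.1.le]
    have := hr.1.ne'
    field_simp
  rw [e0, intervalIntegral.integral_const_mul] at key
  have e1 : (1 : ℝ) - 2 * 0 ^ 2 = 1 := by norm_num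
  have e2 : (1 : ℝ) - 2 * 1 ^ 2 = -1 := by norm_num
  rw [e1, e2, intervalIntegral.integral_symm (-1) 1] at key
  have e3 : ∫ μ in (-1 : ℝ)..1, g μ = 4 / √2 * sqMean h ξ u := by
    unfold sqMean
    linear_combination key
  rw [e3]
  field_simp
  rw [h2]; norm_num

/-! ### Abel identities for `Φ₀` -/

/-- Fubini on the triangle `s < v` for the kernel `1/√(v-s)`, whose integral over `v ∈ (s,q)` is
`2√(q-s)`. -/
theorem integral_triangle {h : ℝ → ℝ} {p q : ℝ} (hpq : p ≤ q) (hh : ContinuousOn h (Icc p q)) :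
    IntegrableOn (fun v => ∫ s in Ioo p q, h s * (√(v - s))⁻¹) (Ioo p q) ∧
    ∫ v in Ioo p q, ∫ s in Ioo p q, h s * (√(v - s))⁻¹ =
      2 * ∫ s in p..q, h s * √(q - s) := by
  have hmeas := (hh.mono Ioo_subset_Icc_self).aestronglyMeasurable measurableSet_Ioo (μ := volume)
  have hc : ContinuousOn (fun s => h s * (2 * √(q - s))) (Icc p q) := hh.mul (by fun_prop)
  have := integral_kernel_swap (I := Ioo p q) (J := Ioo p q) measurableSet_Ioo hmeas
    (k := fun v s => (√(v - s))⁻¹) (by unfold Function.uncurry; fun_prop)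
    (fun v s => by positivity) (κ := fun s => 2 * √(q - s)) (fun s _ => by positivity)
    (fun s hs => by
      rw [setLIntegral_eq_of_subset_of_eq_zero (A := Ioo s q) (Ioo_subset_Ioo hs.1.le le_rfl)
        measurableSet_Ioo _ measurableSet_Ioo, lintegral_inv_sqrt_sub_left hs.2.le]
      intro v hv hv'
      have : v ≤ s := by
        by_contra hc
        exact hv' ⟨not_le.1 hc, hv.2⟩
      rw [Real.sqrt_eq_zero_of_nonpos (by linarith : v - s ≤ 0)]; simp)
    (hc.integrableOn_Icc.mono_set Ioo_subset_Icc_self)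
  refine ⟨this.1.integral_prod_left, this.2.trans ?_⟩
  rw [intervalIntegral.integral_of_le hpq, integral_Ioc_eq_integral_Ioo, ← integral_const_mul]
  exact integral_congr_ae (ae_of_all _ fun s => by ring)

theorem setIntegral_Ioo_cut {h : ℝ → ℝ} {p v q : ℝ} (hpv : p ≤ v) (hvq : v ≤ q) :
    ∫ s in Ioo p q, h s * (√(v - s))⁻¹ = ∫ s in p..v, h s * (√(v - s))⁻¹ := by
  rw [intervalIntegral.integral_of_le hpv, integral_Ioc_eq_integral_Ioo]
  refine (setIntegral_eq_of_subset_of_forall_sdiff_eq_zero measurableSet_Ioo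
    (Ioo_subset_Ioo le_rfl hvq) ?_)
  intro s hs
  have : v ≤ s := by
    by_contra hc
    exact hs.2 ⟨hs.1.1, not_le.1 hc⟩
  rw [Real.sqrt_eq_zero_of_nonpos (by linarith : v - s ≤ 0)]; simp

theorem phi0_of_lt (f : ℝ → ℝ) (x t : ℝ) {ξ u : ℝ} (hlt : ξ < u) :
    phi0 f x t ξ u =
      (2 * √(u - ξ))⁻¹ * ∫ s in ξ..u, deriv (hodograph f x t) s * (√(s - ξ))⁻¹ :=
  mu_form_of_lt _ hlt

theorem phi0_of_gt (f : ℝ → ℝ) (x t : ℝ) {ξ u : ℝ} (hlt : u < ξ) :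
    phi0 f x t ξ u =
      (2 * √(ξ - u))⁻¹ * ∫ s in u..ξ, deriv (hodograph f x t) s * (√(ξ - s))⁻¹ :=
  mu_form_of_gt _ hlt

/-- Integration of the right Abel form of `Φ₀` raises the order of the Abel kernel by one. -/
theorem integral_sqrt_mul_of_abel {h Ψ : ℝ → ℝ} {u ξ : ℝ} (hu : u ≤ ξ)
    (hh : ContinuousOn h (Icc u ξ))
    (hΨ : ∀ v ∈ Ioo u ξ, Ψ v = (2 * √(v - u))⁻¹ * ∫ s in u..v, h s * (√(v - s))⁻¹) :
    ∫ v in u..ξ, √(v - u) * Ψ v = ∫ s in u..ξ, h s * √(ξ - s) := by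
  have e : ∫ v in u..ξ, √(v - u) * Ψ v =
      1 / 2 * ∫ v in Ioo u ξ, ∫ s in Ioo u ξ, h s * (√(v - s))⁻¹ := by
    rw [intervalIntegral.integral_of_le hu, integral_Ioc_eq_integral_Ioo, ← integral_const_mul]
    refine setIntegral_congr_fun measurableSet_Ioo fun v hv => ?_
    rw [setIntegral_Ioo_cut hv.1.le hv.2.le, hΨ v hv]
    have := (Real.sqrt_pos.2 (sub_pos.2 hv.1)).ne'
    field_simp
  rw [e, (integral_triangle hu hh).2]; ring

theorem integral_sqrt_mul_phi0 {f : ℝ → ℝ} {x t u ξ : ℝ} (hu : u ≤ ξ)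
    (hh : ContinuousOn (deriv (hodograph f x t)) (Icc u ξ)) :
    ∫ v in u..ξ, √(v - u) * phi0 f x t v u =
      ∫ s in u..ξ, deriv (hodograph f x t) s * √(ξ - s) :=
  integral_sqrt_mul_of_abel hu hh fun _ hv => phi0_of_gt f x t hv.1

/-- Integration by parts in the Abel transform of `H`, for `H(u) = 0`. -/
theorem integral_mul_inv_sqrt_of_deriv {H h : ℝ → ℝ} {u ξ : ℝ} (hu : u ≤ ξ)
    (hh : ContinuousOn h (Icc u ξ)) (hd : ∀ s ∈ Icc u ξ, HasDerivAt H (h s) s) (h0 : H u = 0) :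
    ∫ s in Ioo u ξ, H s * (√(ξ - s))⁻¹ = 2 * ∫ s in u..ξ, h s * √(ξ - s) := by
  have hmeas := (hh.mono Ioo_subset_Icc_self).aestronglyMeasurable measurableSet_Ioo (μ := volume)
  have hc : ContinuousOn (fun s => h s * (2 * √(ξ - s))) (Icc u ξ) := hh.mul (by fun_prop)
  have hkm : Measurable (Function.uncurry fun v s : ℝ =>
      {p : ℝ × ℝ | p.2 < p.1}.indicator (fun p => (√(ξ - p.1))⁻¹) (v, s)) :=
    Measurable.indicator (by fun_prop) (measurableSet_lt measurable_snd measurable_fst)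
  have := integral_kernel_swap (I := Ioo u ξ) (J := Ioo u ξ) measurableSet_Ioo hmeas
    (k := fun v s => {p : ℝ × ℝ | p.2 < p.1}.indicator (fun p => (√(ξ - p.1))⁻¹) (v, s)) hkm
    (fun v s => indicator_nonneg (fun p _ => by positivity) _) (κ := fun s => 2 * √(ξ - s))
    (fun s _ => by positivity)
    (fun s hs => by
      rw [setLIntegral_eq_of_subset_of_eq_zero (A := Ioo s ξ) (Ioo_subset_Ioo hs.1.le le_rfl)
        measurableSet_Ioo _ measurableSet_Ioo, ← lintegral_inv_sqrt_sub_right hs.2.le]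
      · refine setLIntegral_congr_fun measurableSet_Ioo fun v hv => ?_
        rw [indicator_of_mem (show (v, s) ∈ {p : ℝ × ℝ | p.2 < p.1} from hv.1)]
      · intro v hv hv'
        have : ¬ s < v := fun hc => hv' ⟨hc, hv.2⟩
        rw [indicator_of_notMem (show (v, s) ∉ {p : ℝ × ℝ | p.2 < p.1} from this)]; simp)
    (hc.integrableOn_Icc.mono_set Ioo_subset_Icc_self)
  have e1 : ∫ s in Ioo u ξ, H s * (√(ξ - s))⁻¹ = ∫ v in Ioo u ξ, ∫ s in Ioo u ξ, h s *
      {p : ℝ × ℝ | p.2 < p.1}.indicator (fun p => (√(ξ - p.1))⁻¹) (v, s) := by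
    refine setIntegral_congr_fun measurableSet_Ioo fun v hv => ?_
    have e2 : ∀ s, h s * {p : ℝ × ℝ | p.2 < p.1}.indicator (fun p => (√(ξ - p.1))⁻¹) (v, s) =
        (Iio v).indicator (fun s => h s * (√(ξ - v))⁻¹) s := by
      intro s
      by_cases hs : s < v
      · rw [indicator_of_mem (show (v, s) ∈ {p : ℝ × ℝ | p.2 < p.1} from hs),
          indicator_of_mem (show s ∈ Iio v from hs)]
      · rw [indicator_of_notMem (show (v, s) ∉ {p : ℝ × ℝ | p.2 < p.1} from hs),
          indicator_of_notMem (show s ∉ Iio v from hs), mul_zero]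
    simp_rw [e2]
    rw [setIntegral_indicator measurableSet_Iio, integral_mul_const]
    have e3 : Ioo u ξ ∩ Iio v = Ioo u v := by
      rw [Ioo_inter_Iio, min_eq_right hv.2.le]
    have hsub : Icc u v ⊆ Icc u ξ := Icc_subset_Icc le_rfl hv.2.le
    rw [e3, ← integral_Ioc_eq_integral_Ioo, ← intervalIntegral.integral_of_le hv.1.le,
      intervalIntegral.integral_eq_sub_of_hasDerivAt (f := H), h0, sub_zero]
    · intro s hs
      rw [uIcc_of_le hv.1.le] at hs
      exact hd s (hsub hs)
    · refine ContinuousOn.intervalIntegrable ?_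
      rw [uIcc_of_le hv.1.le]
      exact hh.mono hsub
  rw [e1, this.2, intervalIntegral.integral_of_le hu, integral_Ioc_eq_integral_Ioo,
    ← integral_const_mul]
  exact integral_congr_ae (ae_of_all _ fun s => by ring)

theorem psi_eq_zero {f : ℝ → ℝ} {x t u η : ℝ} (hη : η ∉ Ioo 0 (√u)) :
    psi f x t u η = 0 := by
  unfold psi
  by_cases h1 : η ∈ Ioo (0 : ℝ) 1
  · rw [indicator_of_mem h1]
    have h2 : √u ≤ η := by
      by_contra hc
      exact hη ⟨h1.1, not_le.1 hc⟩
    have h3 : u ≤ η ^ 2 := (Real.sqrt_le_left h1.1.le).1 h2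
    simp [reIR, Real.sqrt_eq_zero_of_nonpos (by linarith : u - η ^ 2 ≤ 0)]
  · rw [indicator_of_notMem h1]

theorem psi_eq_of_mem {f : ℝ → ℝ} {x t u η : ℝ} (hu1 : u ≤ 1) (hη : η ∈ Ioo 0 (√u)) :
    psi f x t u η = 2 * η * √(u - η ^ 2) * phi0 f x t (η ^ 2) u := by
  have h1 : η ∈ Ioo (0 : ℝ) 1 := ⟨hη.1, hη.2.trans_le (Real.sqrt_le_one.2 hu1)⟩
  rw [psi, indicator_of_mem h1, reIR]; ring

theorem psi_eq_integral {f : ℝ → ℝ} {x t u η : ℝ} (hu1 : u ≤ 1) (hη : η ∈ Ioo 0 (√u)) :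
    psi f x t u η =
      η * ∫ s in (η ^ 2)..u, deriv (hodograph f x t) s * (√(s - η ^ 2))⁻¹ := by
  have h2 : η ^ 2 < u := (Real.lt_sqrt hη.1.le).1 hη.2
  have := (Real.sqrt_pos.2 (sub_pos.2 h2)).ne'
  rw [psi_eq_of_mem hu1 hη, phi0_of_lt f x t h2]
  field_simp

/-- The Abel transform of `ψ` is `-(π/2) H` on `(0,u)`. -/
theorem integral_psi_mul_abelKernel {f : ℝ → ℝ} {x t u s : ℝ} (hs : 0 < s) (hsu : s < u)
    (hu1 : u < 1) (hh : ContinuousOn (deriv (hodograph f x t)) (Icc s u))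
    (hd : ∀ r ∈ Icc s u, HasDerivAt (hodograph f x t) (deriv (hodograph f x t) r) r)
    (h0 : hodograph f x t u = 0) :
    IntegrableOn (fun η => psi f x t u η * abelKernel s η) (Ioo 0 1) ∧
    ∫ η in Ioo (0 : ℝ) 1, psi f x t u η * abelKernel s η =
      -(Real.pi / 2) * hodograph f x t s := by
  set h := deriv (hodograph f x t) with hdef
  have hmeas := (hh.mono Ioo_subset_Icc_self).aestronglyMeasurable measurableSet_Ioo (μ := volume)
  have hKm := measurable_abelKernel
  have hkm : Measurable (Function.uncurry fun η r : ℝ =>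
      if 0 ≤ η then η * abelKernel s η * (√(r - η ^ 2))⁻¹ else 0) := by
    have h1 : Measurable fun p : ℝ × ℝ => abelKernel s p.1 :=
      hKm.comp (measurable_const.prodMk measurable_fst)
    refine Measurable.ite (measurableSet_le measurable_const measurable_fst) ?_ measurable_const
    exact (measurable_fst.mul h1).mul (by fun_prop)
  -- the kernel is cut off at `η < 0` so as to be nonnegative everywhere
  have key := integral_kernel_swap (I := Ioo 0 1) (J := Ioo s u) measurableSet_Ioo hmeas
    (k := fun η r => if 0 ≤ η then η * abelKernel s η * (√(r - η ^ 2))⁻¹ else 0) hkm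
    (fun η r => by
      have := abelKernel_nonneg s η
      split_ifs <;> positivity)
    (κ := fun _ => Real.pi / 2) (fun r _ => by positivity)
    (fun r hr => by
      rw [← lintegral_beta_sq hs.le hr.1 (hr.2.trans hu1).le]
      refine setLIntegral_congr_fun measurableSet_Ioo fun η hη => ?_
      simp only [hη.1.le, if_true])
    ((hh.integrableOn_Icc.mono_set Ioo_subset_Icc_self).mul_const _)
  have e : ∀ η ∈ Ioo (0 : ℝ) 1, (∫ r in Ioo s u, h r *
      (if 0 ≤ η then η * abelKernel s η * (√(r - η ^ 2))⁻¹ else 0)) =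
      psi f x t u η * abelKernel s η := by
    intro η hη
    simp only [hη.1.le, if_true]
    have e1 : ∀ r, h r * (η * abelKernel s η * (√(r - η ^ 2))⁻¹) =
        η * abelKernel s η * (h r * (√(r - η ^ 2))⁻¹) := fun r => by ring
    simp_rw [e1]
    rw [integral_const_mul]
    rcases le_or_gt (η ^ 2) s with hηs | hηs
    · simp [abelKernel_eq_zero hηs]
    rcases lt_or_ge (η ^ 2) u with hηu | hηu
    · have hη' : η ∈ Ioo 0 (√u) := ⟨hη.1, (Real.lt_sqrt hη.1.le).2 hηu⟩
      rw [psi_eq_integral hu1.le hη', ← hdef, intervalIntegral.integral_of_le hηu.le,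
        integral_Ioc_eq_integral_Ioo]
      have : ∫ r in Ioo s u, h r * (√(r - η ^ 2))⁻¹ =
          ∫ r in Ioo (η ^ 2) u, h r * (√(r - η ^ 2))⁻¹ := by
        refine setIntegral_eq_of_subset_of_forall_sdiff_eq_zero measurableSet_Ioo
          (Ioo_subset_Ioo hηs.le le_rfl) fun r hr => ?_
        have : r ≤ η ^ 2 := by
          by_contra hc
          exact hr.2 ⟨not_le.1 hc, hr.1.2⟩
        rw [Real.sqrt_eq_zero_of_nonpos (by linarith : r - η ^ 2 ≤ 0)]; simp
      rw [this]; ring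
    · rw [psi_eq_zero (fun hc => absurd ((Real.lt_sqrt hη.1.le).1 hc.2)
        (not_lt.2 hηu)), zero_mul]
      have : ∫ r in Ioo s u, h r * (√(r - η ^ 2))⁻¹ = 0 := by
        rw [setIntegral_congr_fun (g := fun _ => 0) measurableSet_Ioo]
        · simp
        · intro r hr
          simp only
          rw [Real.sqrt_eq_zero_of_nonpos (by linarith [hr.2] : r - η ^ 2 ≤ 0)]; simp
      rw [this, mul_zero]
  constructor
  · exact IntegrableOn.congr_fun key.1.integral_prod_left e measurableSet_Ioo
  · rw [← setIntegral_congr_fun measurableSet_Ioo e, key.2, integral_mul_const,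
      ← integral_Ioc_eq_integral_Ioo, ← intervalIntegral.integral_of_le hsu.le,
      intervalIntegral.integral_eq_sub_of_hasDerivAt (f := hodograph f x t), h0]
    · ring
    · rwa [uIcc_of_le hsu.le]
    · refine ContinuousOn.intervalIntegrable ?_
      rwa [uIcc_of_le hsu.le]

/-! ### Continuity of the averages -/

theorem exists_continuous_eqOn_Icc {h : ℝ → ℝ} {p q : ℝ} (hpq : p ≤ q)
    (hh : ContinuousOn h (Icc p q)) : ∃ g : ℝ → ℝ, Continuous g ∧ EqOn g h (Icc p q) :=
  ⟨IccExtend hpq ((Icc p q).domRestrict h),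
    (continuousOn_iff_continuous_domRestrict.1 hh).Icc_extend',
    fun _ hs => IccExtend_of_mem hpq _ hs⟩

theorem exists_Icc_mem_nhds {ξ : ℝ} (hξ : ξ ∈ Ioo (0 : ℝ) 1) {u : ℝ} (hu : u ∈ Ioo (0 : ℝ) 1) :
    ∃ p q, 0 < p ∧ p ≤ q ∧ q < 1 ∧ Icc p q ∈ 𝓝 ξ ∧ Icc p q ∈ 𝓝 u := by
  have h1 : 0 < min ξ u := lt_min hξ.1 hu.1
  have h2 : max ξ u < 1 := max_lt hξ.2 hu.2
  have h3 : min ξ u ≤ ξ := min_le_left _ _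
  have h4 : min ξ u ≤ u := min_le_right _ _
  have h5 : ξ ≤ max ξ u := le_max_left _ _
  have h6 : u ≤ max ξ u := le_max_right _ _
  refine ⟨min ξ u / 2, (1 + max ξ u) / 2, by linarith, by linarith, by linarith,
    Icc_mem_nhds (by linarith) (by linarith), Icc_mem_nhds (by linarith) (by linarith)⟩

theorem convex_arg_mem_Icc {p q ξ u r : ℝ} (hξ : ξ ∈ Icc p q) (hu : u ∈ Icc p q)
    (hr : r ∈ Icc (0 : ℝ) 1) : (1 - r ^ 2) * ξ + r ^ 2 * u ∈ Icc p q := by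
  have h1 : 0 ≤ 1 - r ^ 2 := by nlinarith [hr.1, hr.2]
  exact (convex_Icc p q) hξ hu h1 (sq_nonneg r) (by ring)

theorem continuousOn_sqMean {h : ℝ → ℝ} (hh : ContinuousOn h (Ioo 0 1)) :
    ContinuousOn (Function.uncurry (sqMean h)) (Ioo 0 1 ×ˢ Ioo 0 1) := by
  rintro ⟨ξ, u⟩ ⟨hξ, hu⟩
  obtain ⟨p, q, hp, hpq, hq, n1, n2⟩ := exists_Icc_mem_nhds hξ hu
  obtain ⟨g, hg, hgh⟩ := exists_continuous_eqOn_Icc hpq (hh.mono (Icc_subset_Ioo hp hq))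
  have hc : Continuous (Function.uncurry (sqMean g)) := by
    unfold sqMean Function.uncurry
    refine intervalIntegral.continuous_parametric_intervalIntegral_of_continuous' ?_ 0 1
    unfold Function.uncurry
    fun_prop
  refine (hc.continuousAt.congr ?_).continuousWithinAt
  filter_upwards [prod_mem_nhds n1 n2] with z hz
  refine intervalIntegral.integral_congr fun r hr => ?_
  rw [uIcc_of_le zero_le_one] at hr
  exact hgh (convex_arg_mem_Icc hz.1 hz.2 hr)

namespace InitialData

variable {u₀ f : ℝ → ℝ}

theorem hasDerivAt_f (h : InitialData u₀ f) {s : ℝ} (hs : s ∈ Ioo (0 : ℝ) 1) :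
    HasDerivAt f (deriv f s) s :=
  ((h.smooth.differentiableOn (by norm_num)).differentiableAt
    (isOpen_Ioo.mem_nhds hs)).hasDerivAt

theorem hasDerivAt_hodograph_explicit (h : InitialData u₀ f) (x t : ℝ) {s : ℝ}
    (hs : s ∈ Ioo (0 : ℝ) 1) :
    HasDerivAt (hodograph f x t) (-60 * t * s - deriv f s) s := by
  have := (((hasDerivAt_pow 2 s).const_mul (30 * t)).const_sub x).sub (h.hasDerivAt_f hs)
  refine this.congr_deriv ?_
  norm_num; ring

theorem hasDerivAt_hodograph (h : InitialData u₀ f) (x t : ℝ) {s : ℝ} (hs : s ∈ Ioo (0 : ℝ) 1) :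
    HasDerivAt (hodograph f x t) (deriv (hodograph f x t) s) s :=
  (h.hasDerivAt_hodograph_explicit x t hs).differentiableAt.hasDerivAt

theorem continuousOn_deriv_hodograph (h : InitialData u₀ f) (x t : ℝ) :
    ContinuousOn (deriv (hodograph f x t)) (Ioo 0 1) := by
  have h1 : ContinuousOn (fun s => -60 * t * s - deriv f s) (Ioo 0 1) :=
    ContinuousOn.sub (by fun_prop) (h.smooth.continuousOn_deriv_of_isOpen isOpen_Ioo (by norm_num))
  exact h1.congr fun s hs => (h.hasDerivAt_hodograph_explicit x t hs).deriv

end InitialData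

/-! ### The one-interval minimizer -/

/-- The conditions under which `ψ` with support `[0,√u]` solves the minimization problem: the
hodograph equation at `u` and the two variational inequalities, not necessarily strict. -/
structure OneInterval (u₀ f : ℝ → ℝ) (x t u : ℝ) : Prop where
  init : InitialData u₀ f
  mem : u ∈ Ioo (0 : ℝ) 1
  hod : hodograph f x t u = 0
  left : ∀ ξ ∈ Ioo 0 u, 0 ≤ phi0 f x t ξ u
  right : ∀ ξ ∈ Ioo u 1, 0 ≤ ∫ v in u..ξ, √(v - u) * phi0 f x t v u

namespace OneInterval

variable {u₀ f : ℝ → ℝ} {x t u : ℝ}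

theorem measurable_psi (d : OneInterval u₀ f x t u) : Measurable (psi f x t u) := by
  have hc : ContinuousOn (fun η => -2 * η * reIR (η ^ 2) u * phi0 f x t (η ^ 2) u) (Ioo 0 1) := by
    refine ContinuousOn.mul (by unfold reIR; fun_prop) ?_
    have hsq : ∀ η ∈ Ioo (0 : ℝ) 1, η ^ 2 ∈ Ioo (0 : ℝ) 1 := fun η hη =>
      ⟨by nlinarith [hη.1], by nlinarith [hη.1, hη.2]⟩
    have h1 : ContinuousOn (fun η : ℝ => sqMean (deriv (hodograph f x t)) (η ^ 2) u) (Ioo 0 1) :=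
      (continuousOn_sqMean (d.init.continuousOn_deriv_hodograph x t)).comp
        (f := fun η : ℝ => (η ^ 2, u)) (by fun_prop) fun η hη => ⟨hsq η hη, d.mem⟩
    exact h1.congr fun η hη =>
      mu_form_eq_sqMean (d.init.continuousOn_deriv_hodograph x t) (hsq η hη) d.mem
  have := hc.measurable_piecewise (g := (0 : ℝ → ℝ)) continuousOn_const measurableSet_Ioo
  rwa [piecewise_eq_indicator] at this

theorem psi_nonneg (d : OneInterval u₀ f x t u) (η : ℝ) : 0 ≤ psi f x t u η := by
  by_cases hη : η ∈ Ioo 0 (√u)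
  · rw [psi_eq_of_mem d.mem.2.le hη]
    have := d.left (η ^ 2) ⟨by have := hη.1; positivity, (Real.lt_sqrt hη.1.le).1 hη.2⟩
    have := hη.1
    positivity
  · rw [psi_eq_zero hη]

theorem integral_psi (d : OneInterval u₀ f x t u) {s : ℝ} (hs : s ∈ Ioo 0 u) :
    IntegrableOn (fun η => psi f x t u η * abelKernel s η) (Ioo 0 1) ∧
    ∫ η in Ioo (0 : ℝ) 1, psi f x t u η * abelKernel s η =
      -(Real.pi / 2) * hodograph f x t s := by
  have hsub : Icc s u ⊆ Ioo (0 : ℝ) 1 := Icc_subset_Ioo hs.1 d.mem.2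
  exact integral_psi_mul_abelKernel hs.1 hs.2 d.mem.2
    ((d.init.continuousOn_deriv_hodograph x t).mono hsub)
    (fun r hr => d.init.hasDerivAt_hodograph x t (hsub hr)) d.hod

/-- Positivity of `Φ₀` on the left forces the hodograph function to be nonpositive there. -/
theorem hodograph_nonpos (d : OneInterval u₀ f x t u) {s : ℝ} (hs : s ∈ Ioo 0 u) :
    hodograph f x t s ≤ 0 := by
  have h1 : 0 ≤ ∫ η in Ioo (0 : ℝ) 1, psi f x t u η * abelKernel s η :=
    integral_nonneg fun η => mul_nonneg (d.psi_nonneg η) (abelKernel_nonneg s η)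
  rw [(d.integral_psi hs).2] at h1
  nlinarith [Real.pi_pos]

/-- The Abel transform of `ψ`, as a real function. -/
def target (f : ℝ → ℝ) (x t u : ℝ) : ℝ → ℝ :=
  (Ioo 0 u).indicator fun s => -(Real.pi / 2) * hodograph f x t s

theorem target_nonneg (d : OneInterval u₀ f x t u) (s : ℝ) : 0 ≤ target f x t u s :=
  indicator_nonneg (fun s hs => by
    have := d.hodograph_nonpos hs
    nlinarith [Real.pi_pos]) s

theorem abelT_psi (d : OneInterval u₀ f x t u) {s : ℝ} (hs : 0 < s) :
    abelT (psi f x t u) s = ENNReal.ofReal (target f x t u s) := by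
  unfold target
  by_cases hsu : s < u
  · obtain ⟨h1, h2⟩ := d.integral_psi ⟨hs, hsu⟩
    rw [indicator_of_mem (show s ∈ Ioo 0 u from ⟨hs, hsu⟩), ← h2,
      ofReal_integral_eq_lintegral_ofReal h1 (ae_of_all _ fun η => mul_nonneg (d.psi_nonneg η)
        (abelKernel_nonneg s η))]
    rfl
  · rw [indicator_of_notMem (fun h => hsu h.2), ENNReal.ofReal_zero, abelT]
    have : ∀ η, ENNReal.ofReal (psi f x t u η * abelKernel s η) = 0 := by
      intro η
      by_cases hη : η ∈ Ioo 0 (√u)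
      · have h2 : η ^ 2 < u := (Real.lt_sqrt hη.1.le).1 hη.2
        rw [abelKernel_eq_zero (by linarith), mul_zero, ENNReal.ofReal_zero]
      · rw [psi_eq_zero hη, zero_mul, ENNReal.ofReal_zero]
    simp [this]

theorem integrableOn_hodograph_sq (d : OneInterval u₀ f x t u) :
    IntegrableOn (fun s => hodograph f x t s ^ 2) (Ioo 0 u) := by
  obtain ⟨C, hC⟩ := d.init.exists_bound_hodograph x t d.mem
  have hc : AEStronglyMeasurable (hodograph f x t) (volume.restrict (Ioo 0 u)) :=
    ((d.init.continuousOn_hodograph x t).mono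
      (Ioo_subset_Ioo le_rfl d.mem.2.le)).aestronglyMeasurable measurableSet_Ioo
  refine Integrable.mono'
    ((d.init.integrableOn_hodograph_mul_inv_sqrt x t d.mem).norm.const_mul C) (hc.pow 2) ?_
  refine (ae_restrict_iff' measurableSet_Ioo).2 (ae_of_all _ fun s hs => ?_)
  have h1 := hC s ⟨hs.1, hs.2.le⟩
  have h2 := Real.sqrt_pos.2 hs.1
  rw [Real.norm_eq_abs, abs_of_nonneg (sq_nonneg _), Real.norm_eq_abs, abs_mul,
    abs_of_pos (inv_pos.2 h2), ← sq_abs]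
  have h3 : 0 ≤ |hodograph f x t s| * (√s)⁻¹ := by positivity
  calc |hodograph f x t s| ^ 2
      = (|hodograph f x t s| * √s) * (|hodograph f x t s| * (√s)⁻¹) := by field_simp
    _ ≤ C * (|hodograph f x t s| * (√s)⁻¹) := by gcongr

theorem integrable_target_sq (d : OneInterval u₀ f x t u) :
    IntegrableOn (fun s => target f x t u s ^ 2) (Ioo 0 1) := by
  have h1 := (Integrable.const_mul d.integrableOn_hodograph_sq ((Real.pi / 2) ^ 2))
  have h2 : Integrable ((Ioo 0 u).indicator
      fun s => (Real.pi / 2) ^ 2 * hodograph f x t s ^ 2) :=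
    IntegrableOn.integrable_indicator h1 measurableSet_Ioo
  refine h2.integrableOn.congr (ae_of_all _ fun s => ?_)
  unfold target
  by_cases hs : s ∈ Ioo 0 u
  · simp only [indicator_of_mem hs]; ring
  · simp only [indicator_of_notMem hs]; ring

theorem integrableOn_psi (d : OneInterval u₀ f x t u) : IntegrableOn (psi f x t u) (Ioo 0 1) := by
  refine ⟨d.measurable_psi.aestronglyMeasurable, ?_⟩
  rw [hasFiniteIntegral_iff_ofReal (ae_of_all _ d.psi_nonneg)]
  have h1 := lintegral_abelT_mul_inv_sqrt d.measurable_psi d.psi_nonneg le_rfl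
  rw [Real.sqrt_zero] at h1
  have h2 : ∫⁻ s in Ioo (0 : ℝ) 1, abelT (psi f x t u) s * ENNReal.ofReal ((√(s - 0))⁻¹) < ⊤ := by
    have e : ∫⁻ s in Ioo (0 : ℝ) 1, abelT (psi f x t u) s * ENNReal.ofReal ((√(s - 0))⁻¹) =
        ∫⁻ s in Ioo (0 : ℝ) 1, ENNReal.ofReal (target f x t u s * (√s)⁻¹) := by
      refine setLIntegral_congr_fun measurableSet_Ioo fun s hs => ?_
      simp only [sub_zero]
      rw [d.abelT_psi hs.1, ← ENNReal.ofReal_mul (d.target_nonneg s)]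
    have hi : Integrable ((Ioo 0 u).indicator
        fun s => -(Real.pi / 2) * (hodograph f x t s * (√s)⁻¹)) :=
      IntegrableOn.integrable_indicator (Integrable.const_mul
        (d.init.integrableOn_hodograph_mul_inv_sqrt x t d.mem) _) measurableSet_Ioo
    have hi' : IntegrableOn (fun s => target f x t u s * (√s)⁻¹) (Ioo 0 1) := by
      refine hi.integrableOn.congr (ae_of_all _ fun s => ?_)
      unfold target
      by_cases hs : s ∈ Ioo 0 u
      · simp only [indicator_of_mem hs]; ring
      · simp only [indicator_of_notMem hs]; ring
    rw [e]
    exact hi'.lintegral_lt_top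
  rw [h1] at h2
  by_contra hc
  rw [not_lt, top_le_iff] at hc
  rw [hc, ENNReal.mul_top (by simpa using Real.pi_pos)] at h2
  exact lt_irrefl _ h2

theorem admissible_psi (d : OneInterval u₀ f x t u) : Admissible (psi f x t u) :=
  ⟨ae_of_all _ d.psi_nonneg, d.integrableOn_psi⟩

/-- The part of the linear term `a(η)` that comes from the interval `(0,u)`. -/
def innerPart (f : ℝ → ℝ) (x t u η : ℝ) : ℝ :=
  1 / 2 * ∫ s in Ioo 0 u, hodograph f x t s * abelKernel s η

theorem aestronglyMeasurable_hodograph (d : OneInterval u₀ f x t u) :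
    AEStronglyMeasurable (hodograph f x t) (volume.restrict (Ioo 0 u)) :=
  ((d.init.continuousOn_hodograph x t).mono
    (Ioo_subset_Ioo le_rfl d.mem.2.le)).aestronglyMeasurable measurableSet_Ioo

/-- A bound for the inner part, uniform in `η`, from `|H| ≤ C/√s` and the Beta integral. -/
theorem exists_bound_lintegral_inner (d : OneInterval u₀ f x t u) :
    ∃ M, 0 ≤ M ∧ ∀ η ∈ Ioo (0 : ℝ) 1,
    ∫⁻ s in Ioo 0 u, ENNReal.ofReal (|hodograph f x t s| * abelKernel s η) ≤
      ENNReal.ofReal M := by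
  obtain ⟨C, hC⟩ := d.init.exists_bound_hodograph x t d.mem
  have hC0 : 0 ≤ C := (by positivity : 0 ≤ |hodograph f x t u| * √u).trans
    (hC u ⟨d.mem.1, le_rfl⟩)
  refine ⟨C * Real.pi, by positivity, fun η hη => ?_⟩
  have h0 : 0 < η ^ 2 := by have := hη.1; positivity
  have h1 : ∫⁻ s in Ioo 0 u, ENNReal.ofReal (|hodograph f x t s| * abelKernel s η) ≤
      ∫⁻ s in Ioo 0 u, ENNReal.ofReal C * (Ioo 0 (η ^ 2)).indicator
        (fun s => ENNReal.ofReal ((√(s - 0))⁻¹ * (√(η ^ 2 - s))⁻¹)) s := by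
    refine setLIntegral_mono' measurableSet_Ioo fun s hs => ?_
    by_cases hsη : s < η ^ 2
    · rw [indicator_of_mem (show s ∈ Ioo 0 (η ^ 2) from ⟨hs.1, hsη⟩), ← ENNReal.ofReal_mul hC0]
      refine ENNReal.ofReal_le_ofReal ?_
      have h2 := hC s ⟨hs.1, hs.2.le⟩
      have h3 := Real.sqrt_pos.2 hs.1
      rw [sub_zero, ← mul_assoc]
      refine mul_le_mul_of_nonneg_right ?_ (abelKernel_nonneg s η)
      rw [← div_eq_mul_inv, le_div_iff₀ h3]
      exact h2
    · rw [abelKernel_eq_zero (not_lt.1 hsη), mul_zero, ENNReal.ofReal_zero]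
      exact zero_le
  refine h1.trans ?_
  rw [lintegral_const_mul' _ _ ENNReal.ofReal_ne_top, ENNReal.ofReal_mul hC0,
    ← lintegral_beta h0]
  refine mul_le_mul' le_rfl ?_
  exact (setLIntegral_le_lintegral _ _).trans_eq (lintegral_indicator measurableSet_Ioo _)

theorem exists_bound_innerPart (d : OneInterval u₀ f x t u) : ∃ M, 0 ≤ M ∧ ∀ η ∈ Ioo (0 : ℝ) 1,
    |innerPart f x t u η| ≤ M := by
  obtain ⟨M, hM0, hM⟩ := d.exists_bound_lintegral_inner
  refine ⟨1 / 2 * M, by positivity, fun η hη => ?_⟩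
  rw [innerPart, abs_mul, abs_of_pos (by norm_num : (0 : ℝ) < 1 / 2)]
  gcongr
  have h1 := norm_integral_le_lintegral_norm (μ := volume.restrict (Ioo 0 u))
    (fun s => hodograph f x t s * abelKernel s η)
  rw [Real.norm_eq_abs] at h1
  refine h1.trans ?_
  simp only [norm_mul, Real.norm_eq_abs, abs_of_nonneg (abelKernel_nonneg _ _)]
  refine ENNReal.toReal_le_of_le_ofReal hM0 (hM η hη)

theorem aFun_eq_innerPart (d : OneInterval u₀ f x t u) {η : ℝ} (hη : η ∈ Ioo (0 : ℝ) 1)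
    (hηu : η ^ 2 ≤ u) : aFun u₀ f x t η = innerPart f x t u η := by
  rw [(d.init.aFun_eq x t hη).2, innerPart]
  congr 1
  refine (setIntegral_eq_of_subset_of_forall_sdiff_eq_zero measurableSet_Ioo
    (Ioo_subset_Ioo le_rfl hηu) fun s hs => ?_).symm
  have : η ^ 2 ≤ s := by
    by_contra hc
    exact hs.2 ⟨hs.1.1, not_le.1 hc⟩
  rw [abelKernel_eq_zero this, mul_zero]

/-- Outside the support the linear term exceeds its inner part, by the right variational
inequality. -/
theorem innerPart_le_aFun (d : OneInterval u₀ f x t u) {η : ℝ} (hη : η ∈ Ioo (0 : ℝ) 1) :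
    innerPart f x t u η ≤ aFun u₀ f x t η := by
  rcases le_or_gt (η ^ 2) u with hηu | hηu
  · exact (d.aFun_eq_innerPart hη hηu).ge
  have hη1 : η ^ 2 < 1 := by nlinarith [hη.1, hη.2]
  obtain ⟨hi, he⟩ := d.init.aFun_eq x t hη
  have hsub : Icc u (η ^ 2) ⊆ Ioo (0 : ℝ) 1 := Icc_subset_Ioo d.mem.1 hη1
  have hcont := (d.init.continuousOn_deriv_hodograph x t).mono hsub
  have h1 := integral_mul_inv_sqrt_of_deriv hηu.le hcont
    (fun s hs => d.init.hasDerivAt_hodograph x t (hsub hs)) d.hod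
  have h2 := d.right (η ^ 2) ⟨hηu, hη1⟩
  rw [integral_sqrt_mul_phi0 hηu.le hcont] at h2
  have h3 : ∫ s in Ioo 0 (η ^ 2), hodograph f x t s * abelKernel s η =
      (∫ s in Ioo 0 u, hodograph f x t s * abelKernel s η) +
        ∫ s in Ioo u (η ^ 2), hodograph f x t s * abelKernel s η := by
    rw [← integral_Ioc_eq_integral_Ioo (x := 0) (y := u), ← setIntegral_union]
    · rw [Ioc_union_Ioo_eq_Ioo d.mem.1.le hηu]
    · rw [Set.disjoint_left]
      exact fun s hs hs' => absurd hs.2 (not_le.2 hs'.1)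
    · exact measurableSet_Ioo
    · exact hi.mono_set (fun s hs => ⟨hs.1, hs.2.trans_lt hηu⟩)
    · exact hi.mono_set (Ioo_subset_Ioo d.mem.1.le le_rfl)
  have h4 : ∫ s in Ioo u (η ^ 2), hodograph f x t s * abelKernel s η =
      ∫ s in Ioo u (η ^ 2), hodograph f x t s * (√(η ^ 2 - s))⁻¹ := rfl
  rw [he, h3, h4, h1, innerPart]
  linarith

end OneInterval

/-! ### The functional -/

theorem functional_congr {u₀ f : ℝ → ℝ} {x t : ℝ} {φ χ : ℝ → ℝ}
    (h : ∀ᵐ η ∂(volume.restrict (Ioo (0 : ℝ) 1)), φ η = χ η) :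
    functional u₀ f x t φ = functional u₀ f x t χ := by
  have e1 : ∫⁻ η in Ioo (0 : ℝ) 1, ∫⁻ μ in Ioo (0 : ℝ) 1,
        ENNReal.ofReal (-Real.log |(η - μ) / (η + μ)| * φ η * φ μ) =
      ∫⁻ η in Ioo (0 : ℝ) 1, ∫⁻ μ in Ioo (0 : ℝ) 1,
        ENNReal.ofReal (-Real.log |(η - μ) / (η + μ)| * χ η * χ μ) := by
    refine lintegral_congr_ae ?_
    filter_upwards [h] with η hη
    refine lintegral_congr_ae ?_
    filter_upwards [h] with μ hμ
    rw [hη, hμ]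
  have e2 : ∫⁻ η in Ioo (0 : ℝ) 1, ENNReal.ofReal (aFun u₀ f x t η * φ η) =
      ∫⁻ η in Ioo (0 : ℝ) 1, ENNReal.ofReal (aFun u₀ f x t η * χ η) := by
    refine lintegral_congr_ae ?_
    filter_upwards [h] with η hη
    rw [hη]
  have e3 : ∫⁻ η in Ioo (0 : ℝ) 1, ENNReal.ofReal (-(aFun u₀ f x t η * φ η)) =
      ∫⁻ η in Ioo (0 : ℝ) 1, ENNReal.ofReal (-(aFun u₀ f x t η * χ η)) := by
    refine lintegral_congr_ae ?_
    filter_upwards [h] with η hη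
    rw [hη]
  rw [functional, functional, e1, e2, e3]

theorem Admissible.exists_measurable {φ : ℝ → ℝ} (h : Admissible φ) :
    ∃ χ : ℝ → ℝ, Measurable χ ∧ (∀ η, 0 ≤ χ η) ∧ IntegrableOn χ (Ioo 0 1) ∧
      ∀ᵐ η ∂(volume.restrict (Ioo (0 : ℝ) 1)), φ η = χ η := by
  obtain ⟨h0, hi⟩ := h
  set g := hi.aestronglyMeasurable.mk φ with hg
  have hgm : Measurable g := hi.aestronglyMeasurable.stronglyMeasurable_mk.measurable
  have hae : ∀ᵐ η ∂(volume.restrict (Ioo (0 : ℝ) 1)), φ η = max (g η) 0 := by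
    filter_upwards [h0, hi.aestronglyMeasurable.ae_eq_mk] with η h1 h2
    rw [hg, ← h2, max_eq_left h1]
  exact ⟨fun η => max (g η) 0, hgm.max measurable_const, fun η => le_max_right _ _,
    hi.congr hae, hae⟩

/-- The functional on densities of finite energy, as a real number. -/
theorem functional_eq_coe {u₀ f : ℝ → ℝ} {x t : ℝ} {χ : ℝ → ℝ} (hχ : Measurable χ)
    (h0 : ∀ η, 0 ≤ χ η) (hQ : ∫⁻ s in Ioo (0 : ℝ) 1, abelT χ s ^ 2 ≠ ⊤)
    (ha : IntegrableOn (fun η => aFun u₀ f x t η * χ η) (Ioo 0 1)) :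
    functional u₀ f x t χ = ((1 / (2 * Real.pi) *
      (∫⁻ s in Ioo (0 : ℝ) 1, abelT χ s ^ 2).toReal +
        ∫ η in Ioo (0 : ℝ) 1, aFun u₀ f x t η * χ η : ℝ) : EReal) := by
  have hA := ha.lintegral_lt_top.ne
  have hB := ha.neg.lintegral_lt_top.ne
  simp only [Pi.neg_apply] at hB
  have hQ' : ENNReal.ofReal (1 / (2 * Real.pi)) * ∫⁻ s in Ioo (0 : ℝ) 1, abelT χ s ^ 2 ≠ ⊤ :=
    ENNReal.mul_ne_top ENNReal.ofReal_ne_top hQ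
  rw [functional, lintegral_log_energy hχ h0, ← EReal.coe_ennreal_toReal hQ',
    ← EReal.coe_ennreal_toReal hA, ← EReal.coe_ennreal_toReal hB, ← EReal.coe_add,
    ← EReal.coe_sub, ENNReal.toReal_mul, ENNReal.toReal_ofReal (by positivity),
    integral_eq_lintegral_pos_part_sub_lintegral_neg_part ha]
  congr 1; ring

namespace OneInterval

variable {u₀ f : ℝ → ℝ} {x t u : ℝ}

theorem aestronglyMeasurable_aFun (h : InitialData u₀ f) (x t : ℝ) :
    AEStronglyMeasurable (aFun u₀ f x t) (volume.restrict (Ioo 0 1)) := by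
  have hH : AEStronglyMeasurable (hodograph f x t) (volume.restrict (Ioo 0 1)) :=
    (h.continuousOn_hodograph x t).aestronglyMeasurable measurableSet_Ioo
  have hK : Measurable fun p : ℝ × ℝ => abelKernel p.2 p.1 :=
    measurable_abelKernel.comp measurable_swap
  have hp : AEStronglyMeasurable (fun p : ℝ × ℝ => hodograph f x t p.2 * abelKernel p.2 p.1)
      ((volume.restrict (Ioo 0 1)).prod (volume.restrict (Ioo 0 1))) :=
    hH.comp_snd.mul hK.aestronglyMeasurable
  refine (hp.integral_prod_right'.const_mul (1 / 2)).congr ?_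
  refine (ae_restrict_iff' measurableSet_Ioo).2 (ae_of_all _ fun η hη => ?_)
  have h1 : η ^ 2 ≤ 1 := by nlinarith [hη.1, hη.2]
  have e : ∫ s in Ioo (0 : ℝ) 1, hodograph f x t s * abelKernel s η =
      ∫ s in Ioo 0 (η ^ 2), hodograph f x t s * abelKernel s η := by
    refine setIntegral_eq_of_subset_of_forall_sdiff_eq_zero measurableSet_Ioo
      (Ioo_subset_Ioo le_rfl h1) fun s hs => ?_
    have : η ^ 2 ≤ s := by
      by_contra hc
      exact hs.2 ⟨hs.1.1, not_le.1 hc⟩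
    rw [abelKernel_eq_zero this, mul_zero]
  rw [(h.aFun_eq x t hη).2, ← e]

theorem aestronglyMeasurable_innerPart (d : OneInterval u₀ f x t u) :
    AEStronglyMeasurable (innerPart f x t u) (volume.restrict (Ioo 0 1)) := by
  have hK : Measurable fun p : ℝ × ℝ => abelKernel p.2 p.1 :=
    measurable_abelKernel.comp measurable_swap
  have hp : AEStronglyMeasurable (fun p : ℝ × ℝ => hodograph f x t p.2 * abelKernel p.2 p.1)
      ((volume.restrict (Ioo 0 1)).prod (volume.restrict (Ioo 0 u))) :=
    d.aestronglyMeasurable_hodograph.comp_snd.mul hK.aestronglyMeasurable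
  exact hp.integral_prod_right'.const_mul (1 / 2)

theorem integrableOn_innerPart_mul (d : OneInterval u₀ f x t u) {χ : ℝ → ℝ}
    (hi : IntegrableOn χ (Ioo 0 1)) :
    IntegrableOn (fun η => innerPart f x t u η * χ η) (Ioo 0 1) := by
  obtain ⟨M, -, hM⟩ := d.exists_bound_innerPart
  refine Integrable.bdd_mul (c := M) hi d.aestronglyMeasurable_innerPart ?_
  exact (ae_restrict_iff' measurableSet_Ioo).2 (ae_of_all _ fun η hη => hM η hη)

/-- The inner part of the linear term, paired with a density, in terms of Abel transforms. -/
theorem integral_innerPart_mul (d : OneInterval u₀ f x t u) {χ : ℝ → ℝ} (hχ : Measurable χ)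
    (h0 : ∀ η, 0 ≤ χ η) (hi : IntegrableOn χ (Ioo 0 1)) :
    IntegrableOn (fun s => target f x t u s * (abelT χ s).toReal) (Ioo 0 1) ∧
    ∫ η in Ioo (0 : ℝ) 1, innerPart f x t u η * χ η =
      -(1 / Real.pi) * ∫ s in Ioo (0 : ℝ) 1, target f x t u s * (abelT χ s).toReal := by
  obtain ⟨M, hM0, hM⟩ := d.exists_bound_lintegral_inner
  have hK : Measurable fun p : ℝ × ℝ => abelKernel p.2 p.1 :=
    measurable_abelKernel.comp measurable_swap
  set F : ℝ × ℝ → ℝ := fun p => hodograph f x t p.2 * (χ p.1 * abelKernel p.2 p.1) with hF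
  have hFm : AEStronglyMeasurable F
      ((volume.restrict (Ioo 0 1)).prod (volume.restrict (Ioo 0 u))) :=
    d.aestronglyMeasurable_hodograph.comp_snd.mul
      ((hχ.comp measurable_fst).mul hK).aestronglyMeasurable
  have hFi : Integrable F ((volume.restrict (Ioo 0 1)).prod (volume.restrict (Ioo 0 u))) := by
    refine ⟨hFm, ?_⟩
    rw [hasFiniteIntegral_iff_norm, lintegral_prod _ hFm.norm.aemeasurable.ennreal_ofReal]
    have hb : ∫⁻ η in Ioo (0 : ℝ) 1, ∫⁻ s in Ioo 0 u, ENNReal.ofReal ‖F (η, s)‖ ≤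
        ∫⁻ η in Ioo (0 : ℝ) 1, ENNReal.ofReal (χ η) * ENNReal.ofReal M := by
      refine setLIntegral_mono' measurableSet_Ioo fun η hη => ?_
      have e : ∀ s, ENNReal.ofReal ‖F (η, s)‖ = ENNReal.ofReal (χ η) *
          ENNReal.ofReal (|hodograph f x t s| * abelKernel s η) := by
        intro s
        rw [← ENNReal.ofReal_mul (h0 η)]
        congr 1
        simp only [hF, Real.norm_eq_abs, abs_mul, abs_of_nonneg (h0 η),
          abs_of_nonneg (abelKernel_nonneg s η)]
        ring
      simp_rw [e]
      rw [lintegral_const_mul' _ _ ENNReal.ofReal_ne_top]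
      exact mul_le_mul' le_rfl (hM η hη)
    refine hb.trans_lt ?_
    rw [lintegral_mul_const' _ _ ENNReal.ofReal_ne_top]
    exact ENNReal.mul_lt_top hi.lintegral_lt_top ENNReal.ofReal_lt_top
  have e1 : ∀ s, ∫ η in Ioo (0 : ℝ) 1, F (η, s) = hodograph f x t s * (abelT χ s).toReal := by
    intro s
    simp only [hF]
    rw [integral_const_mul, abelT_toReal hχ h0]
  have e2 : ∀ η, ∫ s in Ioo 0 u, F (η, s) = 2 * (innerPart f x t u η * χ η) := by
    intro η
    have : ∀ s, F (η, s) = χ η * (hodograph f x t s * abelKernel s η) := fun s => by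
      simp only [hF]; ring
    simp_rw [this]
    rw [integral_const_mul, innerPart]; ring
  have hi1 : IntegrableOn (fun s => hodograph f x t s * (abelT χ s).toReal) (Ioo 0 u) :=
    hFi.integral_prod_right.congr (ae_of_all _ e1)
  have hfun : (fun s => target f x t u s * (abelT χ s).toReal) = (Ioo 0 u).indicator
      (fun s => -(Real.pi / 2) * (hodograph f x t s * (abelT χ s).toReal)) := by
    funext s
    unfold target
    by_cases hs : s ∈ Ioo 0 u
    · simp only [indicator_of_mem hs]; ring
    · simp only [indicator_of_notMem hs]; ring
  have hsw := integral_integral_swap (f := fun η s => F (η, s)) hFi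
  simp_rw [e1, e2] at hsw
  rw [integral_const_mul] at hsw
  constructor
  · rw [hfun]
    exact (IntegrableOn.integrable_indicator (Integrable.const_mul hi1 _)
      measurableSet_Ioo).integrableOn
  · rw [hfun, setIntegral_indicator measurableSet_Ioo,
      inter_eq_self_of_subset_right (Ioo_subset_Ioo le_rfl d.mem.2.le), integral_const_mul, ← hsw]
    have := Real.pi_pos.ne'
    field_simp

/-- Finiteness of the functional splits into finiteness of the energy and of the linear term. -/
theorem finite_of_functional_ne_top (d : OneInterval u₀ f x t u) {χ : ℝ → ℝ} (hχ : Measurable χ)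
    (h0 : ∀ η, 0 ≤ χ η) (hi : IntegrableOn χ (Ioo 0 1))
    (hfin : functional u₀ f x t χ ≠ ⊤) :
    ∫⁻ s in Ioo (0 : ℝ) 1, abelT χ s ^ 2 ≠ ⊤ ∧
      IntegrableOn (fun η => aFun u₀ f x t η * χ η) (Ioo 0 1) := by
  obtain ⟨M, hM0, hM⟩ := d.exists_bound_innerPart
  have hneg : ∫⁻ η in Ioo (0 : ℝ) 1, ENNReal.ofReal (-(aFun u₀ f x t η * χ η)) < ⊤ := by
    refine lt_of_le_of_lt (setLIntegral_mono' measurableSet_Ioo fun η hη => ?_)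
      (Integrable.const_mul hi M).lintegral_lt_top
    refine ENNReal.ofReal_le_ofReal ?_
    have h1 := d.innerPart_le_aFun hη
    have h2 := (abs_le.1 (hM η hη)).1
    nlinarith [h0 η]
  rw [functional, lintegral_log_energy hχ h0, ← EReal.coe_ennreal_toReal hneg.ne] at hfin
  have hA : ∫⁻ η in Ioo (0 : ℝ) 1, ENNReal.ofReal (aFun u₀ f x t η * χ η) ≠ ⊤ := by
    intro hc
    refine hfin ?_
    rw [hc, EReal.coe_ennreal_top, EReal.add_top_of_ne_bot (EReal.coe_ennreal_ne_bot _),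
      EReal.top_sub_coe]
  have hQ : ∫⁻ s in Ioo (0 : ℝ) 1, abelT χ s ^ 2 ≠ ⊤ := by
    intro hc
    refine hfin ?_
    rw [hc, ENNReal.mul_top (by simpa using Real.pi_pos), EReal.coe_ennreal_top,
      EReal.top_add_of_ne_bot (EReal.coe_ennreal_ne_bot _), EReal.top_sub_coe]
  refine ⟨hQ, (aestronglyMeasurable_aFun d.init x t).mul hχ.aestronglyMeasurable, ?_⟩
  rw [hasFiniteIntegral_iff_norm]
  have e : ∀ η, ENNReal.ofReal ‖aFun u₀ f x t η * χ η‖ =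
      ENNReal.ofReal (aFun u₀ f x t η * χ η) + ENNReal.ofReal (-(aFun u₀ f x t η * χ η)) := by
    intro η
    rcases le_total 0 (aFun u₀ f x t η * χ η) with hc | hc
    · rw [Real.norm_eq_abs, abs_of_nonneg hc, ENNReal.ofReal_of_nonpos (neg_nonpos.2 hc), add_zero]
    · rw [Real.norm_eq_abs, abs_of_nonpos hc, ENNReal.ofReal_of_nonpos hc, zero_add]
  simp_rw [e]
  rw [lintegral_add_left']
  · exact ENNReal.add_lt_top.2 ⟨hA.lt_top, hneg⟩
  · exact ((aestronglyMeasurable_aFun d.init x t).mul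
      hχ.aestronglyMeasurable).aemeasurable.ennreal_ofReal

theorem integrableOn_abelT_sq {χ : ℝ → ℝ} (hχ : Measurable χ)
    (hQ : ∫⁻ s in Ioo (0 : ℝ) 1, abelT χ s ^ 2 ≠ ⊤) :
    (∀ᵐ s ∂(volume.restrict (Ioo (0 : ℝ) 1)), abelT χ s ≠ ⊤) ∧
    IntegrableOn (fun s => (abelT χ s).toReal ^ 2) (Ioo 0 1) ∧
    ∫ s in Ioo (0 : ℝ) 1, (abelT χ s).toReal ^ 2 =
      (∫⁻ s in Ioo (0 : ℝ) 1, abelT χ s ^ 2).toReal := by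
  have hm := (measurable_abelT hχ).pow_const 2
  have hae := ae_lt_top hm hQ
  have hi := integrable_toReal_of_lintegral_ne_top hm.aemeasurable hQ
  have e := integral_toReal hm.aemeasurable hae
  simp only [ENNReal.toReal_pow] at hi e
  refine ⟨?_, hi, e⟩
  filter_upwards [hae] with s hs hc
  simp [hc] at hs

/-- The minimal value of the functional. -/
theorem functional_psi (d : OneInterval u₀ f x t u) :
    functional u₀ f x t (psi f x t u) =
      ((-(1 / (2 * Real.pi)) * ∫ s in Ioo (0 : ℝ) 1, target f x t u s ^ 2 : ℝ) : EReal) := by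
  have hT : ∀ s ∈ Ioo (0 : ℝ) 1, abelT (psi f x t u) s = ENNReal.ofReal (target f x t u s) :=
    fun s hs => d.abelT_psi hs.1
  have hQe : ∫⁻ s in Ioo (0 : ℝ) 1, abelT (psi f x t u) s ^ 2 =
      ∫⁻ s in Ioo (0 : ℝ) 1, ENNReal.ofReal (target f x t u s ^ 2) := by
    refine setLIntegral_congr_fun measurableSet_Ioo fun s hs => ?_
    simp only [hT s hs]
    rw [ENNReal.ofReal_pow (d.target_nonneg s)]
  have hQ : ∫⁻ s in Ioo (0 : ℝ) 1, abelT (psi f x t u) s ^ 2 ≠ ⊤ := by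
    rw [hQe]; exact d.integrable_target_sq.lintegral_lt_top.ne
  have haeq : ∀ η ∈ Ioo (0 : ℝ) 1, innerPart f x t u η * psi f x t u η =
      aFun u₀ f x t η * psi f x t u η := by
    intro η hη
    by_cases hη' : η ∈ Ioo 0 (√u)
    · rw [d.aFun_eq_innerPart hη ((Real.lt_sqrt hη.1.le).1 hη'.2).le]
    · rw [psi_eq_zero hη', mul_zero, mul_zero]
  have ha : IntegrableOn (fun η => aFun u₀ f x t η * psi f x t u η) (Ioo 0 1) :=
    (d.integrableOn_innerPart_mul d.integrableOn_psi).congr_fun haeq measurableSet_Ioo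
  rw [functional_eq_coe d.measurable_psi d.psi_nonneg hQ ha,
    ← setIntegral_congr_fun measurableSet_Ioo haeq,
    (d.integral_innerPart_mul d.measurable_psi d.psi_nonneg d.integrableOn_psi).2,
    ← (integrableOn_abelT_sq d.measurable_psi hQ).2.2]
  have e1 : ∫ s in Ioo (0 : ℝ) 1, (abelT (psi f x t u) s).toReal ^ 2 =
      ∫ s in Ioo (0 : ℝ) 1, target f x t u s ^ 2 := by
    refine setIntegral_congr_fun measurableSet_Ioo fun s hs => ?_
    simp only [hT s hs, ENNReal.toReal_ofReal (d.target_nonneg s)]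
  have e2 : ∫ s in Ioo (0 : ℝ) 1, target f x t u s * (abelT (psi f x t u) s).toReal =
      ∫ s in Ioo (0 : ℝ) 1, target f x t u s ^ 2 := by
    refine setIntegral_congr_fun measurableSet_Ioo fun s hs => ?_
    simp only [hT s hs, ENNReal.toReal_ofReal (d.target_nonneg s)]
    ring
  rw [e1, e2]
  congr 1
  have := Real.pi_pos.ne'
  field_simp
  ring

/-- Completing the square: the excess of the functional over its value at `ψ` is at least the
squared `L²` distance of the Abel transforms. -/
theorem functional_excess (d : OneInterval u₀ f x t u) {χ : ℝ → ℝ} (hχ : Measurable χ)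
    (h0 : ∀ η, 0 ≤ χ η) (hi : IntegrableOn χ (Ioo 0 1))
    (hfin : functional u₀ f x t χ ≠ ⊤) :
    IntegrableOn (fun s => ((abelT χ s).toReal - target f x t u s) ^ 2) (Ioo 0 1) ∧
    functional u₀ f x t (psi f x t u) + ((1 / (2 * Real.pi) *
      ∫ s in Ioo (0 : ℝ) 1, ((abelT χ s).toReal - target f x t u s) ^ 2 : ℝ) : EReal) ≤
      functional u₀ f x t χ := by
  obtain ⟨hQ, ha⟩ := d.finite_of_functional_ne_top hχ h0 hi hfin
  obtain ⟨-, hqi, hqe⟩ := integrableOn_abelT_sq hχ hQ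
  obtain ⟨hci, hce⟩ := d.integral_innerPart_mul hχ h0 hi
  have hpi := d.integrable_target_sq
  have hc2 := Integrable.const_mul hci 2
  have hfun : ∀ s, ((abelT χ s).toReal - target f x t u s) ^ 2 =
      ((abelT χ s).toReal ^ 2 - 2 * (target f x t u s * (abelT χ s).toReal)) +
        target f x t u s ^ 2 := fun s => by ring
  have h1 : IntegrableOn (fun s => (abelT χ s).toReal ^ 2 -
      2 * (target f x t u s * (abelT χ s).toReal)) (Ioo 0 1) := Integrable.sub hqi hc2
  have hsum : IntegrableOn (fun s => ((abelT χ s).toReal - target f x t u s) ^ 2) (Ioo 0 1) :=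
    (Integrable.add h1 hpi).congr (ae_of_all _ fun s => (hfun s).symm)
  refine ⟨hsum, ?_⟩
  have hlin : ∫ η in Ioo (0 : ℝ) 1, innerPart f x t u η * χ η ≤
      ∫ η in Ioo (0 : ℝ) 1, aFun u₀ f x t η * χ η :=
    setIntegral_mono_on (d.integrableOn_innerPart_mul hi) ha measurableSet_Ioo fun η hη =>
      mul_le_mul_of_nonneg_right (d.innerPart_le_aFun hη) (h0 η)
  rw [d.functional_psi, functional_eq_coe hχ h0 hQ ha, ← EReal.coe_add, EReal.coe_le_coe_iff]
  simp_rw [hfun]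
  rw [integral_add h1 hpi, integral_sub hqi hc2, integral_const_mul, ← hqe]
  rw [hce] at hlin
  have hp := Real.pi_pos.ne'
  have e : 1 / (2 * Real.pi) * (2 * ∫ s in Ioo (0 : ℝ) 1, target f x t u s * (abelT χ s).toReal) =
      1 / Real.pi * ∫ s in Ioo (0 : ℝ) 1, target f x t u s * (abelT χ s).toReal := by
    field_simp
  linarith

theorem isMinimizer_psi (d : OneInterval u₀ f x t u) :
    IsMinimizer u₀ f x t (psi f x t u) := by
  refine ⟨d.admissible_psi, fun φ hφ => ?_⟩
  obtain ⟨χ, hχ, h0, hi, hae⟩ := hφ.exists_measurable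
  rw [functional_congr hae]
  by_cases hfin : functional u₀ f x t χ = ⊤
  · rw [hfin]; exact le_top
  obtain ⟨-, hle⟩ := d.functional_excess hχ h0 hi hfin
  refine le_trans ?_ hle
  have : (0 : ℝ) ≤ 1 / (2 * Real.pi) *
      ∫ s in Ioo (0 : ℝ) 1, ((abelT χ s).toReal - target f x t u s) ^ 2 :=
    mul_nonneg (by positivity) (integral_nonneg fun s => sq_nonneg _)
  rw [d.functional_psi, ← EReal.coe_add, EReal.coe_le_coe_iff]
  linarith

theorem eq_psi_of_isMinimizer (d : OneInterval u₀ f x t u) {φ : ℝ → ℝ}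
    (hφ : IsMinimizer u₀ f x t φ) :
    ∀ᵐ η ∂(volume.restrict (Ioo (0 : ℝ) 1)), φ η = psi f x t u η := by
  obtain ⟨χ, hχ, h0, hi, hae⟩ := hφ.1.exists_measurable
  have hle := hφ.2 _ d.admissible_psi
  rw [functional_congr hae] at hle
  have hfin : functional u₀ f x t χ ≠ ⊤ := by
    intro hc
    rw [hc, d.functional_psi] at hle
    exact absurd hle (not_le.2 (EReal.coe_lt_top _))
  obtain ⟨hint, hex⟩ := d.functional_excess hχ h0 hi hfin
  obtain ⟨htop, -, -⟩ :=
    integrableOn_abelT_sq hχ (d.finite_of_functional_ne_top hχ h0 hi hfin).1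
  have h1 := hex.trans hle
  rw [d.functional_psi, ← EReal.coe_add, EReal.coe_le_coe_iff] at h1
  have h2 : 1 / (2 * Real.pi) *
      ∫ s in Ioo (0 : ℝ) 1, ((abelT χ s).toReal - target f x t u s) ^ 2 ≤ 0 := by linarith
  have h3 : 0 ≤ ∫ s in Ioo (0 : ℝ) 1, ((abelT χ s).toReal - target f x t u s) ^ 2 :=
    integral_nonneg fun s => sq_nonneg _
  have h4 : ∫ s in Ioo (0 : ℝ) 1, ((abelT χ s).toReal - target f x t u s) ^ 2 = 0 := by
    have : 0 < 1 / (2 * Real.pi) := by positivity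
    nlinarith
  have h5 := (integral_eq_zero_iff_of_nonneg (fun s => sq_nonneg _) hint).1 h4
  have h6 : ∀ᵐ s ∂(volume.restrict (Ioo (0 : ℝ) 1)), abelT χ s = abelT (psi f x t u) s := by
    filter_upwards [h5, htop, ae_restrict_mem measurableSet_Ioo] with s hs hs' hs''
    rw [d.abelT_psi hs''.1, ← ENNReal.ofReal_toReal hs']
    congr 1
    have := pow_eq_zero_iff (two_ne_zero) |>.1 hs
    linarith
  filter_upwards [hae, ae_eq_of_abelT_ae_eq hχ h0 d.measurable_psi d.psi_nonneg hi
    d.integrableOn_psi h6] with η hη hη'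
  rw [hη, hη']

end OneInterval

/-! ### Convexity of `Φ₀` in its first variable -/

theorem continuousOn_convex_arg {h : ℝ → ℝ} (hh : ContinuousOn h (Ioo 0 1)) {ξ u : ℝ}
    (hξ : ξ ∈ Ioo (0 : ℝ) 1) (hu : u ∈ Ioo (0 : ℝ) 1) :
    ContinuousOn (fun r : ℝ => h ((1 - r ^ 2) * ξ + r ^ 2 * u)) (Icc 0 1) :=
  hh.comp (by fun_prop) fun _ hr => convex_arg_mem hξ hu hr

/-- Differentiation under the integral sign in the first variable of a weighted average. -/
theorem hasDerivAt_weighted {w h h' : ℝ → ℝ} (hw : Continuous w)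
    (hd : ∀ s ∈ Ioo (0 : ℝ) 1, HasDerivAt h (h' s) s) (hc : ContinuousOn h' (Ioo 0 1))
    {ξ u : ℝ} (hξ : ξ ∈ Ioo (0 : ℝ) 1) (hu : u ∈ Ioo (0 : ℝ) 1) :
    HasDerivAt (fun ξ => ∫ r in (0 : ℝ)..1, w r * h ((1 - r ^ 2) * ξ + r ^ 2 * u))
      (∫ r in (0 : ℝ)..1, w r * (1 - r ^ 2) * h' ((1 - r ^ 2) * ξ + r ^ 2 * u)) ξ := by
  obtain ⟨p, q, hp, hpq, hq, n1, n2⟩ := exists_Icc_mem_nhds hξ hu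
  have hsub : Icc p q ⊆ Ioo (0 : ℝ) 1 := Icc_subset_Ioo hp hq
  have hhc : ContinuousOn h (Ioo 0 1) := fun s hs => (hd s hs).continuousAt.continuousWithinAt
  obtain ⟨C, hC⟩ := isCompact_Icc.exists_bound_of_continuousOn (hc.mono hsub)
  have hFc : ∀ y ∈ Icc p q, ContinuousOn
      (fun r : ℝ => w r * h ((1 - r ^ 2) * y + r ^ 2 * u)) (Icc 0 1) := fun y hy =>
    hw.continuousOn.mul (continuousOn_convex_arg hhc (hsub hy) hu)
  have hFc' : ContinuousOn
      (fun r : ℝ => w r * (1 - r ^ 2) * h' ((1 - r ^ 2) * ξ + r ^ 2 * u)) (Icc 0 1) :=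
    ContinuousOn.mul (by fun_prop) (continuousOn_convex_arg hc hξ hu)
  have huI : uIoc (0 : ℝ) 1 ⊆ Icc 0 1 := by
    rw [uIoc_of_le zero_le_one]; exact Ioc_subset_Icc_self
  refine (intervalIntegral.hasDerivAt_integral_of_dominated_loc_of_deriv_le
    (F := fun ξ r => w r * h ((1 - r ^ 2) * ξ + r ^ 2 * u))
    (F' := fun ξ r => w r * (1 - r ^ 2) * h' ((1 - r ^ 2) * ξ + r ^ 2 * u))
    (bound := fun r => |w r * (1 - r ^ 2)| * C) n1 ?_ ?_ ?_ ?_ ?_ ?_).2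
  · filter_upwards [n1] with y hy
    exact ((hFc y hy).mono huI).aestronglyMeasurable measurableSet_uIoc
  · refine ContinuousOn.intervalIntegrable ?_
    rw [uIcc_of_le zero_le_one]
    exact hFc ξ (mem_of_mem_nhds n1)
  · exact (hFc'.mono huI).aestronglyMeasurable measurableSet_uIoc
  · refine ae_of_all _ fun r hr y hy => ?_
    rw [norm_mul, Real.norm_eq_abs]
    gcongr
    exact hC _ (convex_arg_mem_Icc hy (mem_of_mem_nhds n2) (huI hr))
  · exact (Continuous.mul (by fun_prop) continuous_const).intervalIntegrable _ _
  · refine ae_of_all _ fun r hr y hy => ?_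
    have hmem := convex_arg_mem (hsub hy) hu (huI hr)
    have h1 : HasDerivAt (fun y : ℝ => (1 - r ^ 2) * y + r ^ 2 * u) (1 - r ^ 2) y := by
      simpa using ((hasDerivAt_id y).const_mul (1 - r ^ 2)).add_const (r ^ 2 * u)
    refine ((HasDerivAt.comp (h := fun y : ℝ => (1 - r ^ 2) * y + r ^ 2 * u) y (hd _ hmem)
      h1).const_mul (w r)).congr_deriv ?_
    ring

theorem hasDerivAt_sqMean {h h' : ℝ → ℝ}
    (hd : ∀ s ∈ Ioo (0 : ℝ) 1, HasDerivAt h (h' s) s) (hc : ContinuousOn h' (Ioo 0 1))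
    {ξ u : ℝ} (hξ : ξ ∈ Ioo (0 : ℝ) 1) (hu : u ∈ Ioo (0 : ℝ) 1) :
    HasDerivAt (fun ξ => sqMean h ξ u)
      (∫ r in (0 : ℝ)..1, (1 - r ^ 2) * h' ((1 - r ^ 2) * ξ + r ^ 2 * u)) ξ := by
  have := hasDerivAt_weighted (w := fun _ => 1) continuous_const hd hc hξ hu
  simpa only [one_mul, sqMean] using this

/-- Strict convexity of the average in its first variable, from the sign of its second derivative
under the integral. -/
theorem strictConvexOn_sqMean {h h' h'' : ℝ → ℝ}
    (hd : ∀ s ∈ Ioo (0 : ℝ) 1, HasDerivAt h (h' s) s)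
    (hd' : ∀ s ∈ Ioo (0 : ℝ) 1, HasDerivAt h' (h'' s) s) (hc : ContinuousOn h'' (Ioo 0 1))
    {S : Set ℝ} (hS : Convex ℝ S) (hS1 : S ⊆ Ioo 0 1) {u : ℝ} (hu : u ∈ Ioo (0 : ℝ) 1)
    (hpos : ∀ ξ ∈ interior S,
      0 < ∫ r in (0 : ℝ)..1, (1 - r ^ 2) * (1 - r ^ 2) * h'' ((1 - r ^ 2) * ξ + r ^ 2 * u)) :
    StrictConvexOn ℝ S (fun ξ => sqMean h ξ u) := by
  have hc' : ContinuousOn h' (Ioo 0 1) := fun s hs => (hd' s hs).continuousAt.continuousWithinAt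
  refine strictConvexOn_of_deriv2_pos hS
    (fun ξ hξ => (hasDerivAt_sqMean hd hc' (hS1 hξ) hu).continuousAt.continuousWithinAt)
    fun ξ hξ => ?_
  have hξ1 := hS1 (interior_subset hξ)
  have e : deriv (fun ξ => sqMean h ξ u) =ᶠ[𝓝 ξ]
      fun ξ => ∫ r in (0 : ℝ)..1, (1 - r ^ 2) * h' ((1 - r ^ 2) * ξ + r ^ 2 * u) := by
    filter_upwards [isOpen_Ioo.mem_nhds hξ1] with y hy
    exact (hasDerivAt_sqMean hd hc' hy hu).deriv
  have h2 := hasDerivAt_weighted (w := fun r => 1 - r ^ 2) (by fun_prop) hd' hc hξ1 hu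
  simp only [Function.iterate_succ, Function.iterate_zero, Function.comp, id]
  rw [e.deriv_eq, h2.deriv]
  exact hpos ξ hξ

theorem neg_of_strictConvexOn {S : Set ℝ} {g : ℝ → ℝ} (hg : StrictConvexOn ℝ S g)
    {x y z : ℝ} (hx : x ∈ S) (hz : z ∈ S) (hxy : x < y) (hyz : y < z) (gx : g x ≤ 0)
    (gz : g z ≤ 0) : g y < 0 := by
  have hy : y ∈ openSegment ℝ x z := by
    rw [openSegment_eq_Ioo (hxy.trans hyz)]; exact ⟨hxy, hyz⟩
  obtain ⟨a, b, ha, hb, hab, rfl⟩ := hy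
  have := hg.2 hx hz (hxy.trans hyz).ne ha hb hab
  simp only [smul_eq_mul] at this ⊢
  nlinarith

/-- Three times differentiable functions on `(0,1)` with the boundary behaviour of `f` that the
convexity argument uses. The class is stable under `f ↦ -f(1 - ·)`. -/
structure Profile (f f₁ f₂ f₃ : ℝ → ℝ) : Prop where
  d₁ : ∀ s ∈ Ioo (0 : ℝ) 1, HasDerivAt f (f₁ s) s
  d₂ : ∀ s ∈ Ioo (0 : ℝ) 1, HasDerivAt f₁ (f₂ s) s
  d₃ : ∀ s ∈ Ioo (0 : ℝ) 1, HasDerivAt f₂ (f₃ s) s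
  cont : ContinuousOn f₃ (Ioo 0 1)
  zero : Tendsto f (𝓝[>] 0) atTop
  one : Tendsto f (𝓝[<] 1) atBot
  third_zero : ∀ᶠ u in 𝓝[>] (0 : ℝ), f₃ u < 0
  third_one : ∀ᶠ u in 𝓝[<] (1 : ℝ), f₃ u < 0

theorem tendsto_one_sub_nhdsGT_zero :
    Tendsto (fun s : ℝ => 1 - s) (𝓝[>] 0) (𝓝[<] 1) := by
  refine tendsto_nhdsWithin_iff.2 ⟨?_, ?_⟩
  · have : Tendsto (fun s : ℝ => 1 - s) (𝓝 0) (𝓝 (1 - 0)) := by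
      exact (continuous_const.sub continuous_id).tendsto 0
    rw [sub_zero] at this
    exact this.mono_left nhdsWithin_le_nhds
  · filter_upwards [self_mem_nhdsWithin] with s hs
    simpa using hs

theorem tendsto_one_sub_nhdsLT_one :
    Tendsto (fun s : ℝ => 1 - s) (𝓝[<] 1) (𝓝[>] 0) := by
  refine tendsto_nhdsWithin_iff.2 ⟨?_, ?_⟩
  · have : Tendsto (fun s : ℝ => 1 - s) (𝓝 1) (𝓝 (1 - 1)) := by
      exact (continuous_const.sub continuous_id).tendsto 1
    rw [sub_self] at this
    exact this.mono_left nhdsWithin_le_nhds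
  · filter_upwards [self_mem_nhdsWithin] with s hs
    simpa using hs

namespace Profile

variable {f f₁ f₂ f₃ : ℝ → ℝ}

theorem reflect (p : Profile f f₁ f₂ f₃) :
    Profile (fun s => -f (1 - s)) (fun s => f₁ (1 - s)) (fun s => -f₂ (1 - s))
      (fun s => f₃ (1 - s)) := by
  have hm : ∀ s ∈ Ioo (0 : ℝ) 1, 1 - s ∈ Ioo (0 : ℝ) 1 := fun s hs =>
    ⟨by linarith [hs.2], by linarith [hs.1]⟩
  have hd : ∀ {g g' : ℝ → ℝ}, (∀ s ∈ Ioo (0 : ℝ) 1, HasDerivAt g (g' s) s) →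
      ∀ s ∈ Ioo (0 : ℝ) 1, HasDerivAt (fun s => g (1 - s)) (-g' (1 - s)) s := by
    intro g g' hg s hs
    have h1 : HasDerivAt (fun s : ℝ => 1 - s) (-1) s := by
      simpa using (hasDerivAt_id s).const_sub 1
    refine (HasDerivAt.comp (h := fun s : ℝ => 1 - s) s (hg _ (hm s hs)) h1).congr_deriv ?_
    ring
  refine ⟨fun s hs => ?_, fun s hs => hd p.d₂ s hs, fun s hs => ?_, ?_, ?_, ?_, ?_, ?_⟩
  · exact (hd p.d₁ s hs).neg.congr_deriv (neg_neg _)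
  · exact (hd p.d₃ s hs).neg.congr_deriv (neg_neg _)
  · exact p.cont.comp (by fun_prop) hm
  · exact tendsto_neg_atBot_atTop.comp (p.one.comp tendsto_one_sub_nhdsGT_zero)
  · exact tendsto_neg_atTop_atBot.comp (p.zero.comp tendsto_one_sub_nhdsLT_one)
  · exact tendsto_one_sub_nhdsGT_zero.eventually p.third_one
  · exact tendsto_one_sub_nhdsLT_one.eventually p.third_zero

/-- A common neighbourhood of the two end points on which `f''' < 0`. -/
theorem exists_third_neg (p : Profile f f₁ f₂ f₃) :
    ∃ ε > 0, ε < 1 / 2 ∧ (∀ s ∈ Ioc 0 ε, f₃ s < 0) ∧ ∀ s ∈ Ico (1 - ε) 1, f₃ s < 0 := by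
  obtain ⟨c, hc, hc'⟩ := mem_nhdsGT_iff_exists_Ioo_subset.1 p.third_zero
  obtain ⟨e, he, he'⟩ := mem_nhdsLT_iff_exists_Ioo_subset.1 p.third_one
  have hc0 : (0 : ℝ) < c := hc
  have he1 : e < (1 : ℝ) := he
  have h1 : 0 < min (min c (1 - e)) (1 / 2) := by
    refine lt_min (lt_min hc0 (by linarith)) (by norm_num)
  have h2 : min (min c (1 - e)) (1 / 2) ≤ c := (min_le_left _ _).trans (min_le_left _ _)
  have h3 : min (min c (1 - e)) (1 / 2) ≤ 1 - e := (min_le_left _ _).trans (min_le_right _ _)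
  have h4 : min (min c (1 - e)) (1 / 2) ≤ 1 / 2 := min_le_right _ _
  refine ⟨min (min c (1 - e)) (1 / 2) / 2, by linarith, by linarith, fun s hs => ?_, fun s hs => ?_⟩
  · exact hc' ⟨hs.1, by linarith [hs.2]⟩
  · exact he' ⟨by linarith [hs.1], hs.2⟩

/-- For `u` near `0` the second `ξ`-derivative of `Φ₀(·,u)` is positive on `(u,1)`: the
contribution of the neighbourhood of `0`, where `f''' < 0`, integrates to at least
`f(u) - const`, which dominates that of the middle region. -/
theorem second_deriv_pos_left (p : Profile f f₁ f₂ f₃) :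
    ∃ δ > 0, ∀ u ∈ Ioo 0 δ, ∀ ξ ∈ Ioo u 1,
      0 < ∫ r in (0 : ℝ)..1, (1 - r ^ 2) * (1 - r ^ 2) * -f₃ ((1 - r ^ 2) * ξ + r ^ 2 * u) := by
  obtain ⟨ε, hε, hε2, hl, hr⟩ := p.exists_third_neg
  have hε1 : ε ∈ Ioo (0 : ℝ) 1 := ⟨hε, by linarith⟩
  obtain ⟨M, hM⟩ := isCompact_Icc.exists_bound_of_continuousOn
    (p.cont.mono (Icc_subset_Ioo hε (by linarith : 1 - ε < 1)))
  have hM0 : 0 ≤ M := (norm_nonneg _).trans (hM ε ⟨le_rfl, by linarith⟩)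
  have hlow : ∀ s ∈ Ioo (0 : ℝ) 1, -M ≤ -f₃ s := by
    intro s hs
    by_cases h1 : s ≤ ε
    · linarith [hl s ⟨hs.1, h1⟩]
    by_cases h2 : 1 - ε ≤ s
    · linarith [hr s ⟨h2, hs.2⟩]
    · have := (abs_le.1 (hM s ⟨(not_le.1 h1).le, (not_le.1 h2).le⟩)).2
      linarith
  set L := |f₂ ε| + 2 * |f₁ ε| + 2 * |f ε| with hL
  obtain ⟨c, hc, hc'⟩ := mem_nhdsGT_iff_exists_Ioo_subset.1
    (p.zero.eventually_gt_atTop ((L + 2 * M) / 2))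
  have hc0 : (0 : ℝ) < c := hc
  refine ⟨min c ε, lt_min hc0 hε, fun u hu ξ hξ => ?_⟩
  have huε : u < ε := hu.2.trans_le (min_le_right _ _)
  have hfu : (L + 2 * M) / 2 < f u := hc' ⟨hu.1, hu.2.trans_le (min_le_left _ _)⟩
  have hu1 : u ∈ Ioo (0 : ℝ) 1 := ⟨hu.1, huε.trans hε1.2⟩
  have hξ1 : ξ ∈ Ioo (0 : ℝ) 1 := ⟨hu.1.trans hξ.1, hξ.2⟩
  have hcont : ContinuousOn (fun r : ℝ =>
      (1 - r ^ 2) * (1 - r ^ 2) * -f₃ ((1 - r ^ 2) * ξ + r ^ 2 * u)) (Icc 0 1) :=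
    ContinuousOn.mul (by fun_prop) (continuousOn_convex_arg p.cont hξ1 hu1).neg
  have hii : ∀ {y z : ℝ}, 0 ≤ y → y ≤ z → z ≤ 1 → IntervalIntegrable (fun r : ℝ =>
      (1 - r ^ 2) * (1 - r ^ 2) * -f₃ ((1 - r ^ 2) * ξ + r ^ 2 * u)) volume y z := by
    intro y z hy hyz hz
    refine ContinuousOn.intervalIntegrable ?_
    rw [uIcc_of_le hyz]
    exact hcont.mono (Icc_subset_Icc hy hz)
  rcases le_or_gt ξ ε with hξε | hξε
  · refine intervalIntegral.intervalIntegral_pos_of_pos_on (hii le_rfl zero_le_one le_rfl)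
      (fun r hr' => ?_) zero_lt_one
    have h1 : 0 < 1 - r ^ 2 := by nlinarith [hr'.1, hr'.2]
    have h2 := convex_arg_mem_Icc (p := u) (q := ξ) (ξ := ξ) (u := u) ⟨hξ.1.le, le_rfl⟩
      ⟨le_rfl, hξ.1.le⟩ ⟨hr'.1.le, hr'.2.le⟩
    have h3 := hl _ ⟨hu.1.trans_le h2.1, h2.2.trans hξε⟩
    have h4 : 0 < -f₃ ((1 - r ^ 2) * ξ + r ^ 2 * u) := by linarith
    positivity
  · set D := ξ - u with hD
    have hD0 : 0 < D := sub_pos.2 hξ.1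
    have hD1 : D < 1 := by linarith [hξ.2, hu.1]
    -- the point where the argument passes `ε`
    set ρ := √((ξ - ε) / D) with hρ
    have hρ0 : 0 < ρ := Real.sqrt_pos.2 (div_pos (by linarith) hD0)
    have hρsq : ρ ^ 2 = (ξ - ε) / D := Real.sq_sqrt (div_nonneg (by linarith) hD0.le)
    have hρD : ρ ^ 2 * D = ξ - ε := by rw [hρsq]; field_simp
    have hρ1 : ρ < 1 := by
      have : ρ ^ 2 < 1 := by rw [hρsq, div_lt_one hD0]; linarith
      nlinarith
    have harg : ∀ r : ℝ, (1 - r ^ 2) * ξ + r ^ 2 * u = ξ - r ^ 2 * D := fun r => by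
      rw [hD]; ring
    rw [← intervalIntegral.integral_add_adjacent_intervals (hii le_rfl hρ0.le hρ1.le)
      (hii hρ0.le hρ1.le le_rfl)]
    have part1 : -M ≤ ∫ r in (0 : ℝ)..ρ,
        (1 - r ^ 2) * (1 - r ^ 2) * -f₃ ((1 - r ^ 2) * ξ + r ^ 2 * u) := by
      have h1 : ∫ r in (0 : ℝ)..ρ, -M ≤ ∫ r in (0 : ℝ)..ρ,
          (1 - r ^ 2) * (1 - r ^ 2) * -f₃ ((1 - r ^ 2) * ξ + r ^ 2 * u) := by
        refine intervalIntegral.integral_mono_on hρ0.le (by simp) (hii le_rfl hρ0.le hρ1.le)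
          fun r hr' => ?_
        have h2 := hlow _ (convex_arg_mem hξ1 hu1 ⟨hr'.1, hr'.2.trans hρ1.le⟩)
        have h3 : 0 ≤ 1 - r ^ 2 := by nlinarith [hr'.1, hr'.2]
        have h4 : 1 - r ^ 2 ≤ 1 := by nlinarith [sq_nonneg r]
        have h5 : (1 - r ^ 2) * (1 - r ^ 2) ≤ 1 := by nlinarith
        nlinarith [mul_nonneg h3 h3]
      rw [intervalIntegral.integral_const, smul_eq_mul, sub_zero] at h1
      nlinarith
    -- an antiderivative of `(s - u)² f₃ s`, into which `r (1 - r²)² f₃` turns in the variable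
    -- `s = (1 - r²) ξ + r² u`
    set A : ℝ → ℝ := fun s => (s - u) ^ 2 * f₂ s - 2 * (s - u) * f₁ s + 2 * f s with hA
    have hdA : ∀ s ∈ Ioo (0 : ℝ) 1, HasDerivAt A ((s - u) ^ 2 * f₃ s) s := by
      intro s hs
      have e1 := (((hasDerivAt_id s).sub_const u).pow 2).mul (p.d₃ s hs)
      have e2 := (((hasDerivAt_id s).sub_const u).const_mul 2).mul (p.d₂ s hs)
      refine ((e1.sub e2).add ((p.d₁ s hs).const_mul 2)).congr_deriv ?_
      simp
      ring
    have part2 : (2 * f u - A ε) / (2 * D ^ 3) ≤ ∫ r in ρ..1,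
        (1 - r ^ 2) * (1 - r ^ 2) * -f₃ ((1 - r ^ 2) * ξ + r ^ 2 * u) := by
      have hci : ContinuousOn (fun r : ℝ =>
          r * ((1 - r ^ 2) * (1 - r ^ 2) * -f₃ ((1 - r ^ 2) * ξ + r ^ 2 * u))) (uIcc ρ 1) := by
        rw [uIcc_of_le hρ1.le]
        exact continuousOn_id.mul (hcont.mono (Icc_subset_Icc hρ0.le le_rfl))
      have h1 : ∫ r in ρ..1,
          r * ((1 - r ^ 2) * (1 - r ^ 2) * -f₃ ((1 - r ^ 2) * ξ + r ^ 2 * u)) =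
          (2 * f u - A ε) / (2 * D ^ 3) := by
        rw [intervalIntegral.integral_eq_sub_of_hasDerivAt
          (f := fun r => A ((1 - r ^ 2) * ξ + r ^ 2 * u) / (2 * D ^ 3))]
        · have e1 : (1 - (1 : ℝ) ^ 2) * ξ + 1 ^ 2 * u = u := by ring
          have e2 : (1 - ρ ^ 2) * ξ + ρ ^ 2 * u = ε := by rw [harg, hρD]; ring
          rw [e1, e2, ← sub_div]
          congr 1
          simp only [hA]; ring
        · intro r hr'
          rw [uIcc_of_le hρ1.le] at hr'
          have hmem := convex_arg_mem hξ1 hu1 ⟨hρ0.le.trans hr'.1, hr'.2⟩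
          have h2 : HasDerivAt (fun r : ℝ => (1 - r ^ 2) * ξ + r ^ 2 * u) (-2 * r * D) r := by
            have := (((hasDerivAt_pow 2 r).const_sub 1).mul_const ξ).add
              ((hasDerivAt_pow 2 r).mul_const u)
            refine this.congr_deriv ?_
            rw [hD]; norm_num; ring
          refine ((HasDerivAt.comp (h := fun r : ℝ => (1 - r ^ 2) * ξ + r ^ 2 * u) r
            (hdA _ hmem) h2).div_const (2 * D ^ 3)).congr_deriv ?_
          have e3 : (1 - r ^ 2) * ξ + r ^ 2 * u - u = (1 - r ^ 2) * D := by rw [hD]; ring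
          rw [e3]
          field_simp
        · exact hci.intervalIntegrable
      rw [← h1]
      refine intervalIntegral.integral_mono_on hρ1.le hci.intervalIntegrable
        (hii hρ0.le hρ1.le le_rfl) fun r hr' => ?_
      have h2 := convex_arg_mem hξ1 hu1 ⟨hρ0.le.trans hr'.1, hr'.2⟩
      have h3 : (1 - r ^ 2) * ξ + r ^ 2 * u ≤ ε := by
        rw [harg]
        have : ρ ^ 2 ≤ r ^ 2 := by nlinarith [hr'.1]
        nlinarith
      have h4 := hl _ ⟨h2.1, h3⟩
      have h5 : 0 ≤ (1 - r ^ 2) * (1 - r ^ 2) * -f₃ ((1 - r ^ 2) * ξ + r ^ 2 * u) :=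
        mul_nonneg (mul_self_nonneg _) (by linarith)
      nlinarith [hr'.2]
    have hAε : A ε ≤ L := by
      have b0 : 0 ≤ ε - u := by linarith
      have b1 : ε - u ≤ 1 := by linarith [hu.1]
      have t1 : (ε - u) ^ 2 * f₂ ε ≤ |f₂ ε| := by
        have := le_abs_self (f₂ ε)
        have : (ε - u) ^ 2 ≤ 1 := by nlinarith
        calc (ε - u) ^ 2 * f₂ ε ≤ (ε - u) ^ 2 * |f₂ ε| := by gcongr
          _ ≤ 1 * |f₂ ε| := by gcongr
          _ = |f₂ ε| := one_mul _
      have t2 : -(2 * (ε - u) * f₁ ε) ≤ 2 * |f₁ ε| := by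
        have := neg_abs_le (f₁ ε)
        have h0 := abs_nonneg (f₁ ε)
        nlinarith
      have t3 := le_abs_self (f ε)
      simp only [hA, hL]
      linarith
    have h6 : (2 * f u - A ε) / 2 ≤ (2 * f u - A ε) / (2 * D ^ 3) := by
      have hpos : 0 ≤ 2 * f u - A ε := by linarith
      have hD3 : D ^ 3 ≤ 1 := pow_le_one₀ hD0.le hD1.le
      exact div_le_div_of_nonneg_left hpos (by positivity) (by linarith)
    linarith

theorem second_deriv_pos_right (p : Profile f f₁ f₂ f₃) :
    ∃ δ > 0, ∀ u ∈ Ioo (1 - δ) 1, ∀ ξ ∈ Ioo 0 u,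
      0 < ∫ r in (0 : ℝ)..1, (1 - r ^ 2) * (1 - r ^ 2) * -f₃ ((1 - r ^ 2) * ξ + r ^ 2 * u) := by
  obtain ⟨δ, hδ, H⟩ := p.reflect.second_deriv_pos_left
  refine ⟨δ, hδ, fun u hu ξ hξ => ?_⟩
  have := H (1 - u) ⟨by linarith [hu.2], by linarith [hu.1]⟩ (1 - ξ)
    ⟨by linarith [hξ.2], by linarith [hξ.1]⟩
  have e : ∀ r : ℝ, 1 - ((1 - r ^ 2) * (1 - ξ) + r ^ 2 * (1 - u)) =
      (1 - r ^ 2) * ξ + r ^ 2 * u := fun r => by ring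
  simpa only [e] using this

end Profile

theorem InitialData.profile {u₀ f : ℝ → ℝ} (h : InitialData u₀ f) :
    Profile f (deriv f) (deriv (deriv f)) (iteratedDeriv 3 f) := by
  have c1 : ContDiffOn ℝ 2 (deriv f) (Ioo 0 1) := h.smooth.deriv_of_isOpen isOpen_Ioo (by norm_num)
  have c2 : ContDiffOn ℝ 1 (deriv (deriv f)) (Ioo 0 1) :=
    c1.deriv_of_isOpen isOpen_Ioo (by norm_num)
  have c3 : ContDiffOn ℝ 0 (deriv (deriv (deriv f))) (Ioo 0 1) :=
    c2.deriv_of_isOpen isOpen_Ioo (by norm_num)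
  have e : iteratedDeriv 3 f = deriv (deriv (deriv f)) := by
    simp [iteratedDeriv_succ, iteratedDeriv_zero]
  refine ⟨fun s hs => h.hasDerivAt_f hs, fun s hs => ?_, fun s hs => ?_, ?_, h.f_zero, h.f_one,
    h.third_zero, h.third_one⟩
  · exact ((c1.differentiableOn (by norm_num)).differentiableAt
      (isOpen_Ioo.mem_nhds hs)).hasDerivAt
  · rw [e]
    exact ((c2.differentiableOn (by norm_num)).differentiableAt
      (isOpen_Ioo.mem_nhds hs)).hasDerivAt
  · rw [e]; exact c3.continuousOn

/-! ### The shape of the hodograph function for large times -/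

/-- The properties of `H` and `h = H'` at a fixed large time on which the edge equations rest:
`h` is positive, negative, positive on `(0,a)`, `(a,b)`, `(b,1)`, and `Φ₀(·,u)` is strictly convex
for `u` left of `a`, and strictly convex or decreasing for `u` right of `a`. -/
structure Shape (H h : ℝ → ℝ) (a b : ℝ) : Prop where
  a_pos : 0 < a
  a_lt : a < b
  b_lt : b < 1
  deriv : ∀ s ∈ Ioo (0 : ℝ) 1, HasDerivAt H (h s) s
  cont : ContinuousOn h (Ioo 0 1)
  diff : ∀ u ∈ Ioo (0 : ℝ) 1, ∀ ξ ∈ Ioo (0 : ℝ) 1, DifferentiableAt ℝ (fun ξ => sqMean h ξ u) ξ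
  H_zero : Tendsto H (𝓝[>] 0) atBot
  H_one : Tendsto H (𝓝[<] 1) atTop
  pos_left : ∀ s ∈ Ioo 0 a, 0 < h s
  neg_mid : ∀ s ∈ Ioo a b, h s < 0
  pos_right : ∀ s ∈ Ioo b 1, 0 < h s
  convex_left : ∀ u ∈ Ioo 0 a, StrictConvexOn ℝ (Ico u 1) (fun ξ => sqMean h ξ u)
  convex_right : ∀ u ∈ Ioo a 1, StrictConvexOn ℝ (Ioc 0 u) (fun ξ => sqMean h ξ u) ∨
    ∀ ξ ∈ Ioo 0 u, ∃ D < 0, HasDerivAt (fun ξ => sqMean h ξ u) D ξ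

/-- A function tending to `-∞` at the left end point has positive derivative somewhere near it. -/
theorem exists_deriv_pos_left {H h : ℝ → ℝ} {p q : ℝ} (hpq : p < q)
    (hd : ∀ s ∈ Ioo p q, HasDerivAt H (h s) s) (hH : Tendsto H (𝓝[>] p) atBot) :
    ∃ s ∈ Ioo p q, 0 < h s := by
  by_contra! hc
  have ha : AntitoneOn H (Ioo p q) := by
    refine antitoneOn_of_deriv_nonpos (convex_Ioo p q)
      (fun s hs => (hd s hs).continuousAt.continuousWithinAt)
      (fun s hs => ?_) (fun s hs => ?_)
    · rw [interior_Ioo] at hs; exact (hd s hs).differentiableAt.differentiableWithinAt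
    · rw [interior_Ioo] at hs; rw [(hd s hs).deriv]; exact hc s hs
  have hm : (p + q) / 2 ∈ Ioo p q := ⟨by linarith, by linarith⟩
  have h1 := hH.eventually_lt_atBot (H ((p + q) / 2))
  have h2 : ∀ᶠ s in 𝓝[>] p, s ∈ Ioo p ((p + q) / 2) := Ioo_mem_nhdsGT hm.1
  obtain ⟨s, hs1, hs2⟩ := (h1.and h2).exists
  exact absurd (ha ⟨hs2.1, hs2.2.trans hm.2⟩ hm hs2.2.le) (not_le.2 hs1)

theorem exists_deriv_pos_right {H h : ℝ → ℝ} {p q : ℝ} (hpq : p < q)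
    (hd : ∀ s ∈ Ioo p q, HasDerivAt H (h s) s) (hH : Tendsto H (𝓝[<] q) atTop) :
    ∃ s ∈ Ioo p q, 0 < h s := by
  by_contra! hc
  have ha : AntitoneOn H (Ioo p q) := by
    refine antitoneOn_of_deriv_nonpos (convex_Ioo p q)
      (fun s hs => (hd s hs).continuousAt.continuousWithinAt)
      (fun s hs => ?_) (fun s hs => ?_)
    · rw [interior_Ioo] at hs; exact (hd s hs).differentiableAt.differentiableWithinAt
    · rw [interior_Ioo] at hs; rw [(hd s hs).deriv]; exact hc s hs
  have hm : (p + q) / 2 ∈ Ioo p q := ⟨by linarith, by linarith⟩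
  have h1 := hH.eventually_gt_atTop (H ((p + q) / 2))
  have h2 : ∀ᶠ s in 𝓝[<] q, s ∈ Ioo ((p + q) / 2) q := Ioo_mem_nhdsLT hm.2
  obtain ⟨s, hs1, hs2⟩ := (h1.and h2).exists
  exact absurd (ha hm ⟨hm.1.trans hs2.1, hs2.2⟩ hs2.1.le) (not_le.2 hs1)

theorem tendsto_hodograph_zero {u₀ f : ℝ → ℝ} (h : InitialData u₀ f) (x t : ℝ) :
    Tendsto (hodograph f x t) (𝓝[>] 0) atBot := by
  have h1 : Tendsto (fun s : ℝ => x - 30 * t * s ^ 2) (𝓝[>] 0) (𝓝 (x - 30 * t * 0 ^ 2)) :=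
    ((by fun_prop : Continuous fun s : ℝ => x - 30 * t * s ^ 2).tendsto 0).mono_left
      nhdsWithin_le_nhds
  exact h1.add_atBot (tendsto_neg_atTop_atBot.comp h.f_zero)

theorem tendsto_hodograph_one {u₀ f : ℝ → ℝ} (h : InitialData u₀ f) (x t : ℝ) :
    Tendsto (hodograph f x t) (𝓝[<] 1) atTop := by
  have h1 : Tendsto (fun s : ℝ => x - 30 * t * s ^ 2) (𝓝[<] 1) (𝓝 (x - 30 * t * 1 ^ 2)) :=
    ((by fun_prop : Continuous fun s : ℝ => x - 30 * t * s ^ 2).tendsto 1).mono_left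
      nhdsWithin_le_nhds
  exact h1.add_atTop (tendsto_neg_atBot_atTop.comp h.f_one)

/-- For large times the hodograph function has the required shape: away from `1` the second
derivative `-60t - f''` is negative, near `1` the derivative is convex. -/
theorem InitialData.exists_shape {u₀ f : ℝ → ℝ} (hI : InitialData u₀ f) :
    ∃ T > 0, ∀ t > T, ∃ a b, Shape (hodograph f 0 t) (_root_.deriv (hodograph f 0 t)) a b := by
  have P := hI.profile
  set f₁ := _root_.deriv f with hf₁
  set f₂ := _root_.deriv f₁ with hf₂
  set f₃ := iteratedDeriv 3 f with hf₃
  obtain ⟨ε, hε, hε2, hl, hr₃⟩ := P.exists_third_neg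
  obtain ⟨δl, hδl, hcl⟩ := P.second_deriv_pos_left
  obtain ⟨δr, hδr, hcr⟩ := P.second_deriv_pos_right
  obtain ⟨δ, hδ, hδε, hδδl, hδδr⟩ : ∃ δ > 0, δ ≤ ε ∧ δ ≤ δl ∧ δ ≤ δr :=
    ⟨min ε (min δl δr), lt_min hε (lt_min hδl hδr), min_le_left _ _,
      (min_le_right _ _).trans (min_le_left _ _), (min_le_right _ _).trans (min_le_right _ _)⟩
  have hc₂ : ContinuousOn f₂ (Ioo 0 1) := fun s hs =>
    (P.d₃ s hs).continuousAt.continuousWithinAt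
  have hc₁ : ContinuousOn f₁ (Ioo 0 1) := fun s hs =>
    (P.d₂ s hs).continuousAt.continuousWithinAt
  obtain ⟨M, hM⟩ := isCompact_Icc.exists_bound_of_continuousOn
    (hc₂.mono (Icc_subset_Ioo hδ (by linarith : 1 - δ < 1)))
  have hδmem : δ ∈ Icc δ (1 - δ) := ⟨le_rfl, by linarith⟩
  have hM0 : 0 ≤ M := (norm_nonneg _).trans (hM δ hδmem)
  -- `f''` is decreasing on `(0,δ]`, hence bounded below on `(0,1-δ]`
  have hlow : ∀ s ∈ Ioc 0 (1 - δ), -M ≤ f₂ s := by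
    intro s hs
    rcases le_or_gt δ s with h1 | h1
    · exact (abs_le.1 (hM s ⟨h1, hs.2⟩)).1
    · have hanti : AntitoneOn f₂ (Ioc 0 δ) := by
        have hmem : ∀ r ∈ Ioc 0 δ, r ∈ Ioo (0 : ℝ) 1 := fun r hr =>
          ⟨hr.1, by linarith [hr.2]⟩
        refine antitoneOn_of_deriv_nonpos (convex_Ioc 0 δ) (hc₂.mono hmem) (fun r hr => ?_)
          (fun r hr => ?_)
        · rw [interior_Ioc] at hr
          exact (P.d₃ r (hmem r ⟨hr.1, hr.2.le⟩)).differentiableAt.differentiableWithinAt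
        · rw [interior_Ioc] at hr
          rw [(P.d₃ r (hmem r ⟨hr.1, hr.2.le⟩)).deriv]
          exact (hl r ⟨hr.1, hr.2.le.trans hδε⟩).le
      have h2 := hanti ⟨hs.1, h1.le⟩ ⟨hδ, le_rfl⟩ h1.le
      exact (abs_le.1 (hM δ hδmem)).1.trans h2
  refine ⟨(M + |f₁ δ| / δ + |f₁ (1 - δ)| + 1), by positivity, fun t ht => ?_⟩
  set H := hodograph f 0 t with hH
  set h := _root_.deriv H with hh
  have ht0 : 0 < t := lt_trans (by positivity) ht
  have hhs : ∀ s ∈ Ioo (0 : ℝ) 1, h s = -60 * t * s - f₁ s := fun s hs =>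
    (hI.hasDerivAt_hodograph_explicit 0 t hs).deriv
  have hdH : ∀ s ∈ Ioo (0 : ℝ) 1, HasDerivAt H (h s) s := fun s hs =>
    hI.hasDerivAt_hodograph 0 t hs
  have hdh : ∀ s ∈ Ioo (0 : ℝ) 1, HasDerivAt h (-60 * t - f₂ s) s := by
    intro s hs
    have h1 : HasDerivAt (fun s => -60 * t * s - f₁ s) (-60 * t - f₂ s) s := by
      refine (((hasDerivAt_id s).const_mul (-60 * t)).sub (P.d₂ s hs)).congr_deriv ?_
      ring
    refine h1.congr_of_eventuallyEq ?_
    filter_upwards [isOpen_Ioo.mem_nhds hs] with y hy using hhs y hy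
  have hdh' : ∀ s ∈ Ioo (0 : ℝ) 1, HasDerivAt (fun s => -60 * t - f₂ s) (-f₃ s) s := by
    intro s hs
    simpa using (P.d₃ s hs).const_sub (-60 * t)
  have hhc : ContinuousOn h (Ioo 0 1) := hI.continuousOn_deriv_hodograph 0 t
  have hh'c : ContinuousOn (fun s => -60 * t - f₂ s) (Ioo 0 1) := continuousOn_const.sub hc₂
  have hq1 : 0 ≤ |f₁ δ| / δ := by positivity
  have hq2 := abs_nonneg (f₁ (1 - δ))
  have hh'neg : ∀ s ∈ Ioc 0 (1 - δ), -60 * t - f₂ s < 0 := by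
    intro s hs
    have := hlow s hs
    linarith
  have hδ1 : δ ∈ Ioo (0 : ℝ) 1 := ⟨hδ, by linarith⟩
  have hδ2 : 1 - δ ∈ Ioo (0 : ℝ) 1 := ⟨by linarith, by linarith⟩
  have hhδ : h δ < 0 := by
    rw [hhs δ hδ1]
    have h1 : |f₁ δ| / δ < t := by linarith
    rw [div_lt_iff₀ hδ] at h1
    have h2 := neg_abs_le (f₁ δ)
    nlinarith [mul_pos ht0 hδ]
  have hhδ' : h (1 - δ) < 0 := by
    rw [hhs _ hδ2]
    have h1 : |f₁ (1 - δ)| < t := by linarith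
    have h2 := neg_abs_le (f₁ (1 - δ))
    nlinarith
  have hmem1 : ∀ r ∈ Ioc 0 (1 - δ), r ∈ Ioo (0 : ℝ) 1 := fun r hr => ⟨hr.1, by linarith [hr.2]⟩
  have hmem2 : ∀ r ∈ Ico (1 - δ) 1, r ∈ Ioo (0 : ℝ) 1 := fun r hr => ⟨by linarith [hr.1], hr.2⟩
  have hanti : StrictAntiOn h (Ioc 0 (1 - δ)) := by
    refine strictAntiOn_of_deriv_neg (convex_Ioc 0 (1 - δ)) (hhc.mono hmem1) fun r hr => ?_
    rw [interior_Ioc] at hr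
    have hr' : r ∈ Ioc 0 (1 - δ) := ⟨hr.1, hr.2.le⟩
    rw [(hdh r (hmem1 r hr')).deriv]
    exact hh'neg r hr'
  have hconv : StrictConvexOn ℝ (Ico (1 - δ) 1) h := by
    refine strictConvexOn_of_deriv2_pos (convex_Ico _ _) (hhc.mono hmem2) fun r hr => ?_
    rw [interior_Ico] at hr
    have hr1 : r ∈ Ioo (0 : ℝ) 1 := hmem2 r ⟨hr.1.le, hr.2⟩
    have e : _root_.deriv h =ᶠ[𝓝 r] fun s => -60 * t - f₂ s := by
      filter_upwards [isOpen_Ioo.mem_nhds hr1] with y hy using (hdh y hy).deriv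
    simp only [Function.iterate_succ, Function.iterate_zero, Function.comp, id]
    rw [e.deriv_eq, (hdh' r hr1).deriv]
    have := hr₃ r ⟨by linarith [hr.1], hr.2⟩
    linarith
  have hH0 := tendsto_hodograph_zero hI 0 t
  have hH1 := tendsto_hodograph_one hI 0 t
  obtain ⟨p, hp, hp0⟩ := exists_deriv_pos_left hδ
    (fun s hs => hdH s ⟨hs.1, hs.2.trans hδ1.2⟩) hH0
  obtain ⟨q, hq, hq0⟩ := exists_deriv_pos_right (by linarith : 1 - δ < 1)
    (fun s hs => hdH s ⟨hδ2.1.trans hs.1, hs.2⟩) hH1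
  obtain ⟨a, ha, ha0⟩ := intermediate_value_Ioo' hp.2.le
    (hhc.mono fun s hs => ⟨hp.1.trans_le hs.1, hs.2.trans_lt hδ1.2⟩) ⟨hhδ, hp0⟩
  obtain ⟨b, hb, hb0⟩ := intermediate_value_Ioo hq.1.le
    (hhc.mono fun s hs => ⟨hδ2.1.trans_le hs.1, hs.2.trans_lt hq.2⟩) ⟨hhδ', hq0⟩
  have ha' : a ∈ Ioc 0 (1 - δ) := ⟨hp.1.trans ha.1, by linarith [ha.2]⟩
  have hb' : b ∈ Ico (1 - δ) 1 := ⟨hb.1.le, hb.2.trans hq.2⟩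
  refine ⟨a, b, ⟨ha'.1, by linarith [ha.2, hb.1], hb'.2, hdH, hhc, fun u hu ξ hξ =>
    (hasDerivAt_sqMean hdh hh'c hξ hu).differentiableAt, hH0, hH1, ?_, ?_, ?_, ?_, ?_⟩⟩
  · intro s hs
    rw [← ha0]
    exact hanti ⟨hs.1, hs.2.le.trans ha'.2⟩ ha' hs.2
  · intro s hs
    rcases le_or_gt s (1 - δ) with h1 | h1
    · rw [← ha0]
      exact hanti ha' ⟨ha'.1.trans hs.1, h1⟩ hs.1
    · exact neg_of_strictConvexOn hconv ⟨le_rfl, by linarith⟩ hb' h1 hs.2 hhδ'.le hb0.le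
  · intro s hs
    by_contra hc
    exact absurd hb0 (neg_of_strictConvexOn hconv ⟨le_rfl, by linarith⟩
      ⟨hb'.1.trans hs.1.le, hs.2⟩ hb.1 hs.1 hhδ'.le (not_lt.1 hc)).ne
  · intro u hu
    have hu1 : u ∈ Ioo (0 : ℝ) 1 := ⟨hu.1, hu.2.trans (hmem1 a ha').2⟩
    refine strictConvexOn_sqMean hdh hdh' P.cont.neg (convex_Ico u 1)
      (fun s hs => ⟨hu.1.trans_le hs.1, hs.2⟩) hu1 fun ξ hξ => ?_
    rw [interior_Ico] at hξ
    exact hcl u ⟨hu.1, by linarith [hu.2, ha.2]⟩ ξ hξ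
  · intro u hu
    have hu1 : u ∈ Ioo (0 : ℝ) 1 := ⟨ha'.1.trans hu.1, hu.2⟩
    rcases le_or_gt u (1 - δ) with h1 | h1
    · right
      intro ξ hξ
      have hξ1 : ξ ∈ Ioo (0 : ℝ) 1 := ⟨hξ.1, hξ.2.trans hu.2⟩
      refine ⟨_, ?_, hasDerivAt_sqMean hdh hh'c hξ1 hu1⟩
      have hpos : 0 < ∫ r in (0 : ℝ)..1,
          -((1 - r ^ 2) * (-60 * t - f₂ ((1 - r ^ 2) * ξ + r ^ 2 * u))) := by
        refine intervalIntegral.intervalIntegral_pos_of_pos_on ?_ (fun r hr' => ?_) zero_lt_one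
        · refine ContinuousOn.intervalIntegrable ?_
          rw [uIcc_of_le zero_le_one]
          exact (ContinuousOn.mul (by fun_prop) (continuousOn_convex_arg hh'c hξ1 hu1)).neg
        · have h2 : 0 < 1 - r ^ 2 := by nlinarith [hr'.1, hr'.2]
          have h3 := convex_arg_mem_Icc (p := ξ) (q := u) (ξ := ξ) (u := u) ⟨le_rfl, hξ.2.le⟩
            ⟨hξ.2.le, le_rfl⟩ ⟨hr'.1.le, hr'.2.le⟩
          have h4 := hh'neg _ ⟨hξ.1.trans_le h3.1, h3.2.trans h1⟩
          nlinarith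
      rw [intervalIntegral.integral_neg] at hpos
      linarith
    · left
      refine strictConvexOn_sqMean hdh hdh' P.cont.neg (convex_Ioc 0 u)
        (fun s hs => ⟨hs.1, hs.2.trans_lt hu.2⟩) hu1 fun ξ hξ => ?_
      rw [interior_Ioc] at hξ
      exact hcr u ⟨by linarith, hu.2⟩ ξ hξ

/-! ### Abel forms on subintervals -/

theorem intervalIntegrable_left {h : ℝ → ℝ} (hh : ContinuousOn h (Ioo 0 1)) {ξ c d : ℝ}
    (hξ : 0 < ξ) (hc : ξ ≤ c) (hcd : c ≤ d) (hd : d < 1) :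
    IntervalIntegrable (fun s => h s * (√(s - ξ))⁻¹) volume c d := by
  rw [intervalIntegrable_iff_integrableOn_Icc_of_le hcd]
  have h1 : IntegrableOn (fun s : ℝ => (√(s - ξ))⁻¹) (Icc ξ d) := by
    rw [integrableOn_Icc_iff_integrableOn_Ioo]
    refine ⟨by fun_prop, ?_⟩
    rw [hasFiniteIntegral_iff_ofReal (ae_of_all _ fun v => by positivity),
      lintegral_inv_sqrt_sub_left (hc.trans hcd)]
    exact ENNReal.ofReal_lt_top
  exact (h1.mono_set (Icc_subset_Icc hc le_rfl)).continuousOn_mul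
    (hh.mono (Icc_subset_Ioo (hξ.trans_le hc) hd)) isCompact_Icc

theorem intervalIntegrable_right {h : ℝ → ℝ} (hh : ContinuousOn h (Ioo 0 1)) {ξ c d : ℝ}
    (hc : 0 < c) (hcd : c ≤ d) (hd : d ≤ ξ) (hξ : ξ < 1) :
    IntervalIntegrable (fun s => h s * (√(ξ - s))⁻¹) volume c d := by
  rw [intervalIntegrable_iff_integrableOn_Icc_of_le hcd]
  have h1 : IntegrableOn (fun s : ℝ => (√(ξ - s))⁻¹) (Icc c ξ) := by
    rw [integrableOn_Icc_iff_integrableOn_Ioo]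
    exact integrableOn_inv_sqrt_sub (hcd.trans hd)
  exact (h1.mono_set (Icc_subset_Icc le_rfl hd)).continuousOn_mul
    (hh.mono (Icc_subset_Ioo hc (hd.trans_lt hξ))) isCompact_Icc

theorem intervalIntegrable_half {h : ℝ → ℝ} (hh : ContinuousOn h (Ioo 0 1)) {ξ c d : ℝ}
    (hc : 0 < c) (hcd : c ≤ d) (hd : d < 1) :
    IntervalIntegrable (fun s => h s * √(ξ - s)) volume c d := by
  refine ContinuousOn.intervalIntegrable ?_
  rw [uIcc_of_le hcd]
  exact (hh.mono (Icc_subset_Ioo hc hd)).mul (by fun_prop)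

theorem intervalIntegral_neg_of_neg_on {g : ℝ → ℝ} {a b : ℝ} (hg : IntervalIntegrable g volume a b)
    (hneg : ∀ s ∈ Ioo a b, g s < 0) (hab : a < b) : ∫ s in a..b, g s < 0 := by
  have h1 : 0 < ∫ s in a..b, -g s :=
    intervalIntegral.intervalIntegral_pos_of_pos_on hg.neg (fun s hs => by linarith [hneg s hs]) hab
  rw [intervalIntegral.integral_neg] at h1
  linarith

theorem intervalIntegral_nonneg_of_pos_on {g : ℝ → ℝ} {a b : ℝ}
    (hg : IntervalIntegrable g volume a b) (hpos : ∀ s ∈ Ioo a b, 0 < g s) (hab : a ≤ b) :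
    0 ≤ ∫ s in a..b, g s := by
  rcases hab.eq_or_lt with rfl | h
  · simp
  · exact (intervalIntegral.intervalIntegral_pos_of_pos_on hg hpos h).le

/-- A continuous family that starts out positive and later fails to be so has a first parameter at
which it touches zero from above. -/
theorem exists_touching {F : ℝ → ℝ → ℝ} {α β p q : ℝ}
    (hF : ContinuousOn (Function.uncurry F) (Icc α β ×ˢ uIcc p q))
    (hp : ∀ ξ ∈ Icc α β, 0 < F ξ p) (hq : ∃ ξ ∈ Icc α β, F ξ q ≤ 0) :
    ∃ u ∈ uIcc p q, ∃ ξ ∈ Icc α β, F ξ u = 0 ∧ ∀ y ∈ Icc α β, 0 ≤ F y u := by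
  have hK : IsCompact (Icc α β ×ˢ uIcc p q) := isCompact_Icc.prod isCompact_uIcc
  set S := (Icc α β ×ˢ uIcc p q) ∩ (Function.uncurry F) ⁻¹' Iic 0 with hS
  have hSc : IsCompact S :=
    hK.of_isClosed_subset (hF.preimage_isClosed_of_isClosed hK.isClosed isClosed_Iic)
      inter_subset_left
  have hSn : S.Nonempty := by
    obtain ⟨ξ, hξ, hle⟩ := hq
    exact ⟨(ξ, q), ⟨hξ, right_mem_uIcc⟩, hle⟩
  obtain ⟨⟨ξ, u⟩, ⟨⟨hξ, hu⟩, hle⟩, hmin⟩ := hSc.exists_isMinOn hSn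
    (f := fun z : ℝ × ℝ => |z.2 - p|) (by fun_prop)
  have hle' : F ξ u ≤ 0 := hle
  have hnn : ∀ y ∈ Icc α β, 0 ≤ F y u := by
    intro y hy
    by_contra hc
    have hsub : uIcc p u ⊆ uIcc p q := uIcc_subset_uIcc left_mem_uIcc hu
    have hcont : ContinuousOn (fun v => F y v) (uIcc p u) :=
      hF.comp (f := fun v : ℝ => (y, v)) (by fun_prop) fun v hv => ⟨hy, hsub hv⟩
    have h0 : (0 : ℝ) ∈ uIcc (F y p) (F y u) := by
      rw [uIcc_comm, uIcc_of_le ((not_le.1 hc).trans (hp y hy)).le]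
      exact ⟨(not_le.1 hc).le, (hp y hy).le⟩
    obtain ⟨v, hv, hv0⟩ := intermediate_value_uIcc hcont h0
    have hv0' : F y v = 0 := hv0
    have hm : |u - p| ≤ |v - p| := hmin (show (y, v) ∈ S from ⟨⟨hy, hsub hv⟩, hv0'.le⟩)
    have hvu : v ≠ u := by
      rintro rfl
      exact hc hv0'.ge
    rcases le_total p u with hpu | hpu
    · rw [uIcc_of_le hpu] at hv
      rw [abs_of_nonneg (by linarith), abs_of_nonneg (by linarith [hv.1])] at hm
      exact hvu (le_antisymm hv.2 (by linarith))
    · rw [uIcc_of_ge hpu] at hv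
      rw [abs_of_nonpos (by linarith), abs_of_nonpos (by linarith [hv.2])] at hm
      exact hvu (le_antisymm (by linarith) hv.1)
  exact ⟨u, hu, ξ, hξ, le_antisymm hle' (hnn ξ hξ), hnn⟩

theorem sqMean_of_lt {h : ℝ → ℝ} (hh : ContinuousOn h (Ioo 0 1)) {ξ u : ℝ} (hξ : 0 < ξ)
    (hlt : ξ < u) (hu : u < 1) :
    sqMean h ξ u = (2 * √(u - ξ))⁻¹ * ∫ s in ξ..u, h s * (√(s - ξ))⁻¹ := by
  rw [← mu_form_eq_sqMean hh ⟨hξ, hlt.trans hu⟩ ⟨hξ.trans hlt, hu⟩, mu_form_of_lt h hlt]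

theorem sqMean_of_gt {h : ℝ → ℝ} (hh : ContinuousOn h (Ioo 0 1)) {ξ u : ℝ} (hu : 0 < u)
    (hlt : u < ξ) (hξ : ξ < 1) :
    sqMean h ξ u = (2 * √(ξ - u))⁻¹ * ∫ s in u..ξ, h s * (√(ξ - s))⁻¹ := by
  rw [← mu_form_eq_sqMean hh ⟨hu.trans hlt, hξ⟩ ⟨hu, hlt.trans hξ⟩, mu_form_of_gt h hlt]

theorem inv_two_sqrt_pos {c : ℝ} (hc : 0 < c) : 0 < (2 * √c)⁻¹ := by
  have := Real.sqrt_pos.2 hc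
  positivity

namespace Shape

variable {H h : ℝ → ℝ} {a b : ℝ}

theorem b_pos (S : Shape H h a b) : 0 < b := S.a_pos.trans S.a_lt

theorem a_lt_one (S : Shape H h a b) : a < 1 := S.a_lt.trans S.b_lt

theorem left_pos_iff (S : Shape H h a b) {ξ u : ℝ} (hξ : 0 < ξ) (hlt : ξ < u) (hu : u < 1) :
    0 < sqMean h ξ u ↔ 0 < ∫ s in ξ..u, h s * (√(s - ξ))⁻¹ := by
  rw [sqMean_of_lt S.cont hξ hlt hu]
  exact mul_pos_iff_of_pos_left (inv_two_sqrt_pos (sub_pos.2 hlt))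

theorem left_eq_zero_iff (S : Shape H h a b) {ξ u : ℝ} (hξ : 0 < ξ) (hlt : ξ < u) (hu : u < 1) :
    sqMean h ξ u = 0 ↔ ∫ s in ξ..u, h s * (√(s - ξ))⁻¹ = 0 := by
  rw [sqMean_of_lt S.cont hξ hlt hu, mul_eq_zero]
  exact or_iff_right (inv_two_sqrt_pos (sub_pos.2 hlt)).ne'

theorem right_pos_iff (S : Shape H h a b) {ξ u : ℝ} (hu : 0 < u) (hlt : u < ξ) (hξ : ξ < 1) :
    0 < sqMean h ξ u ↔ 0 < ∫ s in u..ξ, h s * (√(ξ - s))⁻¹ := by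
  rw [sqMean_of_gt S.cont hu hlt hξ]
  exact mul_pos_iff_of_pos_left (inv_two_sqrt_pos (sub_pos.2 hlt))

theorem right_eq_zero_iff (S : Shape H h a b) {ξ u : ℝ} (hu : 0 < u) (hlt : u < ξ) (hξ : ξ < 1) :
    sqMean h ξ u = 0 ↔ ∫ s in u..ξ, h s * (√(ξ - s))⁻¹ = 0 := by
  rw [sqMean_of_gt S.cont hu hlt hξ, mul_eq_zero]
  exact or_iff_right (inv_two_sqrt_pos (sub_pos.2 hlt)).ne'

theorem left_integral_pos (S : Shape H h a b) {ξ c d : ℝ} (hξ : 0 < ξ) (hc : ξ ≤ c) (hcd : c < d)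
    (hd : d < 1) (hpos : ∀ s ∈ Ioo c d, 0 < h s) :
    0 < ∫ s in c..d, h s * (√(s - ξ))⁻¹ := by
  refine intervalIntegral.intervalIntegral_pos_of_pos_on
    (intervalIntegrable_left S.cont hξ hc hcd.le hd) (fun s hs => ?_) hcd
  have := Real.sqrt_pos.2 (by linarith [hs.1] : 0 < s - ξ)
  exact mul_pos (hpos s hs) (inv_pos.2 this)

theorem half_integral_pos (S : Shape H h a b) {ξ c d : ℝ} (hc : 0 < c) (hcd : c < d)
    (hd : d ≤ ξ) (hξ : ξ < 1) (hpos : ∀ s ∈ Ioo c d, 0 < h s) :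
    0 < ∫ s in c..d, h s * √(ξ - s) := by
  refine intervalIntegral.intervalIntegral_pos_of_pos_on
    (intervalIntegrable_half S.cont hc hcd.le (hd.trans_lt hξ)) (fun s hs => ?_) hcd
  have := Real.sqrt_pos.2 (by linarith [hs.2] : 0 < ξ - s)
  exact mul_pos (hpos s hs) this

/-- `Φ₀` is positive if `h` is positive between its two arguments. -/
theorem sqMean_pos_of_pos (S : Shape H h a b) {ξ u : ℝ} (hξ : 0 < ξ) (hlt : ξ < u) (hu : u < 1)
    (hpos : ∀ s ∈ Ioo ξ u, 0 < h s) : 0 < sqMean h ξ u :=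
  (S.left_pos_iff hξ hlt hu).2 (S.left_integral_pos hξ le_rfl hlt hu hpos)

theorem exists_lower_bound (S : Shape H h a b) :
    ∃ C, 0 ≤ C ∧ ∀ s ∈ Ioo (0 : ℝ) 1, -C ≤ h s := by
  obtain ⟨C, hC⟩ := isCompact_Icc.exists_bound_of_continuousOn
    (S.cont.mono (Icc_subset_Ioo S.a_pos S.b_lt))
  have hC0 : 0 ≤ C := (norm_nonneg _).trans (hC a ⟨le_rfl, S.a_lt.le⟩)
  refine ⟨C, hC0, fun s hs => ?_⟩
  rcases lt_or_ge s a with h1 | h1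
  · linarith [S.pos_left s ⟨hs.1, h1⟩]
  rcases le_or_gt s b with h2 | h2
  · exact (abs_le.1 (hC s ⟨h1, h2⟩)).1
  · linarith [S.pos_right s ⟨h2, hs.2⟩]

theorem left_integral_ge (S : Shape H h a b) {C : ℝ} (hC0 : 0 ≤ C)
    (hC : ∀ s ∈ Ioo (0 : ℝ) 1, -C ≤ h s) {ξ c d : ℝ} (hξ : 0 < ξ) (hc : ξ ≤ c) (hcd : c ≤ d)
    (hd : d < 1) : -(2 * C) ≤ ∫ s in c..d, h s * (√(s - ξ))⁻¹ := by
  have hw : ∀ {p q : ℝ}, ξ ≤ p → p ≤ q → q < 1 →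
      IntervalIntegrable (fun s : ℝ => (√(s - ξ))⁻¹) volume p q := by
    intro p q hp hpq hq
    simpa using intervalIntegrable_left (h := fun _ => 1) continuousOn_const hξ hp hpq hq
  have h1 : ∫ s in c..d, -C * (√(s - ξ))⁻¹ ≤ ∫ s in c..d, h s * (√(s - ξ))⁻¹ := by
    refine intervalIntegral.integral_mono_on hcd ((hw hc hcd hd).const_mul _)
      (intervalIntegrable_left S.cont hξ hc hcd hd) fun s hs => ?_
    exact mul_le_mul_of_nonneg_right (hC s ⟨by linarith [hs.1], by linarith [hs.2]⟩)
      (by positivity)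
  have h2 : ∫ s in ξ..d, (√(s - ξ))⁻¹ = 2 * √(d - ξ) := by
    rw [intervalIntegral.integral_of_le (hc.trans hcd), integral_Ioc_eq_integral_Ioo,
      integral_eq_lintegral_of_nonneg_ae (ae_of_all _ fun v => by positivity) (by fun_prop),
      lintegral_inv_sqrt_sub_left (hc.trans hcd), ENNReal.toReal_ofReal (by positivity)]
  have h3 : ∫ s in c..d, (√(s - ξ))⁻¹ ≤ ∫ s in ξ..d, (√(s - ξ))⁻¹ :=
    intervalIntegral.integral_mono_interval hc hcd le_rfl
      (ae_of_all _ fun s => by positivity) (hw le_rfl (hc.trans hcd) hd)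
  have h4 : √(d - ξ) ≤ 1 := Real.sqrt_le_one.2 (by linarith)
  rw [intervalIntegral.integral_const_mul] at h1
  nlinarith

theorem right_integral_ge (S : Shape H h a b) {C : ℝ} (hC0 : 0 ≤ C)
    (hC : ∀ s ∈ Ioo (0 : ℝ) 1, -C ≤ h s) {ξ c d : ℝ} (hc : 0 < c) (hcd : c ≤ d) (hd : d ≤ ξ)
    (hξ : ξ < 1) : -(2 * C) ≤ ∫ s in c..d, h s * (√(ξ - s))⁻¹ := by
  have hw : ∀ {p q : ℝ}, 0 < p → p ≤ q → q ≤ ξ →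
      IntervalIntegrable (fun s : ℝ => (√(ξ - s))⁻¹) volume p q := by
    intro p q hp hpq hq
    simpa using intervalIntegrable_right (h := fun _ => 1) continuousOn_const hp hpq hq hξ
  have h1 : ∫ s in c..d, -C * (√(ξ - s))⁻¹ ≤ ∫ s in c..d, h s * (√(ξ - s))⁻¹ := by
    refine intervalIntegral.integral_mono_on hcd ((hw hc hcd hd).const_mul _)
      (intervalIntegrable_right S.cont hc hcd hd hξ) fun s hs => ?_
    exact mul_le_mul_of_nonneg_right (hC s ⟨by linarith [hs.1], by linarith [hs.2]⟩)
      (by positivity)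
  have h2 : ∫ s in c..ξ, (√(ξ - s))⁻¹ = 2 * √(ξ - c) := by
    rw [intervalIntegral.integral_of_le (hcd.trans hd), integral_Ioc_eq_integral_Ioo,
      integral_inv_sqrt_sub (hcd.trans hd)]
  have h3 : ∫ s in c..d, (√(ξ - s))⁻¹ ≤ ∫ s in c..ξ, (√(ξ - s))⁻¹ :=
    intervalIntegral.integral_mono_interval le_rfl hcd hd
      (ae_of_all _ fun s => by positivity) (hw hc (hcd.trans hd) le_rfl)
  have h4 : √(ξ - c) ≤ 1 := Real.sqrt_le_one.2 (by linarith)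
  rw [intervalIntegral.integral_const_mul] at h1
  nlinarith

/-- A weight bounded below by `κ`, against a positive derivative. -/
theorem sub_le_integral_mul (S : Shape H h a b) {c d κ : ℝ} {w : ℝ → ℝ} (hc : 0 < c) (hcd : c ≤ d)
    (hd : d < 1) (hpos : ∀ s ∈ Ioo c d, 0 < h s) (hw : ∀ s ∈ Ioo c d, κ ≤ w s)
    (hi : IntervalIntegrable (fun s => h s * w s) volume c d) :
    κ * (H d - H c) ≤ ∫ s in c..d, h s * w s := by
  have hsub : Icc c d ⊆ Ioo (0 : ℝ) 1 := Icc_subset_Ioo hc hd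
  have hhi : IntervalIntegrable h volume c d := by
    refine ContinuousOn.intervalIntegrable ?_
    rw [uIcc_of_le hcd]; exact S.cont.mono hsub
  rw [← intervalIntegral.integral_eq_sub_of_hasDerivAt (f := H) (f' := h) (fun s hs => by
    rw [uIcc_of_le hcd] at hs; exact S.deriv s (hsub hs)) hhi,
    ← intervalIntegral.integral_const_mul]
  refine intervalIntegral.integral_mono_on_of_le_Ioo hcd (hhi.const_mul κ) hi fun s hs => ?_
  have := hpos s hs
  have := hw s hs
  nlinarith

/-! ### The trailing edge -/

/-- At a critical zero of `Φ₀(·,u₁)`, the point `u₁` lies to the right of `b` and `Φ₀(·,u₁)` is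
positive elsewhere. -/
theorem trailing_props (S : Shape H h a b) {u₁ u₃ : ℝ} (h3 : 0 < u₃) (h31 : u₃ < u₁) (h1 : u₁ < 1)
    (h0 : sqMean h u₃ u₁ = 0) (hd : HasDerivAt (fun ξ => sqMean h ξ u₁) 0 u₃) :
    b < u₁ ∧ ∀ ξ ∈ Ioo 0 u₁, ξ ≠ u₃ → 0 < sqMean h ξ u₁ := by
  have ha : a < u₁ := by
    by_contra hc
    have := S.sqMean_pos_of_pos h3 h31 h1 fun s hs =>
      S.pos_left s ⟨h3.trans hs.1, hs.2.trans_le (not_lt.1 hc)⟩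
    exact this.ne' h0
  have hconv : StrictConvexOn ℝ (Ioc 0 u₁) (fun ξ => sqMean h ξ u₁) := by
    rcases S.convex_right u₁ ⟨ha, h1⟩ with hc | hc
    · exact hc
    · obtain ⟨D, hD, hD'⟩ := hc u₃ ⟨h3, h31⟩
      exact absurd (hD'.unique hd) hD.ne
  have hpos : ∀ ξ ∈ Ioo 0 u₁, ξ ≠ u₃ → 0 < sqMean h ξ u₁ := by
    intro ξ hξ hne
    have hm3 : u₃ ∈ Ioc 0 u₁ := ⟨h3, h31.le⟩
    have hmξ : ξ ∈ Ioc 0 u₁ := ⟨hξ.1, hξ.2.le⟩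
    rcases lt_or_gt_of_ne hne with hlt | hlt
    · have := hconv.slope_lt_of_hasDerivAt hmξ hm3 hlt hd
      rw [slope_def_field, h0, zero_sub, div_lt_iff₀ (by linarith)] at this
      linarith
    · have := hconv.lt_slope_of_hasDerivAt hm3 hmξ hlt hd
      rw [slope_def_field, h0, sub_zero, lt_div_iff₀ (by linarith)] at this
      linarith
  refine ⟨?_, hpos⟩
  by_contra hc
  -- for `u₁ ≤ b` the derivative `h` is negative on `(a,u₁)`, hence so is `Φ₀` at its midpoint
  have hm : (a + u₁) / 2 ∈ Ioo 0 u₁ := ⟨by linarith [S.a_pos], by linarith⟩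
  have hneg : sqMean h ((a + u₁) / 2) u₁ < 0 := by
    rw [sqMean_of_lt S.cont hm.1 hm.2 h1]
    refine mul_neg_of_pos_of_neg (inv_two_sqrt_pos (sub_pos.2 hm.2)) ?_
    refine intervalIntegral_neg_of_neg_on (intervalIntegrable_left S.cont hm.1 le_rfl hm.2.le h1)
      (fun s hs => ?_) hm.2
    have := Real.sqrt_pos.2 (sub_pos.2 hs.1)
    exact mul_neg_of_neg_of_pos (S.neg_mid s ⟨by linarith [hs.1], hs.2.trans_le (not_lt.1 hc)⟩)
      (inv_pos.2 this)
  by_cases he : (a + u₁) / 2 = u₃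
  · rw [he, h0] at hneg; exact lt_irrefl _ hneg
  · exact lt_asymm hneg (hpos _ hm he)

/-- Positivity of `Φ₀(·,u)` propagates to larger `u`. -/
theorem sqMean_pos_of_trailing (S : Shape H h a b) {u₁ u₃ : ℝ} (h3 : 0 < u₃) (h31 : u₃ < u₁)
    (h1 : u₁ < 1) (h0 : sqMean h u₃ u₁ = 0) (hd : HasDerivAt (fun ξ => sqMean h ξ u₁) 0 u₃)
    {u ξ : ℝ} (hu : u₁ < u) (hu1 : u < 1) (hξ : ξ ∈ Ioo 0 u) : 0 < sqMean h ξ u := by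
  obtain ⟨hb, hpos⟩ := S.trailing_props h3 h31 h1 h0 hd
  rcases lt_or_ge ξ u₁ with hlt | hge
  · have hnn : 0 ≤ ∫ s in ξ..u₁, h s * (√(s - ξ))⁻¹ := by
      by_cases he : ξ = u₃
      · subst he
        rw [(S.left_eq_zero_iff h3 h31 h1).1 h0]
      · exact ((S.left_pos_iff hξ.1 hlt h1).1 (hpos ξ ⟨hξ.1, hlt⟩ he)).le
    rw [S.left_pos_iff hξ.1 hξ.2 hu1, ← intervalIntegral.integral_add_adjacent_intervals
      (intervalIntegrable_left S.cont hξ.1 le_rfl hlt.le h1)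
      (intervalIntegrable_left S.cont hξ.1 hlt.le hu.le hu1)]
    have := S.left_integral_pos hξ.1 hlt.le hu hu1 fun s hs =>
      S.pos_right s ⟨hb.trans hs.1, hs.2.trans hu1⟩
    linarith
  · exact S.sqMean_pos_of_pos hξ.1 hξ.2 hu1 fun s hs =>
      S.pos_right s ⟨hb.trans_le (hge.trans hs.1.le), hs.2.trans hu1⟩

theorem trailing_unique (S : Shape H h a b) {u₁ u₃ v₁ v₃ : ℝ} (h3 : 0 < u₃) (h31 : u₃ < u₁)
    (h1 : u₁ < 1) (h0 : sqMean h u₃ u₁ = 0) (hd : HasDerivAt (fun ξ => sqMean h ξ u₁) 0 u₃)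
    (k3 : 0 < v₃) (k31 : v₃ < v₁) (k1 : v₁ < 1) (k0 : sqMean h v₃ v₁ = 0)
    (kd : HasDerivAt (fun ξ => sqMean h ξ v₁) 0 v₃) : u₁ = v₁ ∧ u₃ = v₃ := by
  rcases lt_trichotomy u₁ v₁ with hlt | rfl | hlt
  · exact absurd k0 (S.sqMean_pos_of_trailing h3 h31 h1 h0 hd hlt k1 ⟨k3, k31⟩).ne'
  · refine ⟨rfl, ?_⟩
    by_contra hne
    exact absurd h0 ((S.trailing_props k3 k31 k1 k0 kd).2 u₃ ⟨h3, h31⟩ hne).ne'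
  · exact absurd h0 (S.sqMean_pos_of_trailing k3 k31 k1 k0 kd hlt h1 ⟨h3, h31⟩).ne'

/-- Lowering `u` from near `1` to `b`, the function `Φ₀(·,u)` stops being positive; where it first
touches zero, it does so at an interior minimum. -/
theorem exists_trailing (S : Shape H h a b) : ∃ u₁ u₃, 0 < u₃ ∧ u₃ < u₁ ∧ u₁ < 1 ∧
    sqMean h u₃ u₁ = 0 ∧ HasDerivAt (fun ξ => sqMean h ξ u₁) 0 u₃ := by
  have ha := S.a_pos
  have hab := S.a_lt
  have hb := S.b_lt
  have hb0 := S.b_pos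
  obtain ⟨C, hC0, hC⟩ := S.exists_lower_bound
  -- for `u = q` near `1` the function `Φ₀(·,q)` is positive
  obtain ⟨q, hq, hqb⟩ : ∃ q ∈ Ioo b 1, H b + 2 * C < H q := by
    have e2 : ∀ᶠ s in 𝓝[<] (1 : ℝ), s ∈ Ioo b 1 := Ioo_mem_nhdsLT hb
    obtain ⟨q, h1, h2⟩ := ((S.H_one.eventually_gt_atTop (H b + 2 * C)).and e2).exists
    exact ⟨q, h2, h1⟩
  have E1 : ∀ ξ ∈ Ioc 0 b, 0 < sqMean h ξ q := by
    intro ξ hξ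
    have hξq : ξ < q := hξ.2.trans_lt hq.1
    rw [S.left_pos_iff hξ.1 hξq hq.2, ← intervalIntegral.integral_add_adjacent_intervals
      (intervalIntegrable_left S.cont hξ.1 le_rfl hξ.2 hb)
      (intervalIntegrable_left S.cont hξ.1 hξ.2 hq.1.le hq.2)]
    have i1 := S.left_integral_ge hC0 hC hξ.1 le_rfl hξ.2 hb
    have i2 := S.sub_le_integral_mul (κ := 1) hb0 hq.1.le hq.2
      (fun s hs => S.pos_right s ⟨hs.1, hs.2.trans hq.2⟩)
      (w := fun s => (√(s - ξ))⁻¹) (fun s hs => by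
        refine one_le_inv_iff₀.2 ⟨Real.sqrt_pos.2 (by linarith [hs.1, hξ.2]), ?_⟩
        exact Real.sqrt_le_one.2 (by linarith [hs.2, hξ.1, hq.2]))
      (intervalIntegrable_left S.cont hξ.1 hξ.2 hq.1.le hq.2)
    linarith
  -- for `ξ` near `0` it is positive for all `u ≥ b`
  obtain ⟨α, hα, hαH⟩ : ∃ α ∈ Ioo 0 a, ∀ ξ ∈ Ioc 0 α, H ξ < H a - 2 * C := by
    obtain ⟨c, hc, hc'⟩ := mem_nhdsGT_iff_exists_Ioo_subset.1
      (S.H_zero.eventually_lt_atBot (H a - 2 * C))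
    have hc0 : (0 : ℝ) < c := hc
    have hm := lt_min hc0 ha
    have hm1 : min c a ≤ c := min_le_left _ _
    have hm2 : min c a ≤ a := min_le_right _ _
    exact ⟨min c a / 2, ⟨by linarith, by linarith⟩, fun ξ hξ => hc' ⟨hξ.1, by linarith [hξ.2]⟩⟩
  have E2 : ∀ ξ ∈ Ioc 0 α, ∀ u, b ≤ u → u < 1 → 0 < sqMean h ξ u := by
    intro ξ hξ u hbu hu1
    have hξa : ξ < a := hξ.2.trans_lt hα.2
    rw [S.left_pos_iff hξ.1 (by linarith) hu1,
      ← intervalIntegral.integral_add_adjacent_intervals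
        (intervalIntegrable_left S.cont hξ.1 le_rfl (hξa.trans hab).le hb)
        (intervalIntegrable_left S.cont hξ.1 (hξa.trans hab).le hbu hu1),
      ← intervalIntegral.integral_add_adjacent_intervals
        (intervalIntegrable_left S.cont hξ.1 le_rfl hξa.le S.a_lt_one)
        (intervalIntegrable_left S.cont hξ.1 hξa.le hab.le hb)]
    have i1 := S.left_integral_ge hC0 hC hξ.1 hξa.le hab.le hb
    have i2 := S.sub_le_integral_mul (κ := 1) hξ.1 hξa.le S.a_lt_one
      (fun s hs => S.pos_left s ⟨hξ.1.trans hs.1, hs.2⟩)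
      (w := fun s => (√(s - ξ))⁻¹) (fun s hs => by
        refine one_le_inv_iff₀.2 ⟨Real.sqrt_pos.2 (by linarith [hs.1]), ?_⟩
        exact Real.sqrt_le_one.2 (by linarith [hs.2, hξ.1, S.a_lt_one]))
      (intervalIntegrable_left S.cont hξ.1 le_rfl hξa.le S.a_lt_one)
    have i3 : 0 ≤ ∫ s in b..u, h s * (√(s - ξ))⁻¹ := by
      rcases hbu.eq_or_lt with rfl | hlt
      · simp
      · exact (S.left_integral_pos hξ.1 (hξa.trans hab).le hlt hu1
          fun s hs => S.pos_right s ⟨hs.1, hs.2.trans hu1⟩).le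
    have := hαH ξ hξ
    linarith
  have hmid : sqMean h ((a + b) / 2) b < 0 := by
    have hm : (a + b) / 2 < b := by linarith
    have hm0 : 0 < (a + b) / 2 := by linarith
    rw [sqMean_of_lt S.cont hm0 hm hb]
    refine mul_neg_of_pos_of_neg (inv_two_sqrt_pos (sub_pos.2 hm)) ?_
    refine intervalIntegral_neg_of_neg_on (intervalIntegrable_left S.cont hm0 le_rfl hm.le hb)
      (fun s hs => ?_) hm
    have := Real.sqrt_pos.2 (sub_pos.2 hs.1)
    exact mul_neg_of_neg_of_pos (S.neg_mid s ⟨by linarith [hs.1], hs.2⟩) (inv_pos.2 this)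
  have hKm : (a + b) / 2 ∈ Icc α b := ⟨by linarith [hα.2], by linarith⟩
  obtain ⟨u, hu, ξ, hξ, hz, hnn⟩ := exists_touching (F := sqMean h) (α := α) (β := b) (p := q)
    (q := b) ((continuousOn_sqMean S.cont).mono (by
      rw [uIcc_of_ge hq.1.le]
      exact prod_mono (Icc_subset_Ioo hα.1 hb) (Icc_subset_Ioo hb0 hq.2)))
    (fun ξ hξ => E1 ξ ⟨hα.1.trans_le hξ.1, hξ.2⟩) ⟨_, hKm, hmid.le⟩
  rw [uIcc_of_ge hq.1.le] at hu
  have hub : b < u := by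
    refine lt_of_le_of_ne hu.1 ?_
    rintro rfl
    exact absurd (hnn _ hKm) (not_le.2 hmid)
  have hu1 : u < 1 := hu.2.trans_lt hq.2
  have hξ0 : 0 < ξ := hα.1.trans_le hξ.1
  have hξu : ξ < u := hξ.2.trans_lt hub
  refine ⟨u, ξ, hξ0, hξu, hu1, hz, ?_⟩
  have hall : ∀ y ∈ Ioo 0 u, 0 ≤ sqMean h y u := by
    intro y hy
    rcases le_or_gt y α with hyα | hyα
    · exact (E2 y ⟨hy.1, hyα⟩ u hub.le hu1).le
    rcases le_or_gt y b with hyb | hyb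
    · exact hnn y ⟨hyα.le, hyb⟩
    · exact (S.sqMean_pos_of_pos hy.1 hy.2 hu1 fun s hs =>
        S.pos_right s ⟨hyb.trans hs.1, hs.2.trans hu1⟩).le
  have hmin : IsLocalMin (fun ξ => sqMean h ξ u) ξ := by
    filter_upwards [isOpen_Ioo.mem_nhds (show ξ ∈ Ioo 0 u from ⟨hξ0, hξu⟩)] with y hy
    rw [hz]
    exact hall y hy
  have hdiff := S.diff u ⟨hξ0.trans hξu, hu1⟩ ξ ⟨hξ0, hξu.trans hu1⟩
  rw [← hmin.deriv_eq_zero]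
  exact hdiff.hasDerivAt

end Shape

/-! ### The leading edge -/

theorem continuousOn_half {h : ℝ → ℝ} (hh : ContinuousOn h (Ioo 0 1)) :
    ContinuousOn (Function.uncurry fun ξ u => ∫ s in u..ξ, h s * √(ξ - s))
      (Ioo 0 1 ×ˢ Ioo 0 1) := by
  rintro ⟨ξ, u⟩ ⟨hξ, hu⟩
  obtain ⟨p, q, hp, hpq, hq, n1, n2⟩ := exists_Icc_mem_nhds hξ hu
  obtain ⟨g, hg, hgh⟩ := exists_continuous_eqOn_Icc hpq (hh.mono (Icc_subset_Ioo hp hq))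
  have hgc : Continuous (Function.uncurry fun (z : ℝ × ℝ) (s : ℝ) => g s * √(z.1 - s)) := by
    unfold Function.uncurry; fun_prop
  have hc : Continuous fun z : ℝ × ℝ =>
      (∫ s in (0 : ℝ)..z.1, g s * √(z.1 - s)) - ∫ s in (0 : ℝ)..z.2, g s * √(z.1 - s) :=
    (intervalIntegral.continuous_parametric_intervalIntegral_of_continuous hgc continuous_fst).sub
      (intervalIntegral.continuous_parametric_intervalIntegral_of_continuous hgc continuous_snd)
  refine (hc.continuousAt.congr ?_).continuousWithinAt
  filter_upwards [prod_mem_nhds n1 n2] with z hz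
  have hi : ∀ y, IntervalIntegrable (fun s => g s * √(z.1 - s)) volume 0 y := fun y =>
    (by fun_prop : Continuous fun s => g s * √(z.1 - s)).intervalIntegrable _ _
  rw [intervalIntegral.integral_interval_sub_left (hi _) (hi _)]
  refine intervalIntegral.integral_congr fun s hs => ?_
  rw [hgh (uIcc_subset_Icc hz.2 hz.1 hs)]

namespace Shape

variable {H h : ℝ → ℝ} {a b : ℝ}

/-- The weighted primitive of `Φ₀(·,u)` as a half-integral of `h`. -/
theorem half_eq (S : Shape H h a b) {u ξ : ℝ} (hu : 0 < u) (huξ : u ≤ ξ) (hξ : ξ < 1) :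
    ∫ v in u..ξ, √(v - u) * sqMean h v u = ∫ s in u..ξ, h s * √(ξ - s) :=
  integral_sqrt_mul_of_abel huξ (S.cont.mono (Icc_subset_Ioo hu hξ)) fun _ hv =>
    sqMean_of_gt S.cont hu hv.1 (hv.2.trans hξ)

theorem continuousOn_sqMean_left (S : Shape H h a b) {u : ℝ} (hu : u ∈ Ioo (0 : ℝ) 1) :
    ContinuousOn (fun v => √(v - u) * sqMean h v u) (Ioo 0 1) :=
  ContinuousOn.mul (by fun_prop) ((continuousOn_sqMean S.cont).comp (f := fun v : ℝ => (v, u))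
    (by fun_prop) fun _ hv => ⟨hv, hu⟩)

theorem intervalIntegrable_sqMean (S : Shape H h a b) {u c d : ℝ} (hu : u ∈ Ioo (0 : ℝ) 1)
    (hc : 0 < c) (hcd : c ≤ d) (hd : d < 1) :
    IntervalIntegrable (fun v => √(v - u) * sqMean h v u) volume c d := by
  refine ContinuousOn.intervalIntegrable ?_
  rw [uIcc_of_le hcd]
  exact (S.continuousOn_sqMean_left hu).mono (Icc_subset_Ioo hc hd)

theorem half_sub (S : Shape H h a b) {u c d : ℝ} (hu : 0 < u) (huc : u ≤ c) (hcd : c ≤ d)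
    (hd : d < 1) :
    (∫ s in u..d, h s * √(d - s)) = (∫ s in u..c, h s * √(c - s)) +
      ∫ v in c..d, √(v - u) * sqMean h v u := by
  have hu1 : u ∈ Ioo (0 : ℝ) 1 := ⟨hu, by linarith⟩
  rw [← S.half_eq hu (huc.trans hcd) hd, ← S.half_eq hu huc (hcd.trans_lt hd),
    intervalIntegral.integral_add_adjacent_intervals
      (S.intervalIntegrable_sqMean hu1 hu huc (hcd.trans_lt hd))
      (S.intervalIntegrable_sqMean hu1 (hu.trans_le huc) hcd hd)]

theorem sqMean_integral_pos (S : Shape H h a b) {u c d : ℝ} (hu : 0 < u) (huc : u ≤ c)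
    (hcd : c < d) (hd : d < 1) (hpos : ∀ v ∈ Ioo c d, 0 < sqMean h v u) :
    0 < ∫ v in c..d, √(v - u) * sqMean h v u := by
  refine intervalIntegral.intervalIntegral_pos_of_pos_on
    (S.intervalIntegrable_sqMean ⟨hu, by linarith⟩ (hu.trans_le huc) hcd.le hd) (fun v hv => ?_) hcd
  exact mul_pos (Real.sqrt_pos.2 (by linarith [hv.1])) (hpos v hv)

/-- At a simultaneous zero of `Φ₀(·,u₃)` and of its weighted primitive, the point `u₃` lies to the
left of `a`. -/
theorem leading_lt (S : Shape H h a b) {u₁ u₃ : ℝ} (h3 : 0 < u₃) (h31 : u₃ < u₁) (h1 : u₁ < 1)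
    (h0 : sqMean h u₁ u₃ = 0) (hi : ∫ s in u₃..u₁, h s * √(u₁ - s) = 0) : u₃ < a := by
  have hg := (S.right_eq_zero_iff h3 h31 h1).1 h0
  have hint := intervalIntegrable_right S.cont h3 h31.le le_rfl h1
  by_contra hc
  rw [not_lt] at hc
  rcases le_or_gt b u₃ with hb | hb
  · have : 0 < ∫ s in u₃..u₁, h s * √(u₁ - s) := S.half_integral_pos h3 h31 le_rfl h1
      fun s hs => S.pos_right s ⟨hb.trans_lt hs.1, hs.2.trans h1⟩
    exact this.ne' hi
  rcases le_or_gt u₁ b with hb1 | hb1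
  · have := intervalIntegral_neg_of_neg_on hint (fun s hs => mul_neg_of_neg_of_pos
      (S.neg_mid s ⟨hc.trans_lt hs.1, hs.2.trans_le hb1⟩)
      (inv_pos.2 (Real.sqrt_pos.2 (sub_pos.2 hs.2)))) h31
    exact this.ne hg
  · -- `h` changes sign only at `b`, so `∫ h(s) (b - s) / √(u₁ - s) ds` is negative, while it is a
    -- combination of the two vanishing integrals
    have hF : ∀ {c d : ℝ}, u₃ ≤ c → c ≤ d → d ≤ u₁ → IntervalIntegrable
        (fun s => (b - s) * (h s * (√(u₁ - s))⁻¹)) volume c d := fun hc' hcd hd' =>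
      (intervalIntegrable_right S.cont (h3.trans_le hc') hcd hd' h1).continuousOn_mul
        (by fun_prop)
    have n1 : ∫ s in u₃..b, (b - s) * (h s * (√(u₁ - s))⁻¹) < 0 :=
      intervalIntegral_neg_of_neg_on (hF le_rfl hb.le hb1.le) (fun s hs =>
        mul_neg_of_pos_of_neg (sub_pos.2 hs.2) (mul_neg_of_neg_of_pos
          (S.neg_mid s ⟨hc.trans_lt hs.1, hs.2⟩)
          (inv_pos.2 (Real.sqrt_pos.2 (by linarith [hs.2]))))) hb
    have n2 : ∫ s in b..u₁, (b - s) * (h s * (√(u₁ - s))⁻¹) < 0 :=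
      intervalIntegral_neg_of_neg_on (hF hb.le hb1.le le_rfl) (fun s hs =>
        mul_neg_of_neg_of_pos (by linarith [hs.1]) (mul_pos
          (S.pos_right s ⟨hs.1, hs.2.trans h1⟩)
          (inv_pos.2 (Real.sqrt_pos.2 (sub_pos.2 hs.2))))) hb1
    have n3 := intervalIntegral.integral_add_adjacent_intervals (hF le_rfl hb.le hb1.le)
      (hF hb.le hb1.le le_rfl)
    have n4 : ∫ s in u₃..u₁, (b - s) * (h s * (√(u₁ - s))⁻¹) =
        (∫ s in u₃..u₁, h s * √(u₁ - s)) - (u₁ - b) * ∫ s in u₃..u₁, h s * (√(u₁ - s))⁻¹ := by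
      rw [← intervalIntegral.integral_const_mul, ← intervalIntegral.integral_sub
        (intervalIntegrable_half S.cont h3 h31.le h1) (hint.const_mul _)]
      refine intervalIntegral.integral_congr fun s hs => ?_
      rw [uIcc_of_le h31.le] at hs
      rcases hs.2.eq_or_lt with rfl | hlt
      · simp
      · have hp := Real.sqrt_pos.2 (sub_pos.2 hlt)
        have hsq := Real.sq_sqrt (sub_pos.2 hlt).le
        field_simp
        rw [hsq]; ring
    rw [n4, hi, hg] at n3
    linarith

/-- At the leading edge the weighted primitive of `Φ₀(·,u₃)` has no zero besides `u₁`: it starts at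
`0`, and by convexity `Φ₀(·,u₃)` is positive, negative, positive in turn, the second sign change
being at `u₁`. -/
theorem leading_props (S : Shape H h a b) {u₁ u₃ : ℝ} (h3 : 0 < u₃) (h31 : u₃ < u₁) (h1 : u₁ < 1)
    (h0 : sqMean h u₁ u₃ = 0) (hi : ∫ s in u₃..u₁, h s * √(u₁ - s) = 0) :
    ∀ ξ ∈ Ioo u₃ 1, ξ ≠ u₁ → 0 < ∫ s in u₃..ξ, h s * √(ξ - s) := by
  have ha := S.leading_lt h3 h31 h1 h0 hi
  have hconv := S.convex_left u₃ ⟨h3, ha⟩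
  have hm1 : u₁ ∈ Ico u₃ 1 := ⟨h31.le, h1⟩
  have hself : ∫ s in u₃..u₃, h s * √(u₃ - s) = 0 := by simp
  intro ξ hξ hne
  rcases lt_or_gt_of_ne hne with hlt | hlt
  · by_contra hc
    rw [not_lt] at hc
    obtain ⟨v, hv, hv0⟩ : ∃ v ∈ Ioo u₃ ξ, sqMean h v u₃ ≤ 0 := by
      by_contra! hcon
      have h2 := S.half_sub h3 le_rfl hξ.1.le hξ.2
      have := S.sqMean_integral_pos h3 le_rfl hξ.1 hξ.2 hcon
      linarith
    have hneg : ∫ v in ξ..u₁, √(v - u₃) * sqMean h v u₃ < 0 := by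
      refine intervalIntegral_neg_of_neg_on (S.intervalIntegrable_sqMean ⟨h3, h31.trans h1⟩
        (h3.trans hξ.1) hlt.le h1) (fun w hw => ?_) hlt
      refine mul_neg_of_pos_of_neg (Real.sqrt_pos.2 (by linarith [hw.1, hξ.1])) ?_
      exact neg_of_strictConvexOn hconv ⟨hv.1.le, hv.2.trans hξ.2⟩ hm1 (hv.2.trans hw.1) hw.2 hv0
        h0.le
    have h2 := S.half_sub h3 hξ.1.le hlt.le h1
    linarith
  · obtain ⟨v, hv, hv0⟩ : ∃ v ∈ Ioo u₃ u₁, sqMean h v u₃ ≤ 0 := by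
      by_contra! hcon
      have h2 := S.half_sub h3 le_rfl h31.le h1
      have := S.sqMean_integral_pos h3 le_rfl h31 h1 hcon
      linarith
    have hpos : ∀ w ∈ Ioo u₁ ξ, 0 < sqMean h w u₃ := by
      intro w hw
      by_contra hc
      have := neg_of_strictConvexOn hconv (x := v) (y := u₁) (z := w)
        ⟨hv.1.le, hv.2.trans h1⟩ ⟨(h31.trans hw.1).le, hw.2.trans hξ.2⟩ hv.2 hw.1 hv0 (not_lt.1 hc)
      exact this.ne h0
    have h2 := S.half_sub h3 h31.le hlt.le hξ.2
    have := S.sqMean_integral_pos h3 h31.le hlt hξ.2 hpos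
    linarith

/-- Positivity of the weighted primitive propagates to smaller `u`. -/
theorem half_pos_of_leading (S : Shape H h a b) {u₁ u₃ : ℝ} (h3 : 0 < u₃) (h31 : u₃ < u₁)
    (h1 : u₁ < 1) (h0 : sqMean h u₁ u₃ = 0) (hi : ∫ s in u₃..u₁, h s * √(u₁ - s) = 0)
    {u ξ : ℝ} (hu0 : 0 < u) (hu : u < u₃) (hξ : ξ ∈ Ioo u 1) :
    0 < ∫ s in u..ξ, h s * √(ξ - s) := by
  have ha := S.leading_lt h3 h31 h1 h0 hi
  rcases le_or_gt ξ u₃ with hle | hlt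
  · exact S.half_integral_pos hu0 hξ.1 le_rfl hξ.2 fun s hs =>
      S.pos_left s ⟨hu0.trans hs.1, hs.2.trans_le (hle.trans ha.le)⟩
  · have hnn : 0 ≤ ∫ s in u₃..ξ, h s * √(ξ - s) := by
      by_cases he : ξ = u₁
      · rw [he, hi]
      · exact (S.leading_props h3 h31 h1 h0 hi ξ ⟨hlt, hξ.2⟩ he).le
    rw [← intervalIntegral.integral_add_adjacent_intervals
      (intervalIntegrable_half S.cont hu0 hu.le (hlt.trans hξ.2))
      (intervalIntegrable_half S.cont h3 hlt.le hξ.2)]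
    have := S.half_integral_pos hu0 hu hlt.le hξ.2 fun s hs =>
      S.pos_left s ⟨hu0.trans hs.1, hs.2.trans ha⟩
    linarith

theorem leading_unique (S : Shape H h a b) {u₁ u₃ v₁ v₃ : ℝ} (h3 : 0 < u₃) (h31 : u₃ < u₁)
    (h1 : u₁ < 1) (h0 : sqMean h u₁ u₃ = 0) (hi : ∫ s in u₃..u₁, h s * √(u₁ - s) = 0)
    (k3 : 0 < v₃) (k31 : v₃ < v₁) (k1 : v₁ < 1) (k0 : sqMean h v₁ v₃ = 0)
    (ki : ∫ s in v₃..v₁, h s * √(v₁ - s) = 0) : u₁ = v₁ ∧ u₃ = v₃ := by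
  rcases lt_trichotomy u₃ v₃ with hlt | rfl | hlt
  · exact absurd hi (S.half_pos_of_leading k3 k31 k1 k0 ki h3 hlt ⟨h31, h1⟩).ne'
  · refine ⟨?_, rfl⟩
    by_contra hne
    exact absurd hi (S.leading_props k3 k31 k1 k0 ki u₁ ⟨h31, h1⟩ hne).ne'
  · exact absurd ki (S.half_pos_of_leading h3 h31 h1 h0 hi k3 hlt ⟨k31, k1⟩).ne'

/-- Raising `u` from near `0` to `a`, the weighted primitive of `Φ₀(·,u)` stops being positive;
where it first touches zero, it does so at an interior minimum, a zero of `Φ₀(·,u)`. -/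
theorem exists_leading (S : Shape H h a b) : ∃ u₁ u₃, 0 < u₃ ∧ u₃ < u₁ ∧ u₁ < 1 ∧
    sqMean h u₁ u₃ = 0 ∧ ∫ s in u₃..u₁, h s * √(u₁ - s) = 0 := by
  have ha := S.a_pos
  have hab := S.a_lt
  have hb := S.b_lt
  have hb0 := S.b_pos
  have ha1 := S.a_lt_one
  obtain ⟨C, hC0, hC⟩ := S.exists_lower_bound
  -- near `ξ = 1` the function `Φ₀(·,u)` is positive for all `u ≤ a`
  obtain ⟨c, hc, hcH⟩ : ∃ c ∈ Ioo b 1, ∀ ξ ∈ Ico c 1, H b + 2 * C < H ξ := by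
    obtain ⟨e, he, he'⟩ := mem_nhdsLT_iff_exists_Ioo_subset.1
      (S.H_one.eventually_gt_atTop (H b + 2 * C))
    have he1 : e < (1 : ℝ) := he
    have hm := max_lt he1 hb
    have hm1 : e ≤ max e b := le_max_left _ _
    have hm2 : b ≤ max e b := le_max_right _ _
    exact ⟨(max e b + 1) / 2, ⟨by linarith, by linarith⟩,
      fun ξ hξ => he' ⟨by linarith [hξ.1], hξ.2⟩⟩
  have E1 : ∀ ξ ∈ Ico c 1, ∀ u ∈ Ioc 0 a, 0 < sqMean h ξ u := by
    intro ξ hξ u hu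
    have hbξ : b < ξ := hc.1.trans_le hξ.1
    rw [S.right_pos_iff hu.1 (by linarith [hu.2]) hξ.2,
      ← intervalIntegral.integral_add_adjacent_intervals
        (intervalIntegrable_right S.cont hu.1 (hu.2.trans hab.le) hbξ.le hξ.2)
        (intervalIntegrable_right S.cont hb0 hbξ.le le_rfl hξ.2),
      ← intervalIntegral.integral_add_adjacent_intervals
        (intervalIntegrable_right S.cont hu.1 hu.2 (hab.trans hbξ).le hξ.2)
        (intervalIntegrable_right S.cont ha hab.le hbξ.le hξ.2)]
    have i1 := S.right_integral_ge hC0 hC ha hab.le hbξ.le hξ.2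
    have i2 := S.sub_le_integral_mul (κ := 1) hb0 hbξ.le hξ.2
      (fun s hs => S.pos_right s ⟨hs.1, hs.2.trans hξ.2⟩)
      (w := fun s => (√(ξ - s))⁻¹) (fun s hs => by
        refine one_le_inv_iff₀.2 ⟨Real.sqrt_pos.2 (by linarith [hs.2]), ?_⟩
        exact Real.sqrt_le_one.2 (by linarith [hs.1, hξ.2]))
      (intervalIntegrable_right S.cont hb0 hbξ.le le_rfl hξ.2)
    have i3 : 0 ≤ ∫ s in u..a, h s * (√(ξ - s))⁻¹ :=
      intervalIntegral_nonneg_of_pos_on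
        (intervalIntegrable_right S.cont hu.1 hu.2 (hab.trans hbξ).le hξ.2)
        (fun s hs => mul_pos (S.pos_left s ⟨hu.1.trans hs.1, hs.2⟩)
          (inv_pos.2 (Real.sqrt_pos.2 (by linarith [hs.2])))) hu.2
    have := hcH ξ hξ
    linarith
  set β := (c + 1) / 2 with hβ
  have hcβ : c < β := by linarith [hc.2]
  have hβ1 : β < 1 := by linarith [hc.2]
  -- for `u = p` near `0` the weighted primitive is positive on all of `[a, β]`
  have hsq : 0 < √(a / 2) := Real.sqrt_pos.2 (by linarith)
  obtain ⟨p, hp, hpH⟩ : ∃ p ∈ Ioo 0 (a / 2), H p < H (a / 2) - C / √(a / 2) := by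
    have e2 : ∀ᶠ s in 𝓝[>] (0 : ℝ), s ∈ Ioo 0 (a / 2) := Ioo_mem_nhdsGT (by linarith)
    obtain ⟨p, h1, h2⟩ := ((S.H_zero.eventually_lt_atBot (H (a / 2) - C / √(a / 2))).and e2).exists
    exact ⟨p, h2, h1⟩
  have hpa : p < a := by linarith [hp.2]
  have E2 : ∀ ξ ∈ Icc a β, 0 < ∫ s in p..ξ, h s * √(ξ - s) := by
    intro ξ hξ
    have hξ1 : ξ < 1 := hξ.2.trans_lt hβ1
    have ha2 : 0 < a / 2 := by linarith
    rw [← intervalIntegral.integral_add_adjacent_intervals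
        (intervalIntegrable_half S.cont hp.1 hpa.le ha1)
        (intervalIntegrable_half S.cont ha hξ.1 hξ1),
      ← intervalIntegral.integral_add_adjacent_intervals
        (intervalIntegrable_half S.cont hp.1 hp.2.le (by linarith))
        (intervalIntegrable_half S.cont ha2 (by linarith) ha1)]
    have i1 := S.sub_le_integral_mul (κ := √(a / 2)) hp.1 hp.2.le (by linarith)
      (fun s hs => S.pos_left s ⟨hp.1.trans hs.1, by linarith [hs.2]⟩)
      (w := fun s => √(ξ - s)) (fun s hs => Real.sqrt_le_sqrt (by linarith [hs.2, hξ.1]))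
      (intervalIntegrable_half S.cont hp.1 hp.2.le (by linarith))
    have i2 : 0 < ∫ s in (a / 2)..a, h s * √(ξ - s) :=
      S.half_integral_pos ha2 (by linarith) hξ.1 hξ1 fun s hs =>
        S.pos_left s ⟨ha2.trans hs.1, hs.2⟩
    have i3 : -C ≤ ∫ s in a..ξ, h s * √(ξ - s) := by
      have h1 : ∫ s in a..ξ, -C ≤ ∫ s in a..ξ, h s * √(ξ - s) := by
        refine intervalIntegral.integral_mono_on hξ.1 (by simp)
          (intervalIntegrable_half S.cont ha hξ.1 hξ1) fun s hs => ?_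
        have e1 := hC s ⟨by linarith [hs.1], by linarith [hs.2]⟩
        have e2 := Real.sqrt_nonneg (ξ - s)
        have e3 : √(ξ - s) ≤ 1 := Real.sqrt_le_one.2 (by linarith [hs.1])
        nlinarith
      rw [intervalIntegral.integral_const, smul_eq_mul] at h1
      nlinarith
    have i4 : C < √(a / 2) * (H (a / 2) - H p) := by
      have : C / √(a / 2) < H (a / 2) - H p := by linarith
      rw [div_lt_iff₀ hsq] at this
      linarith
    linarith
  have hmid : ∫ s in a..b, h s * √(b - s) < 0 :=
    intervalIntegral_neg_of_neg_on (intervalIntegrable_half S.cont ha hab.le hb)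
      (fun s hs => mul_neg_of_neg_of_pos (S.neg_mid s hs) (Real.sqrt_pos.2 (sub_pos.2 hs.2))) hab
  have hKb : b ∈ Icc a β := ⟨hab.le, (hc.1.trans hcβ).le⟩
  obtain ⟨u, hu, ξ, hξ, hz, hnn⟩ := exists_touching
    (F := fun ξ u => ∫ s in u..ξ, h s * √(ξ - s)) (α := a) (β := β) (p := p) (q := a)
    ((continuousOn_half S.cont).mono (by
      rw [uIcc_of_le hpa.le]
      exact prod_mono (Icc_subset_Ioo ha hβ1) (Icc_subset_Ioo hp.1 ha1)))
    E2 ⟨b, hKb, hmid.le⟩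
  rw [uIcc_of_le hpa.le] at hu
  have hu0 : 0 < u := hp.1.trans_le hu.1
  have hua : u < a := by
    refine lt_of_le_of_ne hu.2 ?_
    rintro rfl
    exact absurd (hnn b hKb) (not_le.2 hmid)
  have hu1 : u ∈ Ioo (0 : ℝ) 1 := ⟨hu0, hua.trans ha1⟩
  have haξ : a < ξ := by
    refine lt_of_le_of_ne hξ.1 ?_
    rintro rfl
    have : 0 < ∫ s in u..a, h s * √(a - s) := S.half_integral_pos hu0 hua le_rfl ha1
      fun s hs => S.pos_left s ⟨hu0.trans hs.1, hs.2⟩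
    exact this.ne' hz
  -- beyond `c` the primitive is strictly increasing, so it cannot touch zero first at `β`
  have hξβ : ξ < β := by
    refine lt_of_le_of_ne hξ.2 ?_
    intro he
    rw [he] at hz
    have h2 := S.half_sub hu0 (by linarith [hc.1] : u ≤ c) hcβ.le hβ1
    have h3 := S.sqMean_integral_pos hu0 (by linarith [hc.1] : u ≤ c) hcβ hβ1
      fun v hv => E1 v ⟨hv.1.le, hv.2.trans hβ1⟩ u ⟨hu0, hua.le⟩
    have h4 := hnn c ⟨(hab.trans hc.1).le, hcβ.le⟩
    linarith
  have hξ1 : ξ < 1 := hξβ.trans hβ1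
  have huξ : u < ξ := hua.trans haξ
  refine ⟨ξ, u, hu0, huξ, hξ1, ?_, hz⟩
  -- the touching point is an interior minimum of the primitive
  have hmin : IsLocalMin (fun y => ∫ v in u..y, √(v - u) * sqMean h v u) ξ := by
    filter_upwards [isOpen_Ioo.mem_nhds (show ξ ∈ Ioo a β from ⟨haξ, hξβ⟩)] with y hy
    rw [S.half_eq hu0 huξ.le hξ1, S.half_eq hu0 (hua.trans hy.1).le (hy.2.trans hβ1)]
    have h1 := hnn y ⟨hy.1.le, hy.2.le⟩
    rw [hz]; exact h1
  have hcont := S.continuousOn_sqMean_left hu1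
  have hξmem : Ioo (0 : ℝ) 1 ∈ 𝓝 ξ := isOpen_Ioo.mem_nhds ⟨hu0.trans huξ, hξ1⟩
  have hder := intervalIntegral.integral_hasDerivAt_right
    (S.intervalIntegrable_sqMean hu1 hu0 huξ.le hξ1)
    (hcont.stronglyMeasurableAtFilter isOpen_Ioo ξ ⟨hu0.trans huξ, hξ1⟩)
    (hcont.continuousAt hξmem)
  have h0 := hmin.hasDerivAt_eq_zero hder
  exact (mul_eq_zero.1 h0).resolve_left (Real.sqrt_pos.2 (sub_pos.2 huξ)).ne'

end Shape

/-! ### The edges in terms of square means -/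

theorem hodograph_eq_add (f : ℝ → ℝ) (x t s : ℝ) :
    hodograph f x t s = hodograph f 0 t s + x := by
  unfold hodograph; ring

theorem deriv_hodograph_eq (f : ℝ → ℝ) (x t : ℝ) :
    deriv (hodograph f x t) = deriv (hodograph f 0 t) := by
  have h1 : hodograph f x t = fun s => hodograph f 0 t s + x :=
    funext fun s => hodograph_eq_add f x t s
  funext s
  rw [h1, deriv_add_const]

namespace InitialData

variable {u₀ f : ℝ → ℝ}

/-- Since `H'` does not involve `x`, neither does `Φ₀`. -/
theorem phi0_eq_sqMean (h : InitialData u₀ f) (x t : ℝ) {ξ u : ℝ} (hξ : ξ ∈ Ioo (0 : ℝ) 1)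
    (hu : u ∈ Ioo (0 : ℝ) 1) : phi0 f x t ξ u = sqMean (deriv (hodograph f 0 t)) ξ u := by
  rw [← mu_form_eq_sqMean (h.continuousOn_deriv_hodograph 0 t) hξ hu, phi0, deriv_hodograph_eq]

theorem integral_sqrt_mul_phi0 (h : InitialData u₀ f) (x t : ℝ) {u ξ : ℝ} (hu : 0 < u)
    (huξ : u ≤ ξ) (hξ : ξ < 1) :
    ∫ v in u..ξ, √(v - u) * phi0 f x t v u =
      ∫ s in u..ξ, deriv (hodograph f 0 t) s * √(ξ - s) := by
  rw [FifthKdV.integral_sqrt_mul_phi0 huξ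
    ((h.continuousOn_deriv_hodograph x t).mono (Icc_subset_Ioo hu hξ)), deriv_hodograph_eq]

theorem isTrailingEdge_iff (h : InitialData u₀ f) (t u₁ u₃ x : ℝ) :
    IsTrailingEdge f t u₁ u₃ x ↔ 0 < u₃ ∧ u₃ < u₁ ∧ u₁ < 1 ∧
      sqMean (deriv (hodograph f 0 t)) u₃ u₁ = 0 ∧
      HasDerivAt (fun ξ => sqMean (deriv (hodograph f 0 t)) ξ u₁) 0 u₃ ∧
      x = -hodograph f 0 t u₁ := by
  refine and_congr_right fun h3 => and_congr_right fun h31 => and_congr_right fun h1 => ?_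
  have hu3 : u₃ ∈ Ioo (0 : ℝ) 1 := ⟨h3, h31.trans h1⟩
  have hu1 : u₁ ∈ Ioo (0 : ℝ) 1 := ⟨h3.trans h31, h1⟩
  have hev : (fun ξ => phi0 f x t ξ u₁) =ᶠ[𝓝 u₃]
      fun ξ => sqMean (deriv (hodograph f 0 t)) ξ u₁ := by
    filter_upwards [isOpen_Ioo.mem_nhds hu3] with ξ hξ using h.phi0_eq_sqMean x t hξ hu1
  rw [h.phi0_eq_sqMean x t hu3 hu1, hev.hasDerivAt_iff, hodograph_eq_add f x,
    eq_neg_iff_add_eq_zero, add_comm x]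

theorem isLeadingEdge_iff (h : InitialData u₀ f) (t u₁ u₃ x : ℝ) :
    IsLeadingEdge f t u₁ u₃ x ↔ 0 < u₃ ∧ u₃ < u₁ ∧ u₁ < 1 ∧
      sqMean (deriv (hodograph f 0 t)) u₁ u₃ = 0 ∧
      ∫ s in u₃..u₁, deriv (hodograph f 0 t) s * √(u₁ - s) = 0 ∧
      x = -hodograph f 0 t u₃ := by
  refine and_congr_right fun h3 => and_congr_right fun h31 => and_congr_right fun h1 => ?_
  have hu3 : u₃ ∈ Ioo (0 : ℝ) 1 := ⟨h3, h31.trans h1⟩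
  have hu1 : u₁ ∈ Ioo (0 : ℝ) 1 := ⟨h3.trans h31, h1⟩
  rw [h.phi0_eq_sqMean x t hu1 hu3, ← h.integral_sqrt_mul_phi0 x t h3 h31.le h1,
    hodograph_eq_add f x, eq_neg_iff_add_eq_zero, add_comm x]
  simp only [mul_comm]

end InitialData

/-! ### Roots of the hodograph equation beyond the edges -/

namespace Shape

variable {H h : ℝ → ℝ} {a b : ℝ}

theorem continuousOn (S : Shape H h a b) : ContinuousOn H (Ioo 0 1) := fun s hs =>
  (S.deriv s hs).continuousAt.continuousWithinAt

theorem exists_root_ge (S : Shape H h a b) {u₁ x : ℝ} (h0 : 0 < u₁) (h1 : u₁ < 1)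
    (hx : x ≤ -H u₁) : ∃ u ∈ Ico u₁ 1, H u + x = 0 := by
  obtain ⟨q, hq, hq1⟩ := ((S.H_one.eventually_ge_atTop (-x)).and (Ioo_mem_nhdsLT h1)).exists
  obtain ⟨u, hu, hux⟩ := intermediate_value_Icc hq1.1.le
    (S.continuousOn.mono (Icc_subset_Ioo h0 hq1.2)) ⟨by linarith, hq⟩
  exact ⟨u, ⟨hu.1, hu.2.trans_lt hq1.2⟩, by linarith⟩

theorem exists_root_le (S : Shape H h a b) {u₃ x : ℝ} (h0 : 0 < u₃) (h1 : u₃ < 1)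
    (hx : -H u₃ ≤ x) : ∃ u ∈ Ioc 0 u₃, H u + x = 0 := by
  obtain ⟨p, hp, hp1⟩ := ((S.H_zero.eventually_le_atBot (-x)).and (Ioo_mem_nhdsGT h0)).exists
  obtain ⟨u, hu, hux⟩ := intermediate_value_Icc hp1.2.le
    (S.continuousOn.mono (Icc_subset_Ioo hp1.1 h1)) ⟨hp, by linarith⟩
  exact ⟨u, ⟨hp1.1.trans_le hu.1, hu.2⟩, by linarith⟩

theorem strictMonoOn_left (S : Shape H h a b) : StrictMonoOn H (Ioc 0 a) := by
  refine strictMonoOn_of_deriv_pos (convex_Ioc 0 a)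
    (S.continuousOn.mono fun s hs => ⟨hs.1, hs.2.trans_lt S.a_lt_one⟩) fun s hs => ?_
  rw [interior_Ioc] at hs
  rw [(S.deriv s ⟨hs.1, hs.2.trans S.a_lt_one⟩).deriv]
  exact S.pos_left s hs

end Shape

/-! ### The support of the minimizer -/

/-- The zeros of `Φ₀(·, u)` do not shrink the support as long as there is at most one. -/
theorem tsupport_psi {f : ℝ → ℝ} {x t u c : ℝ} (hu : 0 < u) (hu1 : u ≤ 1)
    (hne : ∀ ξ ∈ Ioo 0 u, ξ ≠ c → phi0 f x t ξ u ≠ 0) :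
    tsupport (psi f x t u) = Icc 0 (√u) := by
  have hs : 0 < √u := Real.sqrt_pos.2 hu
  refine Subset.antisymm (closure_minimal (fun η hη => ?_) isClosed_Icc) ?_
  · by_contra hc
    exact hη (psi_eq_zero fun h => hc (Ioo_subset_Icc_self h))
  · have hd : Dense ({√c}ᶜ : Set ℝ) := dense_compl_singleton _
    rw [← closure_Ioo hs.ne]
    refine closure_minimal ((hd.open_subset_closure_inter isOpen_Ioo).trans
      (closure_mono fun η hη => ?_)) isClosed_closure
    obtain ⟨hη, hηc⟩ := hη
    have h2 : η ^ 2 < u := (Real.lt_sqrt hη.1.le).1 hη.2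
    have h3 := Real.sqrt_pos.2 (sub_pos.2 h2)
    have h4 := hne (η ^ 2) ⟨pow_pos hη.1 2, h2⟩ fun h => hηc (by
      rw [mem_singleton_iff, ← h, Real.sqrt_sq hη.1.le])
    rw [Function.mem_support, psi_eq_of_mem hu1 hη]
    exact mul_ne_zero (mul_ne_zero (by linarith [hη.1]) h3.ne') h4

/-! ### One interval beyond the edges -/

section Edges

variable {u₀ f : ℝ → ℝ} {t a b u₁ u₃ : ℝ}

/-- At the trailing edge and for roots `u` of the hodograph equation to its right, both inequalities
hold, strictly except at `ξ = u₃` for `u = u₁`. -/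
theorem InitialData.oneInterval_of_trailing (h : InitialData u₀ f)
    (S : Shape (hodograph f 0 t) (deriv (hodograph f 0 t)) a b)
    (h3 : 0 < u₃) (h31 : u₃ < u₁) (h1 : u₁ < 1)
    (h0 : sqMean (deriv (hodograph f 0 t)) u₃ u₁ = 0)
    (hd : HasDerivAt (fun ξ => sqMean (deriv (hodograph f 0 t)) ξ u₁) 0 u₃)
    {x u : ℝ} (hu : u₁ ≤ u) (hu1 : u < 1) (hod : hodograph f 0 t u + x = 0) :
    OneInterval u₀ f x t u ∧
      (∀ ξ ∈ Ioo 0 u, ¬(u = u₁ ∧ ξ = u₃) → 0 < phi0 f x t ξ u) ∧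
      ∀ ξ ∈ Ioo u 1, 0 < ∫ v in u..ξ, √(v - u) * phi0 f x t v u := by
  obtain ⟨hb, hpos⟩ := S.trailing_props h3 h31 h1 h0 hd
  have hu0 : 0 < u := (h3.trans h31).trans_le hu
  have hum : u ∈ Ioo (0 : ℝ) 1 := ⟨hu0, hu1⟩
  have hl : ∀ ξ ∈ Ioo 0 u, ¬(u = u₁ ∧ ξ = u₃) → 0 < phi0 f x t ξ u := fun ξ hξ hne => by
    rw [h.phi0_eq_sqMean x t ⟨hξ.1, hξ.2.trans hu1⟩ hum]
    rcases hu.eq_or_lt with rfl | hlt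
    · exact hpos ξ hξ fun hc => hne ⟨rfl, hc⟩
    · exact S.sqMean_pos_of_trailing h3 h31 h1 h0 hd hlt hu1 hξ
  have hr : ∀ ξ ∈ Ioo u 1, 0 < ∫ v in u..ξ, √(v - u) * phi0 f x t v u := fun ξ hξ => by
    rw [h.integral_sqrt_mul_phi0 x t hu0 hξ.1.le hξ.2]
    exact S.half_integral_pos hu0 hξ.1 le_rfl hξ.2 fun s hs =>
      S.pos_right s ⟨(hb.trans_le hu).trans hs.1, hs.2.trans hξ.2⟩
  refine ⟨⟨h, hum, by rw [hodograph_eq_add, hod], fun ξ hξ => ?_, fun ξ hξ => (hr ξ hξ).le⟩, hl, hr⟩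
  by_cases hc : u = u₁ ∧ ξ = u₃
  · obtain ⟨rfl, rfl⟩ := hc
    rw [h.phi0_eq_sqMean x t ⟨hξ.1, hξ.2.trans hu1⟩ hum, h0]
  · exact (hl ξ hξ hc).le

/-- At the leading edge and for roots `u` of the hodograph equation to its left, both inequalities
hold, strictly except at `ξ = u₁` for `u = u₃`. -/
theorem InitialData.oneInterval_of_leading (h : InitialData u₀ f)
    (S : Shape (hodograph f 0 t) (deriv (hodograph f 0 t)) a b)
    (h3 : 0 < u₃) (h31 : u₃ < u₁) (h1 : u₁ < 1)
    (h0 : sqMean (deriv (hodograph f 0 t)) u₁ u₃ = 0)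
    (hi : ∫ s in u₃..u₁, deriv (hodograph f 0 t) s * √(u₁ - s) = 0)
    {x u : ℝ} (hu0 : 0 < u) (hu : u ≤ u₃) (hod : hodograph f 0 t u + x = 0) :
    OneInterval u₀ f x t u ∧
      (∀ ξ ∈ Ioo 0 u, 0 < phi0 f x t ξ u) ∧
      ∀ ξ ∈ Ioo u 1, ¬(u = u₃ ∧ ξ = u₁) → 0 < ∫ v in u..ξ, √(v - u) * phi0 f x t v u := by
  have ha := S.leading_lt h3 h31 h1 h0 hi
  have hu1 : u < 1 := hu.trans_lt (h31.trans h1)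
  have hum : u ∈ Ioo (0 : ℝ) 1 := ⟨hu0, hu1⟩
  have hl : ∀ ξ ∈ Ioo 0 u, 0 < phi0 f x t ξ u := fun ξ hξ => by
    rw [h.phi0_eq_sqMean x t ⟨hξ.1, hξ.2.trans hu1⟩ hum]
    exact S.sqMean_pos_of_pos hξ.1 hξ.2 hu1 fun s hs =>
      S.pos_left s ⟨hξ.1.trans hs.1, (hs.2.trans_le hu).trans ha⟩
  have hr : ∀ ξ ∈ Ioo u 1, ¬(u = u₃ ∧ ξ = u₁) →
      0 < ∫ v in u..ξ, √(v - u) * phi0 f x t v u := fun ξ hξ hne => by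
    rw [h.integral_sqrt_mul_phi0 x t hu0 hξ.1.le hξ.2]
    rcases hu.eq_or_lt with rfl | hlt
    · exact S.leading_props h3 h31 h1 h0 hi ξ hξ fun hc => hne ⟨rfl, hc⟩
    · exact S.half_pos_of_leading h3 h31 h1 h0 hi hu0 hlt hξ
  refine ⟨⟨h, hum, by rw [hodograph_eq_add, hod], fun ξ hξ => (hl ξ hξ).le, fun ξ hξ => ?_⟩, hl, hr⟩
  by_cases hc : u = u₃ ∧ ξ = u₁
  · obtain ⟨rfl, rfl⟩ := hc
    rw [h.integral_sqrt_mul_phi0 x t hu0 hξ.1.le hξ.2, hi]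
  · exact (hr ξ hξ hc).le

end Edges

end FifthKdV

end

theorem theorem5p1 (u₀ f : ℝ → ℝ) (h : FifthKdV.InitialData u₀ f) :
    ∃ Tm Tp : ℝ, 0 < Tm ∧ 0 < Tp ∧
    ∃ um₁ um₃ xm up₁ up₃ xp : ℝ → ℝ,
      -- for `t > T⁻` the trailing edge equations have exactly one solution
      (∀ t > Tm, ∀ u₁ u₃ x : ℝ, FifthKdV.IsTrailingEdge f t u₁ u₃ x ↔
        u₁ = um₁ t ∧ u₃ = um₃ t ∧ x = xm t) ∧
      -- for `t > T⁺` the leading edge equations have exactly one solution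
      (∀ t > Tp, ∀ u₁ u₃ x : ℝ, FifthKdV.IsLeadingEdge f t u₁ u₃ x ↔
        u₁ = up₁ t ∧ u₃ = up₃ t ∧ x = xp t) ∧
      ∀ t > max Tm Tp, ∀ x : ℝ, (x ≤ xm t ∨ xp t ≤ x) →
        ∃ u : ℝ, 0 < u ∧ u < 1 ∧
          (x ≤ xm t → um₁ t ≤ u) ∧ (xp t ≤ x → u ≤ up₃ t) ∧
          FifthKdV.hodograph f x t u = 0 ∧
          -- the variational inequalities, strict but for one point at the edges themselves
          (∀ ξ : ℝ, 0 < ξ → ξ < u → ¬ (x = xm t ∧ ξ = um₃ t) →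
            FifthKdV.reIR ξ u * FifthKdV.phi0 f x t ξ u < 0) ∧
          (∀ ξ : ℝ, u < ξ → ξ < 1 → ¬ (x = xp t ∧ ξ = up₁ t) →
            0 < ∫ v in u..ξ, √(v - u) * FifthKdV.phi0 f x t v u) ∧
          -- the minimizer, unique up to null sets, and its support
          FifthKdV.IsMinimizer u₀ f x t (FifthKdV.psi f x t u) ∧
          (∀ φ : ℝ → ℝ, FifthKdV.IsMinimizer u₀ f x t φ →
            ∀ᵐ η ∂(MeasureTheory.volume.restrict (Set.Ioo (0 : ℝ) 1)),
              φ η = FifthKdV.psi f x t u η) ∧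
          tsupport (FifthKdV.psi f x t u) = Set.Icc 0 (√u) := by
  obtain ⟨T, hT, hS⟩ := h.exists_shape
  have hm : ∀ t, ∃ u₁ u₃ : ℝ, t > T → 0 < u₃ ∧ u₃ < u₁ ∧ u₁ < 1 ∧
      FifthKdV.sqMean (deriv (FifthKdV.hodograph f 0 t)) u₃ u₁ = 0 ∧
      HasDerivAt (fun ξ => FifthKdV.sqMean (deriv (FifthKdV.hodograph f 0 t)) ξ u₁) 0 u₃ := by
    intro t
    by_cases ht : t > T
    · obtain ⟨a, b, S⟩ := hS t ht
      obtain ⟨u₁, u₃, H⟩ := S.exists_trailing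
      exact ⟨u₁, u₃, fun _ => H⟩
    · exact ⟨0, 0, fun h => absurd h ht⟩
  have hp : ∀ t, ∃ u₁ u₃ : ℝ, t > T → 0 < u₃ ∧ u₃ < u₁ ∧ u₁ < 1 ∧
      FifthKdV.sqMean (deriv (FifthKdV.hodograph f 0 t)) u₁ u₃ = 0 ∧
      ∫ s in u₃..u₁, deriv (FifthKdV.hodograph f 0 t) s * √(u₁ - s) = 0 := by
    intro t
    by_cases ht : t > T
    · obtain ⟨a, b, S⟩ := hS t ht
      obtain ⟨u₁, u₃, H⟩ := S.exists_leading
      exact ⟨u₁, u₃, fun _ => H⟩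
    · exact ⟨0, 0, fun h => absurd h ht⟩
  choose um₁ um₃ hm using hm
  choose up₁ up₃ hp using hp
  refine ⟨T, T, hT, hT, um₁, um₃, fun t => -FifthKdV.hodograph f 0 t (um₁ t), up₁, up₃,
    fun t => -FifthKdV.hodograph f 0 t (up₃ t), fun t ht u₁ u₃ x => ?_, fun t ht u₁ u₃ x => ?_,
    fun t ht x hx => ?_⟩
  · obtain ⟨a, b, S⟩ := hS t ht
    obtain ⟨k3, k31, k1, k0, kd⟩ := hm t ht
    rw [h.isTrailingEdge_iff]
    constructor
    · rintro ⟨h3, h31, h1, h0, hd, rfl⟩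
      obtain ⟨rfl, rfl⟩ := S.trailing_unique h3 h31 h1 h0 hd k3 k31 k1 k0 kd
      exact ⟨rfl, rfl, rfl⟩
    · rintro ⟨rfl, rfl, rfl⟩
      exact ⟨k3, k31, k1, k0, kd, rfl⟩
  · obtain ⟨a, b, S⟩ := hS t ht
    obtain ⟨k3, k31, k1, k0, ki⟩ := hp t ht
    rw [h.isLeadingEdge_iff]
    constructor
    · rintro ⟨h3, h31, h1, h0, hi, rfl⟩
      obtain ⟨rfl, rfl⟩ := S.leading_unique h3 h31 h1 h0 hi k3 k31 k1 k0 ki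
      exact ⟨rfl, rfl, rfl⟩
    · rintro ⟨rfl, rfl, rfl⟩
      exact ⟨k3, k31, k1, k0, ki, rfl⟩
  rw [max_self] at ht
  obtain ⟨a, b, S⟩ := hS t ht
  obtain ⟨m3, m31, m1, m0, md⟩ := hm t ht
  obtain ⟨p3, p31, p1, p0, pi⟩ := hp t ht
  have hm01 : um₁ t ∈ Set.Ioo (0 : ℝ) 1 := ⟨m3.trans m31, m1⟩
  have hp01 : up₃ t ∈ Set.Ioo (0 : ℝ) 1 := ⟨p3, p31.trans p1⟩
  -- The edges are ordered: at the local maximum `a` of `H` the hodograph function is `≤ 0` for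
  -- `x = xm`, as the minimizer there is nonnegative, and `> 0` for `x = xp`.
  have hlt : -FifthKdV.hodograph f 0 t (um₁ t) < -FifthKdV.hodograph f 0 t (up₃ t) := by
    have d := (h.oneInterval_of_trailing S m3 m31 m1 m0 md le_rfl m1 (add_neg_cancel _)).1
    have hb := (S.trailing_props m3 m31 m1 m0 md).1
    have ha := S.leading_lt p3 p31 p1 p0 pi
    have e1 := d.hodograph_nonpos ⟨S.a_pos, S.a_lt.trans hb⟩
    have e2 := S.strictMonoOn_left ⟨p3, ha.le⟩ ⟨S.a_pos, le_rfl⟩ ha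
    rw [FifthKdV.hodograph_eq_add] at e1
    linarith
  have hre : ∀ {u ξ : ℝ}, ξ < u → 0 < FifthKdV.phi0 f x t ξ u →
      FifthKdV.reIR ξ u * FifthKdV.phi0 f x t ξ u < 0 := fun hξ hpos =>
    mul_neg_of_neg_of_pos (neg_lt_zero.2 (Real.sqrt_pos.2 (sub_pos.2 hξ))) hpos
  rcases hx with hx | hx
  · obtain ⟨u, hu, hod⟩ := S.exists_root_ge hm01.1 m1 hx
    obtain ⟨d, hl, hr⟩ := h.oneInterval_of_trailing S m3 m31 m1 m0 md hu.1 hu.2 hod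
    refine ⟨u, d.mem.1, d.mem.2, fun _ => hu.1, fun hc => absurd (hx.trans_lt hlt) (not_lt.2 hc),
      d.hod, fun ξ h0 hξ hne => hre hξ (hl ξ ⟨h0, hξ⟩ ?_), fun ξ hξ h1 _ => hr ξ ⟨hξ, h1⟩,
      d.isMinimizer_psi, fun φ hφ => d.eq_psi_of_isMinimizer hφ,
      FifthKdV.tsupport_psi (c := um₃ t) d.mem.1 d.mem.2.le
        fun ξ hξ hne => (hl ξ hξ fun hc => hne hc.2).ne'⟩
    rintro ⟨rfl, rfl⟩
    exact hne ⟨by linarith, rfl⟩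
  · obtain ⟨u, hu, hod⟩ := S.exists_root_le p3 hp01.2 hx
    obtain ⟨d, hl, hr⟩ := h.oneInterval_of_leading S p3 p31 p1 p0 pi hu.1 hu.2 hod
    refine ⟨u, d.mem.1, d.mem.2, fun hc => absurd (hc.trans_lt hlt) (not_lt.2 hx), fun _ => hu.2,
      d.hod, fun ξ h0 hξ _ => hre hξ (hl ξ ⟨h0, hξ⟩), fun ξ hξ h1 hne => hr ξ ⟨hξ, h1⟩ ?_,
      d.isMinimizer_psi, fun φ hφ => d.eq_psi_of_isMinimizer hφ,
      FifthKdV.tsupport_psi (c := 0) d.mem.1 d.mem.2.le fun ξ hξ _ => (hl ξ hξ).ne'⟩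
    rintro ⟨rfl, rfl⟩
    exact hne ⟨by linarith, rfl⟩
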